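/- Let $\delta\in\mathbb Z/2\mathbb Z$, let $\mathbb R\cup\{\infty\}$ be the compactified real line, with coordinate $x$ on $\mathbb R$ and $y=1/x$ near $\infty$, and let all functions and distributions be complex valued. Distributions are dual to compactly supported smooth measures, so they transform like functions under changes of coordinates. A distribution $\sigma$ defined near a point $p\in\mathbb R\cup\{\infty\}$ \emph{vanishes to order} $k\ge 0$ at $p$ if on some open neighborhood $U$ of $p$ it can be written as a finite sum $\sigma=\sum_j f_jD_jh_j$, where $f_j\in C^\infty(U)$ vanishes to order $k$ at $p$, $h_j\in L^\infty_{\mathrm{loc}}(U)$, and $D_j$ is a linear differential operator on $U$ with smooth coefficients that is tangential to $\{p\}$, i.e. $D_j$ maps smooth functions (on open subsets of $U$) vanishing to order $m$ at $p$ to functions vanishing to order $m$ at $p$, for every $m\ge 0$. It \emph{vanishes to infinite order} at $p$ if it vanishes to order $k$ for every $k\ge0$. A distribution on the complement of $\{p\}$ \emph{extends canonically across} $p$ if it is the restriction of a distribution on the full space that vanishes to infinite order at $p$. Let $\mathcal S'_\delta(\mathbb R)_{\infty,\infty}$ be the space of tempered distributions $\sigma$ on $\mathbb R$ with $\sigma(-x)=(-1)^\delta\sigma(x)$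 that vanish to infinite order at $0$ and extend canonically across $\infty$. Let $\mathcal O_{\mathrm{pg}}(\mathbb C)$ be the space of entire functions $H$ of moderate growth on vertical strips: for all real $a<b$ there are $T,C>0$ and $N\in\mathbb N$ such that $|H(s)|\le C\,|\operatorname{Im}s|^N$ whenever $a\le\operatorname{Re}s\le b$ and $|\operatorname{Im}s|\ge T$. For $\sigma\in\mathcal S'_\delta(\mathbb R)_{\infty,\infty}$ and $s\in\mathbb C$, the measure with distribution coefficients $(\operatorname{sg}x)^\delta|x|^{s-1}\sigma(x)\,dx$ on $\mathbb R\setminus\{0\}$ has a unique extension to $\mathbb R\cup\{\infty\}$ whose coefficient (with respect to $dx$ near $0$, and to $dy$ near $\infty$) vanishes to infinite order at $0$ and at $\infty$. Let the signed Mellin transform $$M_\delta\sigma(s)=\int_{\mathbb R}(\operatorname{sg}x)^\delta\,|x|^{s-1}\,\sigma(x)\,dx$$ be the integral of this extension over the compact space $\mathbb R\cup\{\infty\}$ against the constant function $1$. Then $M_\delta\sigma(s)$ is well defined for all $\sigma\in\mathcal S'_\delta(\mathbb R)_{\infty,\infty}$ and $s\in\mathbb C$, and $\sigma\mapsto M_\delta\sigma$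 is a linear isomorphism $$M_\delta:\ \mathcal S'_\delta(\mathbb R)_{\infty,\infty}\ \xrightarrow{\ \sim\ }\ \mathcal O_{\mathrm{pg}}(\mathbb C).$$ -/

import Mathlib

open scoped Distributions SchwartzMap ContDiff
open MeasureTheory TopologicalSpace

noncomputable section

namespace MellinDist

/-- Complex distributions on an open set `Ω ⊆ ℝ`: continuous `ℂ`-linear functionals on
`C_c^∞(Ω)` with its LF topology. A test function `φ` stands for the smooth measure `φ(x) dx`. -/
abbrev Dist (Ω : Opens ℝ) : Type := 𝓓(Ω, ℂ) →L[ℂ] ℂ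

/-- `ℝ ∖ {0}`. -/
def puncturedLine : Opens ℝ := ⟨{0}ᶜ, isOpen_compl_singleton⟩

/-- Extension by zero `C_c^∞(Ω) → C_c^∞(ℝ)`; restriction of distributions is its transpose. -/
def incl {Ω : Opens ℝ} : 𝓓(Ω, ℂ) →L[ℂ] 𝓓((⊤ : Opens ℝ), ℂ) := TestFunction.monoCLM ℂ

theorem incl_apply {Ω : Opens ℝ} (φ : 𝓓(Ω, ℂ)) (x : ℝ) : incl φ x = φ x := by
  simp [incl]

/-- The product of a test function on `Ω` with a function which is smooth on `Ω`. -/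
def mulTest {Ω : Opens ℝ} (g : ℝ → ℂ) (hg : ContDiffOn ℝ ∞ g Ω) (φ : 𝓓(Ω, ℂ)) : 𝓓(Ω, ℂ) where
  toFun x := g x * φ x
  contDiff' := by
    refine contDiff_iff_contDiffAt.2 fun x => ?_
    by_cases hx : x ∈ tsupport (fun x => g x * φ x)
    swap
    · exact contDiffAt_const.congr_of_eventuallyEq (notMem_tsupport_iff_eventuallyEq.1 hx)
    have hx' : x ∈ Ω := φ.tsupport_subset (tsupport_mul_subset_right hx)
    exact (hg.contDiffAt (Ω.isOpen.mem_nhds hx')).mul φ.contDiff.contDiffAt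
  hasCompactSupport' := φ.hasCompactSupport.mul_left
  tsupport_subset' := tsupport_mul_subset_right.trans φ.tsupport_subset

theorem ne_zero_of_mem_tsupport (φ : 𝓓(puncturedLine, ℂ)) {x : ℝ} (hx : x ∈ tsupport φ) :
    x ≠ 0 := φ.tsupport_subset hx

theorem isCompact_inv_tsupport (φ : 𝓓(puncturedLine, ℂ)) :
    IsCompact ((fun x : ℝ => x⁻¹) '' tsupport φ) :=
  φ.hasCompactSupport.isCompact.image_of_continuousOn
    (continuousOn_inv₀.mono fun _ hx => ne_zero_of_mem_tsupport φ hx)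

theorem tsupport_inv_subset (φ : 𝓓(puncturedLine, ℂ)) :
    tsupport (fun x : ℝ => φ x⁻¹) ⊆ (fun x : ℝ => x⁻¹) '' tsupport φ :=
  closure_minimal (fun x hx => ⟨x⁻¹, subset_tsupport _ hx, inv_inv x⟩)
    (isCompact_inv_tsupport φ).isClosed

/-- The substitution `φ(x) ↦ φ(1/x)` on `C_c^∞(ℝ ∖ {0})`. -/
def invTest (φ : 𝓓(puncturedLine, ℂ)) : 𝓓(puncturedLine, ℂ) where
  toFun x := φ x⁻¹
  contDiff' := by
    refine contDiff_iff_contDiffAt.2 fun x => ?_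
    by_cases hx : x ∈ tsupport (fun x : ℝ => φ x⁻¹)
    · obtain ⟨y, hy, rfl⟩ := tsupport_inv_subset φ hx
      exact φ.contDiff.contDiffAt.comp _
        (contDiffAt_inv ℝ (inv_ne_zero (ne_zero_of_mem_tsupport φ hy)))
    · exact contDiffAt_const.congr_of_eventuallyEq (notMem_tsupport_iff_eventuallyEq.1 hx)
  hasCompactSupport' :=
    (isCompact_inv_tsupport φ).of_isClosed_subset (isClosed_tsupport _) (tsupport_inv_subset φ)
  tsupport_subset' := by
    intro x hx
    obtain ⟨y, hy, rfl⟩ := tsupport_inv_subset φ hx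
    exact inv_ne_zero (ne_zero_of_mem_tsupport φ hy)

theorem contDiffOn_inv_sq :
    ContDiffOn ℝ ∞ (fun x : ℝ => ((x : ℂ) ^ 2)⁻¹) (puncturedLine : Set ℝ) := by
  intro x hx
  have hx' : ((x : ℂ) ^ 2) ≠ 0 := pow_ne_zero _ (Complex.ofReal_ne_zero.2 hx)
  exact ((Complex.ofRealCLM.contDiff.contDiffAt.pow 2).inv hx').contDiffWithinAt

/-- The inclusion `C_c^∞(Ω) → 𝓢(ℝ)`. -/
def toSchwartz {Ω : Opens ℝ} : 𝓓(Ω, ℂ) →L[ℂ] 𝓢(ℝ, ℂ) :=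
  TestFunction.mkCLM ℂ (fun φ => φ.hasCompactSupport.toSchwartzMap φ.contDiff)
    (fun _ _ => rfl) (fun _ _ => rfl) (by
      intro K hK
      let L : 𝓓_{K}(ℝ, ℂ) →ₗ[ℂ] 𝓢(ℝ, ℂ) :=
        { toFun := fun φ => φ.hasCompactSupport.toSchwartzMap φ.contDiff
          map_add' := fun _ _ => rfl
          map_smul' := fun _ _ => rfl }
      refine WithSeminorms.continuous_of_isBounded
        (ContDiffMapSupportedIn.withSeminorms ℂ ℝ ℂ ⊤ K) (schwartz_withSeminorms ℂ ℝ ℂ) L ?_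
      rintro ⟨k, n⟩
      obtain ⟨R, hR⟩ := K.isCompact.isBounded.exists_norm_le
      refine ⟨{n}, ⟨(max R 0) ^ k, pow_nonneg (le_max_right _ _) k⟩, fun φ => ?_⟩
      simp only [Finset.sup_singleton]
      refine SchwartzMap.seminorm_le_bound ℂ k n _
        (mul_nonneg (pow_nonneg (le_max_right _ _) k) (apply_nonneg _ _)) fun x => ?_
      change ‖x‖ ^ k * ‖iteratedFDeriv ℝ n φ x‖ ≤
        (max R 0) ^ k * ContDiffMapSupportedIn.seminorm ℂ ℝ ℂ ⊤ K n φ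
      by_cases hx : x ∈ K
      · gcongr
        · exact (hR x hx).trans (le_max_left _ _)
        · exact ContDiffMapSupportedIn.norm_iteratedFDeriv_apply_le_seminorm_top ℂ
      · rw [φ.iteratedFDeriv_zero_on_compl hx]
        simp only [Pi.zero_apply, norm_zero, mul_zero]
        exact mul_nonneg (by positivity) (apply_nonneg _ _))

/-- A tempered distribution regarded as a distribution on `ℝ`. -/
def ofTempered (σ : 𝓢'(ℝ, ℂ)) : Dist ⊤ where
  toFun φ := σ (toSchwartz φ)
  map_add' φ ψ := by simp
  map_smul' c φ := by simp
  cont := (map_continuous σ).comp toSchwartz.continuous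

/-- `g` is smooth on the neighborhood `V` of `0` and vanishes to order `k` at `0`, i.e. it is a
section over `V` of the `k`-th power of the ideal of functions vanishing at `0`. -/
def SmoothVanishing (V : Opens ℝ) (k : ℕ) (g : ℝ → ℂ) : Prop :=
  ContDiffOn ℝ ∞ g V ∧ ∀ j < k, iteratedDeriv j g 0 = 0

/-- A linear differential operator `∑_{i ≤ order} a_i(x) (d/dx)^i` with smooth coefficients
on `U`. -/
structure DiffOp (U : Opens ℝ) where
  order : ℕ
  coeff : ℕ → ℝ → ℂ
  smooth : ∀ i, ContDiffOn ℝ ∞ (coeff i) U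

namespace DiffOp

variable {U V : Opens ℝ}

/-- `D g`. -/
def apply (D : DiffOp U) (g : ℝ → ℂ) (x : ℝ) : ℂ :=
  ∑ i ∈ Finset.range (D.order + 1), D.coeff i x * iteratedDeriv i g x

/-- The formal transpose `Dᵗ g = ∑ (-1)^i (d/dx)^i (a_i g)` relative to `dx`. -/
def transpose (D : DiffOp U) (g : ℝ → ℂ) (x : ℝ) : ℂ :=
  ∑ i ∈ Finset.range (D.order + 1), (-1) ^ i * iteratedDeriv i (fun y => D.coeff i y * g y) x

/-- `D` is tangential to `{0}`: it preserves all powers of the ideal sheaf of `{0}`. -/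
def IsTangential (D : DiffOp U) : Prop :=
  ∀ V : Opens ℝ, V ≤ U → 0 ∈ V → ∀ (k : ℕ) (g : ℝ → ℂ),
    SmoothVanishing V k g → SmoothVanishing V k (D.apply g)

/-- Restriction of a differential operator to a smaller open set. -/
def restrict (D : DiffOp U) (h : V ≤ U) : DiffOp V :=
  ⟨D.order, D.coeff, fun i => (D.smooth i).mono h⟩

end DiffOp

/-- `h ∈ L^∞_loc(U)`. -/
def LocBounded (U : Opens ℝ) (h : ℝ → ℂ) : Prop :=
  ∀ K : Set ℝ, IsCompact K → K ⊆ U → MemLp h ⊤ (volume.restrict K)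

/-- The distribution `T` on `ℝ` vanishes to order `k` at `0`: on some open neighborhood `U` of `0`,
`T = ∑_j f_j D_j h_j` with `f_j` smooth and vanishing to order `k` at `0`, `D_j` differential
operators tangential to `{0}`, and `h_j ∈ L^∞_loc(U)`. The pairing of `f D h` with `φ(x) dx` is
`∫ h(x) (Dᵗ (f φ))(x) dx`. -/
def VanishesToOrder (k : ℕ) (T : Dist ⊤) : Prop :=
  ∃ U : Opens ℝ, 0 ∈ U ∧ ∃ (N : ℕ) (f : Fin N → ℝ → ℂ) (D : Fin N → DiffOp U)
    (h : Fin N → ℝ → ℂ),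
    (∀ j, SmoothVanishing U k (f j)) ∧ (∀ j, (D j).IsTangential) ∧ (∀ j, LocBounded U (h j)) ∧
    ∀ φ : 𝓓(U, ℂ),
      T (incl φ) = ∑ j, ∫ x, h j x * (D j).transpose (fun y => f j y * φ y) x

/-- `T` vanishes to infinite order at `0`. -/
def VanishesToInfiniteOrder (T : Dist ⊤) : Prop := ∀ k : ℕ, VanishesToOrder k T

/-- A distribution on `ℝ ∪ {∞}`, given by its expressions `fin` in the coordinate `x` on `ℝ` and
`inf` in the coordinate `y = 1/x` on `(ℝ ∪ {∞}) ∖ {0}`. Distributions transform like functions: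
on the overlap `fin(x) = inf(1/x)`, i.e. `∫ fin(x) φ(x) dx = ∫ inf(y) φ(1/y) y⁻² dy`. -/
structure ProjDist where
  fin : Dist ⊤
  inf : Dist ⊤
  compat : ∀ φ : 𝓓(puncturedLine, ℂ),
    fin (incl φ) = inf (incl (mulTest _ contDiffOn_inv_sq (invTest φ)))

/-- The distribution `σ` on `ℝ` has a canonical extension across `∞`: it is the restriction of a
distribution on `ℝ ∪ {∞}` which vanishes to infinite order at `∞`, i.e. at `y = 0`. -/
def ExtendsCanonicallyAcrossInfty (σ : Dist ⊤) : Prop :=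
  ∃ T : ProjDist, T.fin = σ ∧ VanishesToInfiniteOrder T.inf

/-- A measure with distribution coefficients on `ℝ ∪ {∞}`, equal to `fin(x) dx` on `ℝ` and
`inf(y) dy` on `(ℝ ∪ {∞}) ∖ {0}`, where `y = 1/x`. -/
structure ProjDensity where
  fin : Dist ⊤
  inf : Dist ⊤
  compat : ∀ φ : 𝓓(puncturedLine, ℂ), fin (incl φ) = inf (incl (invTest φ))

/-- `z` is the integral of `μ` over `ℝ ∪ {∞}` against the constant function `1`, computed by a
smooth partition of unity `1 = φ(x) + χ(1/x)` with `φ`, `χ` compactly supported in the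
two coordinate domains. -/
def ProjDensity.HasIntegral (μ : ProjDensity) (z : ℂ) : Prop :=
  ∃ φ χ : 𝓓((⊤ : Opens ℝ), ℂ), (∀ x : ℝ, x ≠ 0 → φ x + χ x⁻¹ = 1) ∧ z = μ.fin φ + μ.inf χ

/-- The kernel `(sg x)^δ |x|^(s-1)`. -/
def mellinKernel (δ : ZMod 2) (s : ℂ) (x : ℝ) : ℂ :=
  ((Real.sign x : ℝ) : ℂ) ^ δ.val * ((|x| : ℝ) : ℂ) ^ (s - 1)

theorem contDiffOn_mellinKernel (δ : ZMod 2) (s : ℂ) :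
    ContDiffOn ℝ ∞ (mellinKernel δ s) (puncturedLine : Set ℝ) := by
  intro x hx
  have hx0 : x ≠ 0 := hx
  refine ContDiffAt.contDiffWithinAt (ContDiffAt.mul ?_ ?_)
  · have : ∀ᶠ y in nhds x, ((Real.sign y : ℝ) : ℂ) ^ δ.val = ((Real.sign x : ℝ) : ℂ) ^ δ.val := by
      rcases lt_or_gt_of_ne hx0 with h | h
      · filter_upwards [Iio_mem_nhds h] with y hy
        rw [Real.sign_of_neg hy, Real.sign_of_neg h]
      · filter_upwards [Ioi_mem_nhds h] with y hy
        rw [Real.sign_of_pos hy, Real.sign_of_pos h]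
    exact contDiffAt_const.congr_of_eventuallyEq this
  · have h1 : ∀ᶠ y in nhds x, ((|y| : ℝ) : ℂ) ^ (s - 1) =
        Complex.exp (((Real.log y : ℝ) : ℂ) * (s - 1)) := by
      filter_upwards [isOpen_ne.mem_nhds hx0] with y hy
      rw [Complex.cpow_def_of_ne_zero (by simpa using hy), ← Complex.ofReal_log (abs_nonneg y),
        Real.log_abs]
    refine ContDiffAt.congr_of_eventuallyEq ?_ h1
    exact (Complex.contDiff_exp.contDiffAt).comp x
      ((Complex.ofRealCLM.contDiff.contDiffAt.comp x (Real.contDiffAt_log.2 hx0)).mul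
        contDiffAt_const)

/-- `z` is the value at `s` of the signed Mellin transform
`M_δ σ(s) = ∫_{ℝ ∪ {∞}} (sg x)^δ |x|^(s-1) σ(x) dx`: the distribution-valued measure
`(sg x)^δ |x|^(s-1) σ(x) dx` on `ℝ ∖ {0}` is extended across `0` and across `∞` so as to vanish to
infinite order there, and the extension `μ` is integrated against the constant function `1`. -/
def HasSignedMellinAt (δ : ZMod 2) (σ : 𝓢'(ℝ, ℂ)) (s z : ℂ) : Prop :=
  ∃ μ : ProjDensity,
    (∀ φ : 𝓓(puncturedLine, ℂ), μ.fin (incl φ) =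
      ofTempered σ (incl (mulTest (mellinKernel δ s) (contDiffOn_mellinKernel δ s) φ))) ∧
    VanishesToInfiniteOrder μ.fin ∧ VanishesToInfiniteOrder μ.inf ∧ μ.HasIntegral z

/-- `σ(-x) = (-1)^δ σ(x)`. -/
def HasParity (δ : ZMod 2) (σ : 𝓢'(ℝ, ℂ)) : Prop :=
  ∀ f : 𝓢(ℝ, ℂ), σ (SchwartzMap.compCLMOfContinuousLinearEquiv ℂ (ContinuousLinearEquiv.neg ℝ) f) =
    (-1) ^ δ.val * σ f

/-- Moderate growth on vertical strips, i.e. locally uniform polynomial growth on vertical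
lines. -/
def ModerateGrowth (H : ℂ → ℂ) : Prop :=
  ∀ a b : ℝ, a < b → ∃ (T C : ℝ) (N : ℕ), 0 < T ∧ 0 < C ∧
    ∀ s : ℂ, a ≤ s.re → s.re ≤ b → T ≤ |s.im| → ‖H s‖ ≤ C * |s.im| ^ N

theorem VanishesToOrder.zero (k : ℕ) : VanishesToOrder k 0 :=
  ⟨⊤, trivial, 0, Fin.elim0, Fin.elim0, Fin.elim0, fun j => j.elim0, fun j => j.elim0,
    fun j => j.elim0, fun φ => by simp⟩

theorem SmoothVanishing.mono {U V : Opens ℝ} (h : V ≤ U) {k : ℕ} {g : ℝ → ℂ}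
    (hg : SmoothVanishing U k g) : SmoothVanishing V k g :=
  ⟨hg.1.mono h, hg.2⟩

theorem LocBounded.mono {U V : Opens ℝ} (h : V ≤ U) {g : ℝ → ℂ}
    (hg : LocBounded U g) : LocBounded V g :=
  fun K hK hKV => hg K hK (hKV.trans h)

theorem DiffOp.IsTangential.restrict {U V : Opens ℝ} {D : DiffOp U} (hD : D.IsTangential)
    (h : V ≤ U) : (D.restrict h).IsTangential :=
  fun W hW h0 k g hg => hD W (hW.trans h) h0 k g hg

theorem VanishesToOrder.add {k : ℕ} {S T : Dist ⊤} (hS : VanishesToOrder k S)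
    (hT : VanishesToOrder k T) : VanishesToOrder k (S + T) := by
  obtain ⟨U, hU, M, f, D, h, hf, hD, hh, hSe⟩ := hS
  obtain ⟨V, hV, N, f', D', h', hf', hD', hh', hTe⟩ := hT
  have l1 : U ⊓ V ≤ U := inf_le_left
  have l2 : U ⊓ V ≤ V := inf_le_right
  refine ⟨U ⊓ V, ⟨hU, hV⟩, M + N, Fin.append f f',
    Fin.append (fun j => (D j).restrict l1) (fun j => (D' j).restrict l2), Fin.append h h',
    fun j => ?_, fun j => ?_, fun j => ?_, fun φ => ?_⟩
  · induction j using Fin.addCases with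
    | left i => simpa using (hf i).mono l1
    | right i => simpa using (hf' i).mono l2
  · induction j using Fin.addCases with
    | left i => simpa using (hD i).restrict l1
    | right i => simpa using (hD' i).restrict l2
  · induction j using Fin.addCases with
    | left i => simpa using (hh i).mono l1
    | right i => simpa using (hh' i).mono l2
  · have e1 := hSe ⟨φ, φ.contDiff, φ.hasCompactSupport, φ.tsupport_subset.trans l1⟩
    have e2 := hTe ⟨φ, φ.contDiff, φ.hasCompactSupport, φ.tsupport_subset.trans l2⟩
    have i1 : incl (⟨φ, φ.contDiff, φ.hasCompactSupport, φ.tsupport_subset.trans l1⟩ : 𝓓(U, ℂ)) =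
        incl φ := by
      ext x
      rw [incl_apply, incl_apply]
      rfl
    have i2 : incl (⟨φ, φ.contDiff, φ.hasCompactSupport, φ.tsupport_subset.trans l2⟩ : 𝓓(V, ℂ)) =
        incl φ := by
      ext x
      rw [incl_apply, incl_apply]
      rfl
    rw [i1] at e1
    rw [i2] at e2
    rw [Fin.sum_univ_add]
    simp only [Fin.append_left, Fin.append_right]
    change S (incl φ) + T (incl φ) = _
    rw [e1, e2]
    rfl

theorem VanishesToOrder.smul {k : ℕ} {T : Dist ⊤} (c : ℂ) (hT : VanishesToOrder k T) :
    VanishesToOrder k (c • T) := by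
  obtain ⟨U, hU, N, f, D, h, hf, hD, hh, hTe⟩ := hT
  refine ⟨U, hU, N, f, D, fun j x => c * h j x, hf, hD,
    fun j K hK hKU => (hh j K hK hKU).const_mul c, fun φ => ?_⟩
  change c * T (incl φ) = _
  rw [hTe φ, Finset.mul_sum]
  refine Finset.sum_congr rfl fun j _ => ?_
  rw [← integral_const_mul]
  simp only [mul_assoc]

/-- The space of tempered distributions of parity `δ` which vanish to infinite order at `0` and
extend canonically across `∞`. -/
def mellinSource (δ : ZMod 2) : Submodule ℂ 𝓢'(ℝ, ℂ) where
  carrier := {σ | HasParity δ σ ∧ VanishesToInfiniteOrder (ofTempered σ) ∧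
    ExtendsCanonicallyAcrossInfty (ofTempered σ)}
  zero_mem' := by
    refine ⟨fun f => ?_, fun k => VanishesToOrder.zero k,
      ⟨⟨0, 0, fun φ => rfl⟩, rfl, fun k => VanishesToOrder.zero k⟩⟩
    change (0 : ℂ) = (-1) ^ δ.val * 0
    simp
  add_mem' := by
    rintro σ τ ⟨p1, v1, T1, e1, w1⟩ ⟨p2, v2, T2, e2, w2⟩
    refine ⟨fun f => ?_, fun k => (v1 k).add (v2 k),
      ⟨⟨T1.fin + T2.fin, T1.inf + T2.inf, fun φ => ?_⟩, ?_, fun k => (w1 k).add (w2 k)⟩⟩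
    · change σ _ + τ _ = (-1) ^ δ.val * (σ f + τ f)
      rw [p1 f, p2 f, mul_add]
    · exact congrArg₂ (· + ·) (T1.compat φ) (T2.compat φ)
    · change T1.fin + T2.fin = _
      rw [e1, e2]
      rfl
  smul_mem' := by
    rintro c σ ⟨p, v, T, e, w⟩
    refine ⟨fun f => ?_, fun k => (v k).smul c,
      ⟨⟨c • T.fin, c • T.inf, fun φ => congrArg (c * ·) (T.compat φ)⟩, ?_,
        fun k => (w k).smul c⟩⟩
    · change c * σ _ = (-1) ^ δ.val * (c * σ f)
      rw [p f]
      ring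
    · change c • T.fin = _
      rw [e]
      rfl

/-- The space of entire functions of moderate growth on vertical strips. -/
def entireModerate : Submodule ℂ (ℂ → ℂ) where
  carrier := {H | Differentiable ℂ H ∧ ModerateGrowth H}
  zero_mem' := ⟨differentiable_const 0, fun a b _ =>
    ⟨1, 1, 0, one_pos, one_pos, fun s _ _ _ => by simp⟩⟩
  add_mem' := by
    rintro G H ⟨dG, gG⟩ ⟨dH, gH⟩
    refine ⟨dG.add dH, fun a b hab => ?_⟩
    obtain ⟨T, C, N, hT, hC, h⟩ := gG a b hab
    obtain ⟨T', C', N', hT', hC', h'⟩ := gH a b hab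
    refine ⟨max 1 (max T T'), C + C', max N N', by positivity, by positivity,
      fun s h1 h2 h3 => ?_⟩
    have k1 : 1 ≤ |s.im| := (le_max_left _ _).trans h3
    have k2 : T ≤ |s.im| := ((le_max_left _ _).trans (le_max_right _ _)).trans h3
    have k3 : T' ≤ |s.im| := ((le_max_right _ _).trans (le_max_right _ _)).trans h3
    calc ‖G s + H s‖ ≤ ‖G s‖ + ‖H s‖ := norm_add_le _ _
      _ ≤ C * |s.im| ^ N + C' * |s.im| ^ N' := add_le_add (h s h1 h2 k2) (h' s h1 h2 k3)
      _ ≤ C * |s.im| ^ max N N' + C' * |s.im| ^ max N N' := by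
        gcongr
        · exact le_max_left _ _
        · exact le_max_right _ _
      _ = (C + C') * |s.im| ^ max N N' := by ring
  smul_mem' := by
    rintro c H ⟨dH, gH⟩
    refine ⟨dH.const_smul c, fun a b hab => ?_⟩
    obtain ⟨T, C, N, hT, hC, h⟩ := gH a b hab
    refine ⟨T, (‖c‖ + 1) * C, N, hT, by positivity, fun s h1 h2 h3 => ?_⟩
    have := h s h1 h2 h3
    calc ‖c * H s‖ = ‖c‖ * ‖H s‖ := norm_mul _ _
      _ ≤ (‖c‖ + 1) * (C * |s.im| ^ N) := by
        gcongr
        linarith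
      _ = (‖c‖ + 1) * C * |s.im| ^ N := by ring

end MellinDist

end

/-! Everything on `ℝ ∖ {0}` is measured with the Euler operator θ = x d/dx: it commutes with
dilations, changes sign under x ↦ 1/x, and has the Mellin kernel K_s as eigenfunction with
eigenvalue s - 1.

Estimate. Tangentiality to {0} forces the i-th coefficient of an operator to vanish to order i.
Hence a distribution T vanishing to order k at 0 satisfies, on test functions supported near 0, a
bound by finitely many sup |x|^k |θ^l φ| (`VanishesToOrder.exists_bound`). Using this at 0 and at ∞
with k large, σ is bounded on C_c^∞(ℝ ∖ {0}), for every a, by finitely many sup w_a |θ^l φ|, where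
w_a(x) = |x| min(|x|, 1/|x|)^a (`weightBounded_of_mem_mellinSource`).

From σ to H. By Hahn–Banach, σ(φ) = Λ((w_a θ^l φ)_l) with Λ continuous on a finite power of the
bounded functions. For |re s| < a the jet ((s-1)^l w_a K_s)_l lies in that Banach space, is
holomorphic in s and grows polynomially, so H(s) = Λ(jet of K_s) is holomorphic of moderate growth.
Truncations of K_s converge to it in norm; so H(s) is a limit of values of σ, independent of a and
Λ, and it must equal the integral of every canonical extension of the density. Applying Λ under the
integral sign of Mellin inversion gives σ(φ) as a line integral of H against the pairing of φ with
the kernel (`exists_transform`).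

From H to σ. The same line integral defines a tempered distribution for any H of moderate growth,
since integration by parts with θ gives the pairing arbitrary polynomial decay. Moving the contour
to re s = -1/2 - 2k displays it as x^(2k) times a tangential operator applied to a locally bounded
function. Inversion x ↦ 1/x reflects H and multiplication by K_s translates it, so the extension
across ∞ and the canonical density are again inverse transforms (`inverseMellin_mem_mellinSource`,
`exists_projDensity`).

The two constructions are mutually inverse: line integrals determine H, by Fourier uniqueness
applied to dilates of φ and the identity theorem (`eq_zero_of_lineInt_eq_zero`); and H determines σ
off 0, hence everywhere, because vanishing to order 1 excludes distributions supported at 0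
(`VanishesToOrder.eq_zero`). -/

noncomputable section
namespace MellinDist

open Set Filter Topology

/-- The Euler operator `x d/dx`. -/
def euler (f : ℝ → ℂ) (x : ℝ) : ℂ := x * deriv f x

/-! ### Calculus of the Euler operator -/

section Euler

variable {s : Set ℝ} {f g : ℝ → ℂ}

theorem contDiffOn_deriv (hs : IsOpen s) (hf : ContDiffOn ℝ ∞ f s) :
    ContDiffOn ℝ ∞ (deriv f) s :=
  hf.deriv_of_isOpen hs (by simp)

theorem contDiffOn_euler (hs : IsOpen s) (hf : ContDiffOn ℝ ∞ f s) :
    ContDiffOn ℝ ∞ (euler f) s :=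
  Complex.ofRealCLM.contDiff.contDiffOn.mul (contDiffOn_deriv hs hf)

theorem contDiffOn_euler_iterate (hs : IsOpen s) (hf : ContDiffOn ℝ ∞ f s) (j : ℕ) :
    ContDiffOn ℝ ∞ (euler^[j] f) s := by
  induction j generalizing f with
  | zero => exact hf
  | succ j ih => exact ih (contDiffOn_euler hs hf)

theorem contDiff_euler_iterate (hf : ContDiff ℝ ∞ f) (j : ℕ) :
    ContDiff ℝ ∞ (euler^[j] f) :=
  contDiffOn_univ.1 (contDiffOn_euler_iterate isOpen_univ hf.contDiffOn j)

theorem differentiableAt_of_contDiffOn (hs : IsOpen s) (hf : ContDiffOn ℝ ∞ f s) {x : ℝ}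
    (hx : x ∈ s) : DifferentiableAt ℝ f x :=
  (hf.contDiffAt (hs.mem_nhds hx)).differentiableAt (by simp)

theorem contDiffOn_iteratedDeriv (hs : IsOpen s) (hf : ContDiffOn ℝ ∞ f s) (n : ℕ) :
    ContDiffOn ℝ ∞ (iteratedDeriv n f) s := by
  induction n with
  | zero => simpa using hf
  | succ n ih =>
    rw [iteratedDeriv_succ]
    exact contDiffOn_deriv hs ih

theorem euler_congr (hs : IsOpen s) (h : EqOn f g s) : EqOn (euler f) (euler g) s := by
  intro x hx
  simp only [euler]
  rw [(h.eventuallyEq_of_mem (hs.mem_nhds hx)).deriv_eq]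

theorem euler_iterate_congr (hs : IsOpen s) (h : EqOn f g s) (j : ℕ) :
    EqOn (euler^[j] f) (euler^[j] g) s := by
  induction j generalizing f g with
  | zero => exact h
  | succ j ih => exact ih (euler_congr hs h)

theorem euler_iterate_add (hs : IsOpen s) (hf : ContDiffOn ℝ ∞ f s) (hg : ContDiffOn ℝ ∞ g s)
    (j : ℕ) : EqOn (euler^[j] (fun x => f x + g x)) (fun x => euler^[j] f x + euler^[j] g x) s := by
  induction j generalizing f g with
  | zero => exact fun _ _ => rfl
  | succ j ih =>
    have h : EqOn (euler fun x => f x + g x) (fun x => euler f x + euler g x) s := by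
      intro x hx
      simp only [euler]
      rw [deriv_fun_add (differentiableAt_of_contDiffOn hs hf hx)
        (differentiableAt_of_contDiffOn hs hg hx), mul_add]
    exact (euler_iterate_congr hs h j).trans (ih (contDiffOn_euler hs hf) (contDiffOn_euler hs hg))

theorem euler_const_mul (c : ℂ) (f : ℝ → ℂ) :
    euler (fun x => c * f x) = fun x => c * euler f x := by
  ext x
  simp only [euler]
  rw [deriv_const_mul_field]
  ring

theorem euler_iterate_const_mul (c : ℂ) (f : ℝ → ℂ) (j : ℕ) :
    euler^[j] (fun x => c * f x) = fun x => c * euler^[j] f x := by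
  induction j generalizing f with
  | zero => rfl
  | succ j ih => rw [Function.iterate_succ_apply, euler_const_mul, ih]; rfl

theorem euler_mul (hs : IsOpen s) (hf : ContDiffOn ℝ ∞ f s) (hg : ContDiffOn ℝ ∞ g s) :
    EqOn (euler fun x => f x * g x) (fun x => euler f x * g x + f x * euler g x) s := by
  intro x hx
  simp only [euler]
  rw [deriv_fun_mul (differentiableAt_of_contDiffOn hs hf hx)
    (differentiableAt_of_contDiffOn hs hg hx)]
  ring

/-- The Euler operator is a derivation, so the iterated Leibniz rule produces 2^j products, counted
with multiplicity. -/
theorem norm_euler_iterate_mul_le (hs : IsOpen s) (hf : ContDiffOn ℝ ∞ f s)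
    (hg : ContDiffOn ℝ ∞ g s) {x : ℝ} (hx : x ∈ s) {A B : ℝ} (j : ℕ)
    (hA : ∀ i ≤ j, ‖euler^[i] f x‖ ≤ A) (hB : ∀ i ≤ j, ‖euler^[i] g x‖ ≤ B) :
    ‖euler^[j] (fun y => f y * g y) x‖ ≤ 2 ^ j * A * B := by
  induction j generalizing f g with
  | zero =>
    simpa using mul_le_mul (hA 0 le_rfl) (hB 0 le_rfl) (norm_nonneg _)
      ((norm_nonneg _).trans (hA 0 le_rfl))
  | succ j ih =>
    have h1 := ih (contDiffOn_euler hs hf) hg (fun i hi => hA (i + 1) (by omega))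
      (fun i hi => hB i (by omega))
    have h2 := ih hf (contDiffOn_euler hs hg) (fun i hi => hA i (by omega))
      (fun i hi => hB (i + 1) (by omega))
    rw [Function.iterate_succ_apply, euler_iterate_congr hs (euler_mul hs hf hg) j hx,
      euler_iterate_add hs ((contDiffOn_euler hs hf).mul hg) (hf.mul (contDiffOn_euler hs hg)) j hx]
    calc _ ≤ _ := norm_add_le _ _
      _ ≤ _ := add_le_add h1 h2
      _ = _ := by ring

theorem iteratedDeriv_euler (hs : IsOpen s) (hf : ContDiffOn ℝ ∞ f s) (l : ℕ) :
    EqOn (iteratedDeriv l (euler f))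
      (fun x => x * iteratedDeriv (l + 1) f x + l * iteratedDeriv l f x) s := by
  have hd : ∀ n : ℕ, ∀ x ∈ s, DifferentiableAt ℝ (iteratedDeriv n f) x := fun n _ hx =>
    differentiableAt_of_contDiffOn hs (contDiffOn_iteratedDeriv hs hf n) hx
  induction l with
  | zero => intro x _; simp [euler, iteratedDeriv_one]
  | succ l ih =>
    intro x hx
    rw [iteratedDeriv_succ, (ih.eventuallyEq_of_mem (hs.mem_nhds hx)).deriv_eq]
    have h1 := ((Complex.ofRealCLM.hasDerivAt (x := x)).mul (hd (l + 1) x hx).hasDerivAt).add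
      ((hd l x hx).hasDerivAt.const_mul (l : ℂ))
    refine h1.deriv.trans ?_
    simp only [← iteratedDeriv_succ, Complex.ofRealCLM_apply, Complex.ofReal_one]
    push_cast
    ring

/-- From x f^(l+1) = (θf)^(l) - l f^(l), induction on l trades x^l d^l/dx^l for iterates of θ. The
constant comes from l! + l · l! = (l+1)!. -/
theorem norm_pow_mul_iteratedDeriv_le (hs : IsOpen s) (hf : ContDiffOn ℝ ∞ f s) {x : ℝ}
    (hx : x ∈ s) {A : ℝ} (l : ℕ) (hA : ∀ i ≤ l, ‖euler^[i] f x‖ ≤ A) :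
    |x| ^ l * ‖iteratedDeriv l f x‖ ≤ l.factorial * A := by
  induction l generalizing f with
  | zero => simpa using hA 0 le_rfl
  | succ l ih =>
    have h1 := ih (contDiffOn_euler hs hf) (fun i hi => hA (i + 1) (by omega))
    have h2 := ih hf (fun i hi => hA i (by omega))
    rw [iteratedDeriv_euler hs hf l hx] at h1
    have h3 : (x : ℂ) * iteratedDeriv (l + 1) f x =
        (x * iteratedDeriv (l + 1) f x + l * iteratedDeriv l f x) - l * iteratedDeriv l f x := by
      ring
    calc |x| ^ (l + 1) * ‖iteratedDeriv (l + 1) f x‖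
        = |x| ^ l * ‖(x : ℂ) * iteratedDeriv (l + 1) f x‖ := by
          rw [norm_mul, Complex.norm_real, Real.norm_eq_abs]; ring
      _ ≤ |x| ^ l * (‖x * iteratedDeriv (l + 1) f x + l * iteratedDeriv l f x‖ +
          ‖(l : ℂ) * iteratedDeriv l f x‖) := by
          gcongr
          conv_lhs => rw [h3]
          exact norm_sub_le _ _
      _ = |x| ^ l * ‖x * iteratedDeriv (l + 1) f x + l * iteratedDeriv l f x‖ +
          l * (|x| ^ l * ‖iteratedDeriv l f x‖) := by
          rw [norm_mul, Complex.norm_natCast]; ring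
      _ ≤ l.factorial * A + l * (l.factorial * A) := by gcongr
      _ = (l + 1).factorial * A := by push_cast [Nat.factorial_succ]; ring

theorem euler_comp_mul (f : ℝ → ℂ) (c : ℝ) :
    euler (fun x => f (c * x)) = fun x => euler f (c * x) := by
  ext x
  simp only [euler]
  rw [deriv_comp_mul_left c f x]
  simp only [Complex.real_smul]
  push_cast
  ring

theorem euler_iterate_comp_mul (f : ℝ → ℂ) (c : ℝ) (j : ℕ) :
    euler^[j] (fun x => f (c * x)) = fun x => euler^[j] f (c * x) := by
  induction j generalizing f with
  | zero => rfl
  | succ j ih => rw [Function.iterate_succ_apply, euler_comp_mul, ih]; rfl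

/-- Inversion conjugates θ to -θ; this is why one family of Euler bounds serves at both 0 and ∞. -/
theorem euler_comp_inv (hf : ContDiffOn ℝ ∞ f {0}ᶜ) :
    EqOn (euler (fun x => f x⁻¹)) (fun x => -1 * euler f x⁻¹) {0}ᶜ := by
  intro x hx
  have hx0 : x ≠ 0 := hx
  have hd := differentiableAt_of_contDiffOn isOpen_compl_singleton hf
    (x := x⁻¹) (inv_ne_zero hx0)
  have h := hd.hasDerivAt.scomp x (hasDerivAt_inv hx0)
  simp only [euler]
  rw [show (fun x => f x⁻¹) = f ∘ fun x => x⁻¹ from rfl, h.deriv]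
  have : (x : ℂ) ≠ 0 := Complex.ofReal_ne_zero.2 hx0
  simp only [Complex.real_smul]
  push_cast
  field_simp

theorem euler_iterate_comp_inv (hf : ContDiffOn ℝ ∞ f {0}ᶜ) (j : ℕ) :
    EqOn (euler^[j] (fun x => f x⁻¹)) (fun x => (-1) ^ j * euler^[j] f x⁻¹) {0}ᶜ := by
  induction j generalizing f with
  | zero => intro x _; simp
  | succ j ih =>
    intro x hx
    rw [Function.iterate_succ_apply,
      euler_iterate_congr isOpen_compl_singleton (euler_comp_inv hf) j hx,
      euler_iterate_const_mul]
    simp only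
    rw [ih (contDiffOn_euler isOpen_compl_singleton hf) hx]
    simp only [Function.iterate_succ_apply]
    ring

theorem exists_bound_euler_iterate (hf : ContDiff ℝ ∞ f) (hc : HasCompactSupport f) (N : ℕ) :
    ∃ C : ℝ, 0 ≤ C ∧ ∀ j ≤ N, ∀ x, ‖euler^[j] f x‖ ≤ C := by
  have hcs : ∀ j, HasCompactSupport (euler^[j] f) := by
    intro j
    induction j generalizing f with
    | zero => exact hc
    | succ j ih =>
      exact ih (contDiffOn_univ.1 (contDiffOn_euler isOpen_univ hf.contDiffOn)) hc.deriv.mul_left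
  choose C hC using fun j => (hcs j).exists_bound_of_continuous (contDiff_euler_iterate hf j).continuous
  refine ⟨∑ j ∈ Finset.range (N + 1), |C j|, Finset.sum_nonneg fun _ _ => abs_nonneg _,
    fun j hj x => ((hC j x).trans (le_abs_self _)).trans ?_⟩
  exact Finset.single_le_sum (f := fun j => |C j|) (fun _ _ => abs_nonneg _)
    (Finset.mem_range.2 (by omega))

end Euler

/-! ### The Mellin kernel as an eigenfunction of the Euler operator -/

section Kernel

variable (δ : ZMod 2)

theorem mellinKernel_of_ne_zero (s : ℂ) {x : ℝ} (hx : x ≠ 0) :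
    mellinKernel δ s x =
      ((Real.sign x : ℝ) : ℂ) ^ δ.val * Complex.exp ((s - 1) * Real.log |x|) := by
  rw [mellinKernel, Complex.cpow_def_of_ne_zero (by simpa using hx),
    ← Complex.ofReal_log (abs_nonneg x), mul_comm (s - 1)]

/-- The kernel is homogeneous of degree s - 1 and its sign factor is locally constant, so this is
Euler's identity. -/
theorem euler_mellinKernel (s : ℂ) :
    EqOn (euler (mellinKernel δ s)) (fun x => (s - 1) * mellinKernel δ s x) {0}ᶜ := by
  intro x hx
  have hx0 : x ≠ 0 := hx
  have hsg : ∀ᶠ y in 𝓝 x, Real.sign y = Real.sign x := by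
    rcases lt_or_gt_of_ne hx0 with h | h
    · filter_upwards [Iio_mem_nhds h] with y hy
      rw [Real.sign_of_neg hy, Real.sign_of_neg h]
    · filter_upwards [Ioi_mem_nhds h] with y hy
      rw [Real.sign_of_pos hy, Real.sign_of_pos h]
  have he : mellinKernel δ s =ᶠ[𝓝 x] fun y => ((Real.sign x : ℝ) : ℂ) ^ δ.val *
      Complex.exp ((s - 1) * ((Real.log y : ℝ) : ℂ)) := by
    filter_upwards [hsg, isOpen_ne.mem_nhds hx0] with y hy hy0
    rw [mellinKernel_of_ne_zero δ s hy0, hy, Real.log_abs]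
  have hd : HasDerivAt (fun y => ((Real.sign x : ℝ) : ℂ) ^ δ.val *
      Complex.exp ((s - 1) * ((Real.log y : ℝ) : ℂ))) (((Real.sign x : ℝ) : ℂ) ^ δ.val *
      (Complex.exp ((s - 1) * ((Real.log x : ℝ) : ℂ)) * ((s - 1) * ((x⁻¹ : ℝ) : ℂ)))) x :=
    (((Real.hasDerivAt_log hx0).ofReal_comp.const_mul (s - 1)).cexp).const_mul _
  simp only [euler]
  rw [he.deriv_eq, hd.deriv, he.eq_of_nhds]
  have : (x : ℂ) ≠ 0 := Complex.ofReal_ne_zero.2 hx0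
  push_cast
  field_simp

theorem euler_iterate_mellinKernel (s : ℂ) (j : ℕ) :
    EqOn (euler^[j] (mellinKernel δ s)) (fun x => (s - 1) ^ j * mellinKernel δ s x) {0}ᶜ := by
  induction j with
  | zero => intro x _; simp
  | succ j ih =>
    intro x hx
    rw [Function.iterate_succ_apply,
      euler_iterate_congr isOpen_compl_singleton (euler_mellinKernel δ s) j hx,
      euler_iterate_const_mul]
    simp only
    rw [ih hx]
    ring

theorem norm_sign_pow {x : ℝ} (hx : x ≠ 0) : ‖((Real.sign x : ℝ) : ℂ) ^ δ.val‖ = 1 := by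
  rcases Real.sign_apply_eq_of_ne_zero x hx with h | h <;> simp [h]

theorem norm_mellinKernel (s : ℂ) {x : ℝ} (hx : x ≠ 0) :
    ‖mellinKernel δ s x‖ = |x| ^ (s.re - 1) := by
  rw [mellinKernel, norm_mul, norm_sign_pow δ hx, one_mul,
    Complex.norm_cpow_eq_rpow_re_of_pos (abs_pos.2 hx)]
  simp

end Kernel

/-! ### Vanishing to order k as an estimate -/

section Vanishing

/-- Taylor's bound by induction on m: the derivative is O(|y|^m), and the mean value inequality on
the interval from -|x| to |x| gains one more factor |x|. -/
theorem norm_le_pow_of_iteratedDeriv_eq_zero {V : Set ℝ} (hV : IsOpen V) {r : ℝ}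
    (hrV : Icc (-r) r ⊆ V) (m : ℕ) {g : ℝ → ℂ} (hg : ContDiffOn ℝ ∞ g V)
    (h0 : ∀ j < m, iteratedDeriv j g 0 = 0) :
    ∃ C : ℝ, 0 ≤ C ∧ ∀ x ∈ Icc (-r) r, ‖g x‖ ≤ C * |x| ^ m := by
  induction m generalizing g with
  | zero =>
    obtain ⟨C, hC⟩ := isCompact_Icc.exists_bound_of_continuousOn (hg.continuousOn.mono hrV)
    exact ⟨|C|, abs_nonneg _, fun x hx => by simpa using (hC x hx).trans (le_abs_self C)⟩
  | succ m ih =>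
    obtain ⟨C, hC0, hC⟩ := ih (contDiffOn_deriv hV hg) (fun j hj => by
      rw [← iteratedDeriv_succ']
      exact h0 (j + 1) (by omega))
    refine ⟨C, hC0, fun x hx => ?_⟩
    have hsub : Icc (-|x|) |x| ⊆ Icc (-r) r := by
      have := abs_le.2 hx
      exact Icc_subset_Icc (by linarith) this
    have hb := Convex.norm_image_sub_le_of_norm_deriv_le (𝕜 := ℝ) (f := g) (C := C * |x| ^ m)
      (s := Icc (-|x|) |x|) (x := 0) (y := x)
      (fun y hy => differentiableAt_of_contDiffOn hV hg (hrV (hsub hy)))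
      (fun y hy => (hC y (hsub hy)).trans (by
        have := abs_le.2 hy
        gcongr)) (convex_Icc _ _) ⟨by simp, abs_nonneg x⟩ ⟨neg_abs_le x, le_abs_self x⟩
    have hg0 : g 0 = 0 := by simpa using h0 0 (by omega)
    simpa [hg0, pow_succ, mul_assoc] using hb

theorem norm_iteratedDeriv_le_pow {V : Opens ℝ} {r : ℝ}
    (hrV : Icc (-r) r ⊆ V) {m : ℕ} {g : ℝ → ℂ} (hg : SmoothVanishing V m g) (l : ℕ) :
    ∃ C : ℝ, 0 ≤ C ∧ ∀ x ∈ Icc (-r) r, ‖iteratedDeriv l g x‖ ≤ C * |x| ^ (m - l) := by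
  refine norm_le_pow_of_iteratedDeriv_eq_zero V.isOpen hrV (m - l)
    (contDiffOn_iteratedDeriv V.isOpen hg.1 l) fun j hj => ?_
  have := hg.2 (j + l) (by omega)
  rwa [iteratedDeriv_eq_iterate, Function.iterate_add_apply, ← iteratedDeriv_eq_iterate,
    ← iteratedDeriv_eq_iterate] at this

theorem SmoothVanishing.mul {V : Opens ℝ} (h0 : 0 ∈ V) {p q : ℕ} {f g : ℝ → ℂ}
    (hf : SmoothVanishing V p f) (hg : SmoothVanishing V q g) :
    SmoothVanishing V (p + q) (fun x => f x * g x) := by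
  refine ⟨hf.1.mul hg.1, fun j hj => ?_⟩
  have hf0 := (hf.1.contDiffAt (V.isOpen.mem_nhds h0)).of_le (m := j) (by exact_mod_cast le_top)
  have hg0 := (hg.1.contDiffAt (V.isOpen.mem_nhds h0)).of_le (m := j) (by exact_mod_cast le_top)
  rw [iteratedDeriv_fun_mul hf0 hg0]
  refine Finset.sum_eq_zero fun i hi => ?_
  have hi' := Finset.mem_range.1 hi
  rcases lt_or_ge i p with h | h
  · rw [hf.2 i h]; ring
  · rw [hg.2 (j - i) (by omega)]; ring

theorem SmoothVanishing.add {V : Opens ℝ} (h0 : 0 ∈ V) {p : ℕ} {f g : ℝ → ℂ}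
    (hf : SmoothVanishing V p f) (hg : SmoothVanishing V p g) :
    SmoothVanishing V p (fun x => f x + g x) := by
  refine ⟨hf.1.add hg.1, fun j hj => ?_⟩
  have hf0 := (hf.1.contDiffAt (V.isOpen.mem_nhds h0)).of_le (m := j) (by exact_mod_cast le_top)
  have hg0 := (hg.1.contDiffAt (V.isOpen.mem_nhds h0)).of_le (m := j) (by exact_mod_cast le_top)
  rw [iteratedDeriv_fun_add hf0 hg0, hf.2 j hj, hg.2 j hj, add_zero]

theorem SmoothVanishing.const_mul {V : Opens ℝ} {p : ℕ} {f : ℝ → ℂ} (c : ℂ)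
    (hf : SmoothVanishing V p f) : SmoothVanishing V p (fun x => c * f x) := by
  refine ⟨contDiffOn_const.mul hf.1, fun j hj => ?_⟩
  rw [iteratedDeriv_const_mul_field, hf.2 j hj, mul_zero]

theorem SmoothVanishing.sum {V : Opens ℝ} (h0 : 0 ∈ V) {p : ℕ} {ι : Type*} (t : Finset ι)
    {f : ι → ℝ → ℂ} (hf : ∀ i ∈ t, SmoothVanishing V p (f i)) :
    SmoothVanishing V p (fun x => ∑ i ∈ t, f i x) := by
  classical
  induction t using Finset.induction_on with
  | empty => exact ⟨by simpa using contDiffOn_const, fun j _ => by simp⟩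
  | insert a t ha ih =>
    simp only [Finset.sum_insert ha]
    exact (hf a (Finset.mem_insert_self a t)).add h0
      (ih fun i hi => hf i (Finset.mem_insert_of_mem hi))

theorem SmoothVanishing.of_le {V : Opens ℝ} {p q : ℕ} (hpq : p ≤ q) {f : ℝ → ℂ}
    (hf : SmoothVanishing V q f) : SmoothVanishing V p f :=
  ⟨hf.1, fun j hj => hf.2 j (by omega)⟩

theorem iteratedDeriv_ofReal_pow (m i : ℕ) :
    iteratedDeriv i (fun x : ℝ => (x : ℂ) ^ m) =
      fun x : ℝ => (m.descFactorial i : ℂ) * (x : ℂ) ^ (m - i) := by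
  induction i with
  | zero => simp
  | succ i ih =>
    rw [iteratedDeriv_succ, ih]
    ext x
    have h := ((Complex.ofRealCLM.hasDerivAt (x := x)).pow (m - i)).const_mul
      (m.descFactorial i : ℂ)
    refine h.deriv.trans ?_
    simp only [Complex.ofRealCLM_apply, Complex.ofReal_one, Nat.descFactorial_succ]
    rw [show m - i - 1 = m - (i + 1) by omega]
    push_cast
    ring

theorem smoothVanishing_pow (V : Opens ℝ) (m : ℕ) :
    SmoothVanishing V m (fun x : ℝ => (x : ℂ) ^ m) := by
  refine ⟨(Complex.ofRealCLM.contDiff.pow m).contDiffOn, fun j hj => ?_⟩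
  rw [iteratedDeriv_ofReal_pow]
  simp [Nat.sub_ne_zero_of_lt hj]

/-- Test D on x^m. The result vanishes to order m, and so do its terms a_i x^(m-i) with i < m by
strong induction, while derivatives of order above m kill x^m. What remains is m! a_m. -/
theorem DiffOp.IsTangential.smoothVanishing_coeff {U : Opens ℝ} (h0 : 0 ∈ U) {D : DiffOp U}
    (hD : D.IsTangential) (m : ℕ) (hm : m ≤ D.order) : SmoothVanishing U m (D.coeff m) := by
  induction m using Nat.strong_induction_on with
  | _ m ih =>
    have h1 := hD U le_rfl h0 m _ (smoothVanishing_pow U m)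
    have h2 : ∀ i ∈ (Finset.range (D.order + 1)).erase m, SmoothVanishing U m
        (fun x => (-(m.descFactorial i : ℂ)) * (D.coeff i x * (x : ℂ) ^ (m - i))) := by
      intro i hi
      have hi' := Finset.mem_erase.1 hi
      rcases lt_or_gt_of_ne hi'.1 with h | h
      · have := (ih i h (by omega)).mul h0 (smoothVanishing_pow U (m - i))
        rw [show i + (m - i) = m by omega] at this
        exact this.const_mul _
      · rw [Nat.descFactorial_eq_zero_iff_lt.2 h]
        simp only [Nat.cast_zero, neg_zero, zero_mul]
        exact ⟨contDiffOn_const, fun j _ => by simp⟩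
    have h3 := (h1.add h0 (SmoothVanishing.sum h0 _ h2)).const_mul ((m.factorial : ℂ)⁻¹)
    convert h3 using 1
    ext x
    have hmem : m ∈ Finset.range (D.order + 1) := Finset.mem_range.2 (by omega)
    simp only [DiffOp.apply, iteratedDeriv_ofReal_pow]
    rw [← Finset.add_sum_erase _ _ hmem, add_assoc, ← Finset.sum_add_distrib,
      Finset.sum_eq_zero (fun i _ => by ring)]
    have : (m.factorial : ℂ) ≠ 0 := Nat.cast_ne_zero.2 (Nat.factorial_ne_zero m)
    simp only [Nat.descFactorial_self, Nat.sub_self, pow_zero]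
    field_simp
    simp

/-- In the Leibniz expansion, l derivatives falling on b leave |x|^(k+i-l), exactly the factor |x|^k
|x|^(i-l) needed for the remaining i - l derivatives of φ. -/
theorem exists_norm_iteratedDeriv_mul_le {U : Opens ℝ} {r : ℝ}
    (hrU : Icc (-r) r ⊆ U) {i k : ℕ} {b : ℝ → ℂ} (hb : SmoothVanishing U (i + k) b) :
    ∃ C : ℝ, 0 ≤ C ∧ ∀ φ : ℝ → ℂ, ContDiff ℝ ∞ φ → ∀ x ∈ Icc (-r) r, ∀ A : ℝ,
      (∀ l ≤ i, |x| ^ k * (|x| ^ l * ‖iteratedDeriv l φ x‖) ≤ A) →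
      ‖iteratedDeriv i (fun y => b y * φ y) x‖ ≤ C * A := by
  choose C hC0 hC using norm_iteratedDeriv_le_pow hrU hb
  refine ⟨∑ l ∈ Finset.range (i + 1), (i.choose l : ℝ) * C l,
    Finset.sum_nonneg fun l _ => mul_nonneg (Nat.cast_nonneg _) (hC0 l), fun φ hφ x hx A hA => ?_⟩
  rw [iteratedDeriv_fun_mul ((hb.1.contDiffAt (U.isOpen.mem_nhds (hrU hx))).of_le
    (by exact_mod_cast le_top)) (hφ.contDiffAt.of_le (by exact_mod_cast le_top)), Finset.sum_mul]
  refine (norm_sum_le _ _).trans (Finset.sum_le_sum fun l hl => ?_)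
  have hl' := Finset.mem_range.1 hl
  rw [norm_mul, norm_mul, Complex.norm_natCast]
  calc (i.choose l : ℝ) * ‖iteratedDeriv l b x‖ * ‖iteratedDeriv (i - l) φ x‖
      ≤ (i.choose l : ℝ) * (C l * |x| ^ (i + k - l)) * ‖iteratedDeriv (i - l) φ x‖ := by
        gcongr
        exact hC l x hx
    _ = (i.choose l : ℝ) * C l * (|x| ^ k * (|x| ^ (i - l) * ‖iteratedDeriv (i - l) φ x‖)) := by
        rw [show i + k - l = k + (i - l) by omega, pow_add]
        ring
    _ ≤ (i.choose l : ℝ) * C l * A := by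
        have := hC0 l
        gcongr
        exact hA (i - l) (by omega)

theorem exists_norm_integral_transpose_le {U : Opens ℝ} (h0 : 0 ∈ U) {r : ℝ}
    (hrU : Icc (-r) r ⊆ U) {k : ℕ} {f h : ℝ → ℂ} {D : DiffOp U} (hf : SmoothVanishing U k f)
    (hD : D.IsTangential) (hh : LocBounded U h) :
    ∃ C : ℝ, 0 ≤ C ∧ ∀ φ : ℝ → ℂ, ContDiff ℝ ∞ φ → tsupport φ ⊆ Icc (-r) r → ∀ A : ℝ,
      (∀ l ≤ D.order, ∀ x, |x| ^ k * (|x| ^ l * ‖iteratedDeriv l φ x‖) ≤ A) →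
      ‖∫ x, h x * D.transpose (fun y => f y * φ y) x‖ ≤ C * A := by
  have hb : ∀ i : Fin (D.order + 1), SmoothVanishing U (i + k) (fun x => D.coeff i x * f x) :=
    fun i => (hD.smoothVanishing_coeff h0 i (by omega)).mul h0 hf
  choose C hC0 hC using fun i => exists_norm_iteratedDeriv_mul_le hrU (hb i)
  have hInt : IntegrableOn h (Icc (-r) r) := by
    have := hh _ isCompact_Icc hrU
    exact this.integrable le_top
  refine ⟨(∫ x in Icc (-r) r, ‖h x‖) * ∑ i, C i,
    mul_nonneg (integral_nonneg fun _ => norm_nonneg _) (Finset.sum_nonneg fun i _ => hC0 i),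
    fun φ hφ hsupp A hA => ?_⟩
  have hbound : ∀ x ∈ Icc (-r) r, ‖D.transpose (fun y => f y * φ y) x‖ ≤ (∑ i, C i) * A := by
    intro x hx
    rw [DiffOp.transpose, Finset.sum_range, Finset.sum_mul]
    refine (norm_sum_le _ _).trans (Finset.sum_le_sum fun i _ => ?_)
    rw [norm_mul, norm_pow, norm_neg, norm_one, one_pow, one_mul]
    simp only [← mul_assoc]
    exact hC i φ hφ x hx A fun l hl => hA l (by omega) x
  have hzero : ∀ x ∉ Icc (-r) r, D.transpose (fun y => f y * φ y) x = 0 := by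
    intro x hx
    have hφ0 : φ =ᶠ[𝓝 x] 0 := notMem_tsupport_iff_eventuallyEq.1 fun h => hx (hsupp h)
    refine Finset.sum_eq_zero fun i _ => ?_
    have : (fun y => D.coeff i y * (f y * φ y)) =ᶠ[𝓝 x] fun _ => 0 := by
      filter_upwards [hφ0] with y hy
      simp [hy]
    rw [this.iteratedDeriv_eq]
    simp
  have h1 : ‖∫ x, h x * D.transpose (fun y => f y * φ y) x‖ ≤
      ∫ x, (Icc (-r) r).indicator (fun x => ‖h x‖ * ((∑ i, C i) * A)) x := by
    refine norm_integral_le_of_norm_le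
      ((integrable_indicator_iff measurableSet_Icc).2 (hInt.norm.mul_const _))
      (Eventually.of_forall fun x => ?_)
    by_cases hx : x ∈ Icc (-r) r
    · rw [indicator_of_mem hx, norm_mul]
      gcongr
      exact hbound x hx
    · rw [indicator_of_notMem hx, hzero x hx]
      simp
  rw [integral_indicator measurableSet_Icc, integral_mul_const] at h1
  linarith

/-- The quantitative form of vanishing to order k, through which the hypothesis enters all later
estimates. Each transposed term involves (a_i f φ)^(i) with a_i f vanishing to order i + k. -/
theorem VanishesToOrder.exists_bound {k : ℕ} {T : Dist ⊤} (hT : VanishesToOrder k T) :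
    ∃ (r : ℝ) (N : ℕ) (C : ℝ), 0 < r ∧ 0 ≤ C ∧ ∀ φ : 𝓓((⊤ : Opens ℝ), ℂ),
      tsupport φ ⊆ Icc (-r) r → ∀ A : ℝ,
      (∀ l ≤ N, ∀ x, |x| ^ k * ‖euler^[l] φ x‖ ≤ A) → ‖T φ‖ ≤ C * A := by
  obtain ⟨U, h0, n, f, D, h, hf, hD, hh, hT⟩ := hT
  obtain ⟨r, hr, hrU⟩ : ∃ r : ℝ, 0 < r ∧ Icc (-r) r ⊆ U := by
    obtain ⟨ε, hε, hεU⟩ := Metric.isOpen_iff.1 U.isOpen 0 h0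
    refine ⟨ε / 2, by positivity, fun x hx => hεU ?_⟩
    rw [Metric.mem_ball, dist_zero_right, Real.norm_eq_abs]
    linarith [abs_le.2 hx]
  choose C hC0 hC using fun j => exists_norm_integral_transpose_le h0 hrU (hf j) (hD j) (hh j)
  set N := ∑ j, (D j).order with hN
  have hle : ∀ j, (D j).order ≤ N := fun j =>
    Finset.single_le_sum (f := fun j => (D j).order) (fun _ _ => Nat.zero_le _) (Finset.mem_univ j)
  refine ⟨r, N, (∑ j, C j) * N.factorial, hr,
    mul_nonneg (Finset.sum_nonneg fun j _ => hC0 j) (Nat.cast_nonneg _), fun φ hsupp A hA => ?_⟩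
  have e := hT ⟨φ, φ.contDiff, φ.hasCompactSupport, hsupp.trans hrU⟩
  have i1 : incl (⟨φ, φ.contDiff, φ.hasCompactSupport, hsupp.trans hrU⟩ : 𝓓(U, ℂ)) = φ := by
    ext x
    rw [incl_apply]
    rfl
  rw [i1] at e
  rw [e, mul_assoc, Finset.sum_mul]
  refine (norm_sum_le _ _).trans (Finset.sum_le_sum fun j _ => ?_)
  refine hC j φ φ.contDiff hsupp _ fun l hl x => ?_
  have hA0 : 0 ≤ A := le_trans (by positivity) (hA 0 (Nat.zero_le _) 0)
  -- At the fixed point x the number |x|^k is treated as a constant factor, so that the pointwise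
  -- comparison of derivatives applies to |x|^k φ.
  have hb : ∀ i ≤ l, ‖euler^[i] (fun y => (|x| ^ k : ℝ) * φ y) x‖ ≤ A := by
    intro i hi
    rw [euler_iterate_const_mul, norm_mul]
    simpa using hA i (hi.trans (hl.trans (hle j))) x
  have h3 := norm_pow_mul_iteratedDeriv_le isOpen_univ
    (contDiff_const.mul φ.contDiff).contDiffOn (mem_univ x) l hb
  rw [iteratedDeriv_const_mul_field, norm_mul, Complex.norm_real, Real.norm_eq_abs,
    abs_of_nonneg (show 0 ≤ |x| ^ k by positivity)] at h3
  calc _ = |x| ^ l * (|x| ^ k * ‖iteratedDeriv l φ x‖) := by ring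
    _ ≤ l.factorial * A := h3
    _ ≤ N.factorial * A := by
      gcongr
      exact hl.trans (hle j)

end Vanishing

/-! ### Cutoffs, and uniqueness of extensions across 0 -/

section Cutoff

theorem euler_iterate_eq_zero {f : ℝ → ℂ} {x : ℝ} (h : f =ᶠ[𝓝 x] 0) (j : ℕ) :
    euler^[j] f x = 0 := by
  suffices euler^[j] f =ᶠ[𝓝 x] 0 from this.eq_of_nhds
  induction j generalizing f with
  | zero => exact h
  | succ j ih =>
    refine ih ?_
    filter_upwards [h.eventuallyEq_nhds] with y hy
    simp [euler, hy.deriv_eq]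

/-- The dilate `x ↦ φ(c x)` of a test function. -/
def scaleTest (φ : 𝓓((⊤ : Opens ℝ), ℂ)) (c : ℝ) (hc : c ≠ 0) : 𝓓((⊤ : Opens ℝ), ℂ) where
  toFun x := φ (c * x)
  contDiff' := φ.contDiff.comp (contDiff_const.mul contDiff_id)
  hasCompactSupport' := φ.hasCompactSupport.comp_homeomorph (Homeomorph.mulLeft₀ c hc)
  tsupport_subset' := subset_univ _

@[simp]
theorem scaleTest_apply (φ : 𝓓((⊤ : Opens ℝ), ℂ)) (c : ℝ) (hc : c ≠ 0) (x : ℝ) :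
    scaleTest φ c hc x = φ (c * x) := rfl

@[simp]
theorem mulTest_apply {Ω : Opens ℝ} (g : ℝ → ℂ) (hg : ContDiffOn ℝ ∞ g Ω) (φ : 𝓓(Ω, ℂ)) (x : ℝ) :
    mulTest g hg φ x = g x * φ x := rfl

@[simp]
theorem invTest_apply (φ : 𝓓(puncturedLine, ℂ)) (x : ℝ) : invTest φ x = φ x⁻¹ := rfl

/-- A test function on `ℝ` which vanishes near `0`, as a test function on `ℝ ∖ {0}`. -/
def puncTest (φ : 𝓓((⊤ : Opens ℝ), ℂ)) (h : φ =ᶠ[𝓝 0] 0) : 𝓓(puncturedLine, ℂ) where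
  toFun := φ
  contDiff' := φ.contDiff
  hasCompactSupport' := φ.hasCompactSupport
  tsupport_subset' := fun x hx hx0 => by
    rw [mem_singleton_iff.1 hx0] at hx
    exact notMem_tsupport_iff_eventuallyEq.2 h hx

@[simp]
theorem puncTest_apply (φ : 𝓓((⊤ : Opens ℝ), ℂ)) (h : φ =ᶠ[𝓝 0] 0) (x : ℝ) :
    puncTest φ h x = φ x := rfl

@[simp]
theorem incl_puncTest (φ : 𝓓((⊤ : Opens ℝ), ℂ)) (h : φ =ᶠ[𝓝 0] 0) : incl (puncTest φ h) = φ := by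
  ext x
  rw [incl_apply, puncTest_apply]

theorem testFunction_eventuallyEq_zero (φ : 𝓓(puncturedLine, ℂ)) : φ =ᶠ[𝓝 0] 0 :=
  notMem_tsupport_iff_eventuallyEq.1 fun h => ne_zero_of_mem_tsupport φ h rfl

theorem exists_cutoff : ∃ β : 𝓓((⊤ : Opens ℝ), ℂ), (∀ x, |x| ≤ 1 → β x = 1) ∧
    ∀ x, 2 ≤ |x| → β x = 0 := by
  let b : ContDiffBump (0 : ℝ) := ⟨1, 2, one_pos, one_lt_two⟩
  refine ⟨⟨fun x => (b x : ℂ), Complex.ofRealCLM.contDiff.comp b.contDiff,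
    b.hasCompactSupport.comp_left Complex.ofReal_zero, subset_univ _⟩, fun x hx => ?_,
    fun x hx => ?_⟩
  · have : b x = 1 := b.one_of_mem_closedBall (by simpa [b] using hx)
    change ((b x : ℝ) : ℂ) = 1
    simp [this]
  · have : b x = 0 := b.zero_of_le_dist (by simpa [b] using hx)
    change ((b x : ℝ) : ℂ) = 0
    simp [this]

theorem exists_tsupport_subset_Icc (φ : 𝓓((⊤ : Opens ℝ), ℂ)) :
    ∃ R : ℝ, 0 < R ∧ ∀ x, φ x ≠ 0 → |x| ≤ R := by
  obtain ⟨R, hR⟩ := φ.hasCompactSupport.isCompact.isBounded.exists_norm_le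
  refine ⟨max R 1, by positivity, fun x hx => (hR x (subset_tsupport _ hx)).trans (le_max_left _ _)⟩

theorem tsupport_subset_Icc_of {φ : ℝ → ℂ} {r : ℝ} (h : ∀ x, r < |x| → φ x = 0) :
    tsupport φ ⊆ Icc (-r) r :=
  closure_minimal (fun x hx => abs_le.1 (not_lt.1 fun hr => hx (h x hr))) isClosed_Icc

theorem eventuallyEq_zero_of_lt_abs {φ : ℝ → ℂ} {r x : ℝ} (h : ∀ x, r < |x| → φ x = 0)
    (hx : r < |x|) : φ =ᶠ[𝓝 x] 0 := by
  filter_upwards [(isOpen_lt continuous_const continuous_abs).mem_nhds hx] with y hy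
  exact h y hy

/-- Dilating β leaves the bounds on its Euler derivatives unchanged, while the support shrinks to
|x| ≤ R/(n+1). The factor |x| from order 1 therefore tends to 0. -/
theorem VanishesToOrder.tendsto_mul_scaleTest {T : Dist ⊤} (hT : VanishesToOrder 1 T)
    (φ β : 𝓓((⊤ : Opens ℝ), ℂ)) :
    Tendsto (fun n : ℕ => T (mulTest φ φ.contDiff.contDiffOn
      (scaleTest β (n + 1) (by positivity)))) atTop (𝓝 0) := by
  obtain ⟨r, N, C, hr, hC, h⟩ := hT.exists_bound
  obtain ⟨R, hR, hβR⟩ := exists_tsupport_subset_Icc β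
  obtain ⟨B₁, hB₁, hφ⟩ := exists_bound_euler_iterate φ.contDiff φ.hasCompactSupport N
  obtain ⟨B₂, hB₂, hβ⟩ := exists_bound_euler_iterate β.contDiff β.hasCompactSupport N
  have hlim : Tendsto (fun n : ℕ => R / ((n : ℝ) + 1)) atTop (𝓝 0) :=
    tendsto_const_nhds.div_atTop (tendsto_atTop_add_const_right _ _ tendsto_natCast_atTop_atTop)
  have hlim2 : Tendsto (fun n : ℕ => C * (R / ((n : ℝ) + 1) * (2 ^ N * B₁ * B₂))) atTop (𝓝 0) := by
    simpa using (hlim.mul_const (2 ^ N * B₁ * B₂)).const_mul C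
  refine squeeze_zero_norm' ?_ hlim2
  filter_upwards [hlim.eventually_le_const hr] with n hn
  have hz : ∀ x, R / ((n : ℝ) + 1) < |x| → φ x * β ((n + 1) * x) = 0 := by
    intro x hx
    have : β ((n + 1) * x) = 0 := by
      by_contra hne
      have := hβR _ hne
      rw [abs_mul, abs_of_pos (by positivity : (0 : ℝ) < n + 1)] at this
      rw [div_lt_iff₀ (by positivity)] at hx
      linarith
    rw [this, mul_zero]
  refine h _ ((tsupport_subset_Icc_of hz).trans (Icc_subset_Icc (by linarith) hn)) _
    fun l hl x => ?_
  change |x| ^ 1 * ‖euler^[l] (fun x => φ x * β ((n + 1) * x)) x‖ ≤ _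
  rcases le_or_gt |x| (R / ((n : ℝ) + 1)) with hx | hx
  · rw [pow_one]
    gcongr
    have h2 := norm_euler_iterate_mul_le isOpen_univ φ.contDiff.contDiffOn
      (scaleTest β (n + 1) (by positivity)).contDiff.contDiffOn (mem_univ x) (A := B₁) (B := B₂) l
      (fun i hi => hφ i (hi.trans hl) x) (fun i hi => by
        change ‖euler^[i] (fun x => β ((n + 1) * x)) x‖ ≤ _
        rw [euler_iterate_comp_mul]
        exact hβ i (hi.trans hl) _)
    refine h2.trans ?_
    gcongr
    exact one_le_two
  · rw [euler_iterate_eq_zero (eventuallyEq_zero_of_lt_abs hz hx)]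
    simp only [norm_zero, mul_zero]
    positivity

/-- Remove from φ its cutoff near 0: the rest lives on `ℝ ∖ {0}`, and the removed piece contributes
nothing in the limit. -/
theorem VanishesToOrder.eq_zero {T : Dist ⊤} (hT : VanishesToOrder 1 T)
    (h : ∀ φ : 𝓓(puncturedLine, ℂ), T (incl φ) = 0) (φ : 𝓓((⊤ : Opens ℝ), ℂ)) : T φ = 0 := by
  obtain ⟨β, hβ, -⟩ := exists_cutoff
  refine (tendsto_const_nhds_iff (l := (atTop : Filter ℕ))).1 ?_
  refine (hT.tendsto_mul_scaleTest φ β).congr fun n => ?_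
  have h0 : (φ - mulTest φ φ.contDiff.contDiffOn (scaleTest β (n + 1) (by positivity)) :
      𝓓((⊤ : Opens ℝ), ℂ)) =ᶠ[𝓝 0] 0 := by
    have hn : (0 : ℝ) < n + 1 := by positivity
    filter_upwards [Metric.closedBall_mem_nhds (0 : ℝ) (inv_pos.2 hn)] with x hx
    have : |(n + 1) * x| ≤ 1 := by
      rw [abs_mul, abs_of_pos hn]
      rw [Metric.mem_closedBall, dist_zero_right, Real.norm_eq_abs] at hx
      calc ((n : ℝ) + 1) * |x| ≤ (n + 1) * (n + 1 : ℝ)⁻¹ := by gcongr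
        _ = 1 := mul_inv_cancel₀ hn.ne'
    simp [hβ _ this]
  have := h (puncTest _ h0)
  rw [incl_puncTest, map_sub, sub_eq_zero] at this
  exact this.symm

end Cutoff

/-! ### Weighted bounds for distributions in the source space -/

section SourceBound

/-- The weight `|x| min(|x|, |x|⁻¹)^a`. -/
def weight (a x : ℝ) : ℝ := Real.exp (-(a * |Real.log x|)) * |x|

theorem weight_pos (a : ℝ) {x : ℝ} (hx : x ≠ 0) : 0 < weight a x :=
  mul_pos (Real.exp_pos _) (abs_pos.2 hx)

theorem weight_nonneg (a x : ℝ) : 0 ≤ weight a x :=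
  mul_nonneg (Real.exp_pos _).le (abs_nonneg x)

theorem continuousOn_weight (a : ℝ) : ContinuousOn (weight a) {0}ᶜ := by
  refine ContinuousOn.mul (Real.continuous_exp.comp_continuousOn (ContinuousOn.neg
    (continuousOn_const.mul (ContinuousOn.abs ?_)))) continuous_abs.continuousOn
  exact Real.continuousOn_log

/-- For |x| ≤ 1 the weight is |x|^(a+1), so order k ≥ a + 1 suffices. -/
theorem pow_le_weight {a : ℝ} {k : ℕ} (hk : a + 1 ≤ k) {x : ℝ} (hx : x ≠ 0) (hx1 : |x| ≤ 1) :
    |x| ^ k ≤ weight a x := by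
  have hx0 : 0 < |x| := abs_pos.2 hx
  have hl : Real.log |x| ≤ 0 := Real.log_nonpos hx0.le hx1
  have e1 : |x| ^ k = Real.exp (k * Real.log |x|) := by
    rw [Real.exp_nat_mul, Real.exp_log hx0]
  have e2 : weight a x = Real.exp ((a + 1) * Real.log |x|) := by
    rw [weight, ← Real.log_abs x, abs_of_nonpos hl]
    nth_rewrite 2 [← Real.exp_log hx0]
    rw [← Real.exp_add]
    ring_nf
  rw [e1, e2, Real.exp_le_exp]
  nlinarith

/-- For |x| ≥ 1 the weight is |x|^(1-a). The square is the Jacobian factor created by passing to the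
coordinate y = 1/x. -/
theorem sq_le_pow_mul_weight {a : ℝ} {k : ℕ} (hk : a + 1 ≤ k) {x : ℝ} (hx1 : 1 ≤ |x|) :
    |x| ^ 2 ≤ |x| ^ k * weight a x := by
  have hx0 : 0 < |x| := by linarith
  have hl : 0 ≤ Real.log |x| := Real.log_nonneg hx1
  have e1 : ∀ k : ℕ, |x| ^ k = Real.exp (k * Real.log |x|) := fun k => by
    rw [Real.exp_nat_mul, Real.exp_log hx0]
  have e2 : weight a x = Real.exp ((1 - a) * Real.log |x|) := by
    rw [weight, ← Real.log_abs x, abs_of_nonneg hl]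
    nth_rewrite 2 [← Real.exp_log hx0]
    rw [← Real.exp_add]
    ring_nf
  rw [e1, e1, e2, ← Real.exp_add, Real.exp_le_exp]
  push_cast
  nlinarith

/-- The functional `L` is bounded by finitely many weighted Euler derivatives. -/
def WeightBounded (a : ℝ) (L : 𝓓(puncturedLine, ℂ) → ℂ) : Prop :=
  ∃ (N : ℕ) (C : ℝ), 0 ≤ C ∧ ∀ φ : 𝓓(puncturedLine, ℂ), ∀ A : ℝ,
    (∀ l ≤ N, ∀ x, weight a x * ‖euler^[l] φ x‖ ≤ A) → ‖L φ‖ ≤ C * A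

theorem WeightBounded.add {a : ℝ} {L M : 𝓓(puncturedLine, ℂ) → ℂ} (hL : WeightBounded a L)
    (hM : WeightBounded a M) : WeightBounded a (fun φ => L φ + M φ) := by
  obtain ⟨N, C, hC, h⟩ := hL
  obtain ⟨N', C', hC', h'⟩ := hM
  refine ⟨max N N', C + C', add_nonneg hC hC', fun φ A hA => ?_⟩
  rw [add_mul]
  exact (norm_add_le _ _).trans (add_le_add
    (h φ A fun l hl => hA l (hl.trans (le_max_left _ _)))
    (h' φ A fun l hl => hA l (hl.trans (le_max_right _ _))))

/-- All Euler derivatives of `η` are bounded. -/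
def EulerBounded (η : ℝ → ℂ) : Prop :=
  ∀ N : ℕ, ∃ B : ℝ, 0 ≤ B ∧ ∀ j ≤ N, ∀ x, ‖euler^[j] η x‖ ≤ B

theorem eulerBounded_testFunction (φ : 𝓓((⊤ : Opens ℝ), ℂ)) : EulerBounded φ :=
  exists_bound_euler_iterate φ.contDiff φ.hasCompactSupport

theorem eulerBounded_const (c : ℂ) : EulerBounded fun _ => c := by
  have h : ∀ j : ℕ, ∀ x : ℝ, ‖euler^[j] (fun _ => c) x‖ ≤ ‖c‖ := by
    intro j x
    rcases j with _ | j
    · simp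
    · rw [Function.iterate_succ_apply]
      have : euler (fun _ : ℝ => c) = fun _ => 0 := by ext x; simp [euler]
      rw [this]
      have h0 : ((fun _ : ℝ => (0 : ℂ)) : ℝ → ℂ) =ᶠ[𝓝 x] 0 := Eventually.of_forall fun _ => rfl
      rw [euler_iterate_eq_zero h0]
      simp
  exact fun N => ⟨‖c‖, norm_nonneg c, fun j _ x => h j x⟩

theorem EulerBounded.sub {f g : ℝ → ℂ} (hfs : ContDiff ℝ ∞ f) (hgs : ContDiff ℝ ∞ g)
    (hf : EulerBounded f) (hg : EulerBounded g) : EulerBounded fun x => f x - g x := by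
  intro N
  obtain ⟨B, hB, h⟩ := hf N
  obtain ⟨B', hB', h'⟩ := hg N
  refine ⟨B + B', add_nonneg hB hB', fun j hj x => ?_⟩
  have e : (fun x => f x - g x) = fun x => f x + (-1) * g x := by ext x; ring
  rw [e, euler_iterate_add isOpen_univ hfs.contDiffOn (contDiff_const.mul hgs).contDiffOn j
    (mem_univ x), euler_iterate_const_mul]
  refine (norm_add_le _ _).trans (add_le_add (h j hj x) ?_)
  rw [norm_mul, norm_neg, norm_one, one_mul]
  exact h' j hj x

theorem norm_euler_iterate_cutoff_mul_le {η : ℝ → ℂ} (hη : ContDiff ℝ ∞ η) {B : ℝ} {N : ℕ}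
    (hB : ∀ j ≤ N, ∀ x, ‖euler^[j] η x‖ ≤ B) {a : ℝ} {φ : 𝓓(puncturedLine, ℂ)} {A : ℝ}
    (hA : ∀ l ≤ N, ∀ x, weight a x * ‖euler^[l] φ x‖ ≤ A) {x : ℝ} (hx : x ≠ 0) {l : ℕ}
    (hl : l ≤ N) :
    ‖euler^[l] (fun y => η y * φ y) x‖ ≤ 2 ^ N * B * A / weight a x := by
  have hw := weight_pos a hx
  have h := norm_euler_iterate_mul_le isOpen_univ hη.contDiffOn φ.contDiff.contDiffOn (mem_univ x)
    (A := B) (B := A / weight a x) l (fun i hi => hB i (hi.trans hl) x) (fun i hi => by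
      rw [le_div_iff₀ hw, mul_comm]
      exact hA i (hi.trans hl) x)
  refine h.trans ?_
  have hB0 : 0 ≤ B := (norm_nonneg _).trans (hB 0 (Nat.zero_le _) x)
  have hA0 : 0 ≤ A := le_trans (mul_nonneg (weight_nonneg a x) (norm_nonneg _))
    (hA 0 (Nat.zero_le _) x)
  rw [mul_div_assoc]
  gcongr
  exact one_le_two

/-- The part near 0: on the support of η the power |x|^k is at most the weight. At x = 0, where the
weight vanishes and gives no control, the condition k ≠ 0 makes the left side zero. -/
theorem VanishesToOrder.weightBounded {a : ℝ} {k : ℕ} (hk : a + 1 ≤ k) (hk0 : k ≠ 0) {T : Dist ⊤}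
    {r : ℝ} {N : ℕ} {C : ℝ} (hC : 0 ≤ C) (hr1 : r ≤ 1)
    (hT : ∀ φ : 𝓓((⊤ : Opens ℝ), ℂ), tsupport φ ⊆ Icc (-r) r → ∀ A : ℝ,
      (∀ l ≤ N, ∀ x, |x| ^ k * ‖euler^[l] φ x‖ ≤ A) → ‖T φ‖ ≤ C * A)
    {η : ℝ → ℂ} (hη : ContDiff ℝ ∞ η) (hηB : EulerBounded η) (hηr : ∀ x, r < |x| → η x = 0) :
    WeightBounded a (fun φ => T (incl (mulTest η hη.contDiffOn φ))) := by
  obtain ⟨B, hB, h⟩ := hηB N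
  refine ⟨N, C * (2 ^ N * B), by positivity, fun φ A hA => ?_⟩
  have e : (incl (mulTest η hη.contDiffOn φ) : ℝ → ℂ) = fun x => η x * φ x := by
    ext x
    rw [incl_apply, mulTest_apply]
  have hz : ∀ x, r < |x| → η x * φ x = 0 := fun x hx => by rw [hηr x hx, zero_mul]
  have hA0 : 0 ≤ A := le_trans (mul_nonneg (weight_nonneg a 0) (norm_nonneg _))
    (hA 0 (Nat.zero_le _) 0)
  rw [mul_assoc]
  refine hT _ ?_ _ fun l hl x => ?_
  · rw [e]
    exact tsupport_subset_Icc_of hz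
  rw [e]
  rcases lt_or_ge r |x| with hx | hx
  · rw [euler_iterate_eq_zero (eventuallyEq_zero_of_lt_abs hz hx)]
    simp only [norm_zero, mul_zero]
    positivity
  rcases eq_or_ne x 0 with rfl | hx0
  · simp only [abs_zero, zero_pow hk0, zero_mul]
    positivity
  have h1 := norm_euler_iterate_cutoff_mul_le hη h hA hx0 hl
  have h2 := pow_le_weight hk hx0 (hx.trans hr1)
  have hw := weight_pos a hx0
  calc _ ≤ weight a x * (2 ^ N * B * A / weight a x) := by gcongr
    _ = _ := by field_simp

theorem euler_iterate_sq (j : ℕ) :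
    euler^[j] (fun x : ℝ => (x : ℂ) ^ 2) = fun x : ℝ => 2 ^ j * (x : ℂ) ^ 2 := by
  induction j with
  | zero => simp
  | succ j ih =>
    rw [Function.iterate_succ_apply', ih, euler_const_mul]
    ext x
    have h := (Complex.ofRealCLM.hasDerivAt (x := x)).pow 2
    simp only [euler]
    rw [show deriv (fun x : ℝ => (x : ℂ) ^ 2) x = _ from h.deriv]
    simp
    ring

/-- The part near ∞: in the coordinate y the test function becomes χ(1/y) with χ(x) = x² η(x) φ(x).
Euler iterates pass through the inversion up to sign, and x² is an eigenfunction of θ. -/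
theorem VanishesToOrder.weightBounded_inv {a : ℝ} {k : ℕ} (hk : a + 1 ≤ k) (hk0 : k ≠ 0)
    {T : Dist ⊤} {r : ℝ} {N : ℕ} {C : ℝ} (hC : 0 ≤ C) (hr0 : 0 < r) (hr1 : r ≤ 1)
    (hT : ∀ φ : 𝓓((⊤ : Opens ℝ), ℂ), tsupport φ ⊆ Icc (-r) r → ∀ A : ℝ,
      (∀ l ≤ N, ∀ x, |x| ^ k * ‖euler^[l] φ x‖ ≤ A) → ‖T φ‖ ≤ C * A)
    {η : ℝ → ℂ} (hη : ContDiff ℝ ∞ η) (hηB : EulerBounded η) (hηr : ∀ x, |x| < r⁻¹ → η x = 0) :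
    WeightBounded a (fun φ => T (incl (mulTest _ contDiffOn_inv_sq
      (invTest (mulTest η hη.contDiffOn φ))))) := by
  obtain ⟨B, hB, h⟩ := hηB N
  refine ⟨N, C * (2 ^ N * 2 ^ N * (2 ^ N * B)), by positivity, fun φ A hA => ?_⟩
  set χ : ℝ → ℂ := fun x => (x : ℂ) ^ 2 * (η x * φ x) with hχ
  have hsq : ContDiff ℝ ∞ (fun x : ℝ => (x : ℂ) ^ 2) := Complex.ofRealCLM.contDiff.pow 2
  have hηφ : ContDiff ℝ ∞ (fun x => η x * φ x) := hη.mul φ.contDiff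
  have hχs : ContDiff ℝ ∞ χ := hsq.mul hηφ
  have e : (incl (mulTest _ contDiffOn_inv_sq (invTest (mulTest η hη.contDiffOn φ))) : ℝ → ℂ) =
      fun x => χ x⁻¹ := by
    ext x
    rw [incl_apply, mulTest_apply, invTest_apply, mulTest_apply]
    simp only [hχ]
    push_cast
    rw [inv_pow]
  have hz : ∀ x, r < |x| → χ x⁻¹ = 0 := fun x hx => by
    simp only [hχ]
    rw [hηr x⁻¹ (by rw [abs_inv]; exact inv_strictAnti₀ hr0 hx), zero_mul, mul_zero]
  have hA0 : 0 ≤ A := le_trans (mul_nonneg (weight_nonneg a 0) (norm_nonneg _))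
    (hA 0 (Nat.zero_le _) 0)
  rw [mul_assoc]
  refine hT _ ?_ _ fun l hl x => ?_
  · rw [e]
    exact tsupport_subset_Icc_of hz
  rw [e]
  rcases lt_or_ge r |x| with hx | hx
  · rw [euler_iterate_eq_zero (eventuallyEq_zero_of_lt_abs hz hx)]
    simp only [norm_zero, mul_zero]
    positivity
  rcases eq_or_ne x 0 with rfl | hx0
  · simp only [abs_zero, zero_pow hk0, zero_mul]
    positivity
  have hy0 : x⁻¹ ≠ 0 := inv_ne_zero hx0
  rw [euler_iterate_comp_inv hχs.contDiffOn l hx0]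
  have h1 := norm_euler_iterate_mul_le isOpen_univ hsq.contDiffOn hηφ.contDiffOn (mem_univ x⁻¹)
    (A := 2 ^ N * |x⁻¹| ^ 2) (B := 2 ^ N * B * A / weight a x⁻¹) l (fun i hi => by
      rw [euler_iterate_sq]
      simp only [norm_mul, norm_pow, Complex.norm_ofNat, Complex.norm_real, Real.norm_eq_abs]
      have : i ≤ N := hi.trans hl
      gcongr
      exact one_le_two)
    (fun i hi => norm_euler_iterate_cutoff_mul_le hη h hA hy0 (hi.trans hl))
  have hy1 : 1 ≤ |x⁻¹| := by
    rw [abs_inv]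
    exact (one_le_inv₀ (abs_pos.2 hx0)).2 (hx.trans hr1)
  have h2 := sq_le_pow_mul_weight hk hy1
  have hw := weight_pos a hy0
  have hxk : |x| ^ k * |x⁻¹| ^ k = 1 := by
    rw [← mul_pow, ← abs_mul, mul_inv_cancel₀ hx0, abs_one, one_pow]
  rw [norm_mul, norm_pow, norm_neg, norm_one, one_pow, one_mul]
  generalize weight a x⁻¹ = w at h1 h2 hw
  calc |x| ^ k * ‖euler^[l] χ x⁻¹‖
      ≤ |x| ^ k * (2 ^ l * (2 ^ N * |x⁻¹| ^ 2) * (2 ^ N * B * A / w)) := by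
        gcongr
    _ ≤ |x| ^ k * (2 ^ N * (2 ^ N * (|x⁻¹| ^ k * w)) *
          (2 ^ N * B * A / w)) := by
        gcongr
        exact one_le_two
    _ = (|x| ^ k * |x⁻¹| ^ k) * (2 ^ N * 2 ^ N * (2 ^ N * B) * A) := by field_simp
    _ = _ := by rw [hxk, one_mul]

theorem exists_seminorm_bound (σ : 𝓢'(ℝ, ℂ)) : ∃ (s : Finset (ℕ × ℕ)) (C : ℝ), 0 ≤ C ∧
    ∀ f : 𝓢(ℝ, ℂ), ‖σ f‖ ≤ C * (s.sup (schwartzSeminormFamily ℂ ℝ ℂ)) f := by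
  let q : Seminorm ℂ 𝓢(ℝ, ℂ) := (normSeminorm ℂ ℂ).comp (σ : 𝓢(ℝ, ℂ) →ₗ[ℂ] ℂ)
  have hq : Continuous q := continuous_norm.comp (map_continuous σ)
  obtain ⟨s, C, -, h⟩ := Seminorm.bound_of_continuous (schwartz_withSeminorms ℂ ℝ ℂ) q hq
  exact ⟨s, C, C.2, fun f => h f⟩

/-- The middle part: on a compact set avoiding 0 the weight and the powers of |x| are bounded above
and below, so Schwartz continuity is enough. -/
theorem weightBounded_tempered (σ : 𝓢'(ℝ, ℂ)) (a : ℝ) {η : ℝ → ℂ} (hη : ContDiff ℝ ∞ η)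
    (hηB : EulerBounded η) {r R : ℝ} (hr : 0 < r) (hηr : ∀ x, |x| < r → η x = 0)
    (hηR : ∀ x, R < |x| → η x = 0) :
    WeightBounded a (fun φ => ofTempered σ (incl (mulTest η hη.contDiffOn φ))) := by
  obtain ⟨s, C, hC, hσ⟩ := exists_seminorm_bound σ
  set N := s.sup Prod.snd with hN
  obtain ⟨B, hB, h⟩ := hηB N
  set K : Set ℝ := {x | r ≤ |x| ∧ |x| ≤ R} with hK
  have hKc : IsCompact K := by
    refine (isCompact_Icc (a := -R) (b := R)).of_isClosed_subset ?_ fun x hx => abs_le.1 hx.2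
    exact (isClosed_le continuous_const continuous_abs).inter
      (isClosed_le continuous_abs continuous_const)
  have hK0 : ∀ x ∈ K, x ≠ 0 := fun x hx hx0 => by
    have := hx.1
    rw [hx0, abs_zero] at this
    linarith
  have hcont : ∀ p : ℕ × ℕ, ∃ M : ℝ, 0 ≤ M ∧
      ∀ x ∈ K, |x| ^ p.1 * (p.2.factorial / |x| ^ p.2) / weight a x ≤ M := by
    intro p
    have : ContinuousOn (fun x => |x| ^ p.1 * (p.2.factorial / |x| ^ p.2) / weight a x) K := by
      refine ContinuousOn.div (ContinuousOn.mul (by fun_prop) (ContinuousOn.div continuousOn_const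
        (by fun_prop) fun x hx => ?_)) ((continuousOn_weight a).mono fun x hx => hK0 x hx)
        fun x hx => (weight_pos a (hK0 x hx)).ne'
      exact pow_ne_zero _ (abs_ne_zero.2 (hK0 x hx))
    obtain ⟨M, hM⟩ := hKc.exists_bound_of_continuousOn this
    exact ⟨|M|, abs_nonneg _, fun x hx => (le_abs_self _).trans ((hM x hx).trans (le_abs_self M))⟩
  choose M hM0 hM using hcont
  refine ⟨N, C * ((∑ p ∈ s, M p) * (2 ^ N * B)), mul_nonneg hC (mul_nonneg
    (Finset.sum_nonneg fun p _ => hM0 p) (by positivity)), fun φ A hA => ?_⟩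
  have hA0 : 0 ≤ A := le_trans (mul_nonneg (weight_nonneg a 0) (norm_nonneg _))
    (hA 0 (Nat.zero_le _) 0)
  refine (hσ _).trans ?_
  rw [mul_assoc C]
  gcongr
  refine Seminorm.finset_sup_apply_le (mul_nonneg (mul_nonneg
    (Finset.sum_nonneg fun p _ => hM0 p) (by positivity)) hA0) fun p hp => ?_
  change SchwartzMap.seminorm ℂ p.1 p.2 _ ≤ _
  have hpN : p.2 ≤ N := Finset.le_sup (f := Prod.snd) hp
  have hle : M p ≤ ∑ p ∈ s, M p := Finset.single_le_sum (f := M) (fun p _ => hM0 p) hp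
  refine SchwartzMap.seminorm_le_bound' ℂ p.1 p.2 _ (mul_nonneg (mul_nonneg
    (Finset.sum_nonneg fun p _ => hM0 p) (by positivity)) hA0) fun x => ?_
  have e : (toSchwartz (incl (mulTest η hη.contDiffOn φ)) : ℝ → ℂ) = fun x => η x * φ x := by
    ext x
    change incl (mulTest η hη.contDiffOn φ) x = _
    rw [incl_apply, mulTest_apply]
  rw [e]
  by_cases hx : x ∈ K
  · have hx0 := hK0 x hx
    have h1 := norm_pow_mul_iteratedDeriv_le isOpen_univ (hη.mul φ.contDiff).contDiffOn (mem_univ x)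
      p.2 fun i hi => norm_euler_iterate_cutoff_mul_le hη h hA hx0 (hi.trans hpN)
    have hxp : 0 < |x| ^ p.2 := pow_pos (abs_pos.2 hx0) _
    rw [← le_div_iff₀' hxp] at h1
    have hw := weight_pos a hx0
    calc _ ≤ |x| ^ p.1 * (p.2.factorial * (2 ^ N * B * A / weight a x) / |x| ^ p.2) := by gcongr
      _ = (|x| ^ p.1 * (p.2.factorial / |x| ^ p.2) / weight a x) * (2 ^ N * B) * A := by field_simp
      _ ≤ _ := by
        gcongr
        exact (hM p x hx).trans hle
  · have hz : (fun x => η x * φ x) =ᶠ[𝓝 x] 0 := by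
      rcases lt_or_ge |x| r with h1 | h1
      · filter_upwards [(isOpen_lt continuous_abs continuous_const).mem_nhds h1] with y hy
        simp [hηr y hy]
      · have h2 : R < |x| := not_le.1 fun h2 => hx ⟨h1, h2⟩
        filter_upwards [(isOpen_lt continuous_const continuous_abs).mem_nhds h2] with y hy
        simp [hηR y hy]
    rw [hz.iteratedDeriv_eq]
    have : iteratedDeriv p.2 (0 : ℝ → ℂ) x = 0 := by simp
    rw [this, norm_zero, mul_zero]
    exact mul_nonneg (mul_nonneg (Finset.sum_nonneg fun p _ => hM0 p) (by positivity)) hA0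

/-- Split 1 = η₀ + (η₁ - η₀) + (1 - η₁) into pieces near 0, in between and near ∞, and use
infinite-order vanishing at the two ends. As vanishing of every order is available, a is arbitrary.
-/
theorem weightBounded_of_mem_mellinSource {δ : ZMod 2} {σ : 𝓢'(ℝ, ℂ)} (hσ : σ ∈ mellinSource δ)
    (a : ℝ) : WeightBounded a (fun φ => ofTempered σ (incl φ)) := by
  obtain ⟨-, hv, T, hT, hw⟩ := hσ
  obtain ⟨k, hk⟩ := exists_nat_ge (max (a + 1) 1)
  have hka : a + 1 ≤ k := (le_max_left _ _).trans hk
  have hk0 : k ≠ 0 := by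
    have : (1 : ℝ) ≤ k := (le_max_right _ _).trans hk
    rintro rfl
    norm_num at this
  obtain ⟨r₀, N₀, C₀, hr₀, hC₀, h₀⟩ := (hv k).exists_bound
  obtain ⟨r₁, N₁, C₁, hr₁, hC₁, h₁⟩ := (hw k).exists_bound
  obtain ⟨β, hβ1, hβ0⟩ := exists_cutoff
  set r := min 1 (min r₀ r₁) with hr
  have hr0 : 0 < r := lt_min one_pos (lt_min hr₀ hr₁)
  have hr1 : r ≤ 1 := min_le_left _ _
  have hrr₀ : r ≤ r₀ := (min_le_right _ _).trans (min_le_left _ _)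
  have hrr₁ : r ≤ r₁ := (min_le_right _ _).trans (min_le_right _ _)
  set η₀ := scaleTest β (2 / r) (by positivity) with hη₀
  set η₁ := scaleTest β (r / 2) (by positivity) with hη₁
  have hη₀z : ∀ x, r < |x| → η₀ x = 0 := fun x hx => by
    refine hβ0 _ ?_
    rw [abs_mul, abs_of_pos (by positivity : 0 < 2 / r), div_mul_eq_mul_div, le_div_iff₀ hr0]
    linarith
  have hη₁z : ∀ x, 4 / r < |x| → η₁ x = 0 := fun x hx => by
    refine hβ0 _ ?_
    rw [div_lt_iff₀ hr0] at hx
    rw [abs_mul, abs_of_pos (by positivity : 0 < r / 2)]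
    linarith
  have hη₀o : ∀ x, |x| < r / 2 → η₀ x = 1 := fun x hx => by
    refine hβ1 _ ?_
    rw [abs_mul, abs_of_pos (by positivity : 0 < 2 / r), div_mul_eq_mul_div, div_le_one hr0]
    linarith
  have hη₁o : ∀ x, |x| < r⁻¹ → η₁ x = 1 := fun x hx => by
    refine hβ1 _ ?_
    rw [abs_mul, abs_of_pos (by positivity : 0 < r / 2)]
    have : r * |x| < 1 := by
      calc r * |x| < r * r⁻¹ := by gcongr
        _ = 1 := mul_inv_cancel₀ hr0.ne'
    nlinarith [abs_nonneg x]
  have s1 : ContDiff ℝ ∞ (fun _ : ℝ => (1 : ℂ)) := contDiff_const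
  have w0 := VanishesToOrder.weightBounded hka hk0 hC₀ hr1
    (fun φ hs => h₀ φ (hs.trans (Icc_subset_Icc (by linarith) hrr₀))) η₀.contDiff
    (eulerBounded_testFunction η₀) hη₀z
  have w1 := weightBounded_tempered σ a (η₁.contDiff.sub η₀.contDiff)
    ((eulerBounded_testFunction η₁).sub η₁.contDiff η₀.contDiff (eulerBounded_testFunction η₀))
    (r := r / 2) (R := 4 / r) (by positivity)
    (fun x hx => by
      have : r / 2 ≤ r⁻¹ := by
        have : 1 ≤ r⁻¹ := (one_le_inv₀ hr0).2 hr1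
        linarith
      rw [hη₀o x hx, hη₁o x (hx.trans_le this), sub_self])
    (fun x hx => by
      have : r ≤ 4 / r := by
        rw [le_div_iff₀ hr0]
        nlinarith
      rw [hη₁z x hx, hη₀z x (this.trans_lt hx), sub_self])
  have w2 := VanishesToOrder.weightBounded_inv hka hk0 hC₁ hr0 hr1
    (fun φ hs => h₁ φ (hs.trans (Icc_subset_Icc (by linarith) hrr₁))) (s1.sub η₁.contDiff)
    ((eulerBounded_const 1).sub s1 η₁.contDiff (eulerBounded_testFunction η₁))
    (fun x hx => by rw [hη₁o x hx, sub_self])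
  convert (w0.add w1).add w2 using 2 with φ
  -- Compatibility of the two charts returns the piece near ∞ to the coordinate x, where the three
  -- pieces add up to φ.
  rw [← T.compat, hT, ← map_add, ← map_add, ← map_add, ← map_add]
  congr 2
  ext x
  simp
  ring

end SourceBound

/-! ### Pairing Schwartz functions with the kernel, for re s < 0 -/

section Pairing

/-- The Euler operator on Schwartz functions. -/
def eulerCLM : 𝓢(ℝ, ℂ) →L[ℂ] 𝓢(ℝ, ℂ) :=
  SchwartzMap.smulLeftCLM ℂ (fun x : ℝ => (x : ℂ)) ∘L SchwartzMap.derivCLM ℂ ℂ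

theorem coe_eulerCLM (f : 𝓢(ℝ, ℂ)) : ⇑(eulerCLM f) = euler f := by
  ext x
  have h : (fun x : ℝ => (x : ℂ)).HasTemperateGrowth := Complex.ofRealCLM.hasTemperateGrowth
  simp only [eulerCLM, ContinuousLinearMap.comp_apply]
  rw [SchwartzMap.smulLeftCLM_apply_apply h]
  simp [euler]

theorem coe_eulerCLM_iterate (f : 𝓢(ℝ, ℂ)) (n : ℕ) : ⇑((eulerCLM)^[n] f) = euler^[n] f := by
  induction n generalizing f with
  | zero => rfl
  | succ n ih => rw [Function.iterate_succ_apply, ih, coe_eulerCLM]; rfl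

theorem measurable_sign : Measurable Real.sign := by
  unfold Real.sign
  exact Measurable.ite measurableSet_Iio measurable_const
    (Measurable.ite measurableSet_Ioi measurable_const measurable_const)

theorem measurable_mellinKernel_uncurry (δ : ZMod 2) :
    Measurable fun p : ℂ × ℝ => mellinKernel δ p.1 p.2 := by
  unfold mellinKernel
  refine Measurable.mul ?_ ?_
  · exact (Complex.measurable_ofReal.comp (measurable_sign.comp measurable_snd)).pow_const _
  · exact (Complex.measurable_ofReal.comp (measurable_snd.abs)).pow
      (measurable_fst.sub_const 1)

theorem measurable_mellinKernel (δ : ZMod 2) (s : ℂ) : Measurable (mellinKernel δ s) :=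
  (measurable_mellinKernel_uncurry δ).comp (measurable_const.prodMk measurable_id)

variable (δ : ZMod 2)

theorem mellinKernel_zero {s : ℂ} (hs : s ≠ 1) : mellinKernel δ s 0 = 0 := by
  rw [mellinKernel, abs_zero, Complex.ofReal_zero, Complex.zero_cpow (sub_ne_zero.2 hs), mul_zero]

theorem norm_mellinKernel_one_sub {s : ℂ} (hs : s.re < 0) (x : ℝ) :
    ‖mellinKernel δ (1 - s) x‖ = |x| ^ (-s.re) := by
  rcases eq_or_ne x 0 with rfl | hx
  · rw [mellinKernel_zero, norm_zero, abs_zero, Real.zero_rpow (by linarith)]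
    intro h
    have := congrArg Complex.re h
    simp at this
    linarith
  · rw [norm_mellinKernel δ _ hx]
    simp

/-- The Mellin-type pairing `∫ f(x) (sg x)^δ |x|^(-s) dx`. -/
def pairing (f : ℝ → ℂ) (s : ℂ) : ℂ := ∫ x, f x * mellinKernel δ (1 - s) x

theorem rpow_le_one_add_pow {y b : ℝ} (hy : 0 ≤ y) (hb : 0 ≤ b) {M : ℕ} (hM : b ≤ M) :
    y ^ b ≤ 1 + y ^ M := by
  rcases le_total y 1 with h | h
  · exact (Real.rpow_le_one hy h hb).trans (by linarith [pow_nonneg hy M])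
  · calc y ^ b ≤ y ^ (M : ℝ) := Real.rpow_le_rpow_of_exponent_le h hM
      _ = y ^ M := Real.rpow_natCast y M
      _ ≤ _ := by linarith

theorem norm_mul_mellinKernel_le (f : ℝ → ℂ) {s : ℂ} (hs : s.re < 0) {M : ℕ} (hM : -s.re ≤ M)
    (x : ℝ) : ‖f x * mellinKernel δ (1 - s) x‖ ≤ |x| ^ 0 * ‖f x‖ + |x| ^ M * ‖f x‖ := by
  rw [norm_mul, norm_mellinKernel_one_sub δ hs, pow_zero, ← add_mul, mul_comm]
  gcongr
  exact rpow_le_one_add_pow (abs_nonneg x) (by linarith) hM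

theorem integrable_pow_add_pow (f : 𝓢(ℝ, ℂ)) (M : ℕ) :
    Integrable fun x : ℝ => |x| ^ 0 * ‖f x‖ + |x| ^ M * ‖f x‖ :=
  (f.integrable_pow_mul volume 0).add (f.integrable_pow_mul volume M)

theorem integrable_mul_mellinKernel (f : 𝓢(ℝ, ℂ)) {s : ℂ} (hs : s.re < 0) :
    Integrable fun x => f x * mellinKernel δ (1 - s) x := by
  obtain ⟨M, hM⟩ := exists_nat_ge (-s.re)
  exact (integrable_pow_add_pow f M).mono'
    (f.continuous.aestronglyMeasurable.mul (measurable_mellinKernel δ _).aestronglyMeasurable)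
    (Eventually.of_forall (norm_mul_mellinKernel_le δ f hs hM))

theorem norm_pairing_le (f : 𝓢(ℝ, ℂ)) {s : ℂ} (hs : s.re < 0) {M : ℕ} (hM : -s.re ≤ M) :
    ‖pairing δ f s‖ ≤ ∫ x : ℝ, (|x| ^ 0 * ‖f x‖ + |x| ^ M * ‖f x‖) :=
  norm_integral_le_of_norm_le (integrable_pow_add_pow f M)
    (Eventually.of_forall (norm_mul_mellinKernel_le δ f hs hM))

theorem pairing_add (f g : 𝓢(ℝ, ℂ)) {s : ℂ} (hs : s.re < 0) :
    pairing δ (fun x => f x + g x) s = pairing δ f s + pairing δ g s := by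
  rw [pairing, pairing, pairing, ← integral_add (integrable_mul_mellinKernel δ f hs)
    (integrable_mul_mellinKernel δ g hs)]
  simp only [add_mul]

theorem pairing_const_mul (c : ℂ) (f : ℝ → ℂ) (s : ℂ) :
    pairing δ (fun x => c * f x) s = c * pairing δ f s := by
  rw [pairing, pairing, ← integral_const_mul]
  simp only [mul_assoc]

/-- This primitive drives the integration by parts. It is differentiable at 0 as well: its
difference quotient there is f times the kernel, which tends to 0 like |x|^(-re s) because re s < 0.
-/
theorem hasDerivAt_mul_mellinKernel (f : 𝓢(ℝ, ℂ)) {s : ℂ} (hs : s.re < 0) (x : ℝ) :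
    HasDerivAt (fun x : ℝ => (x : ℂ) * f x * mellinKernel δ (1 - s) x)
      (euler f x * mellinKernel δ (1 - s) x - (s - 1) * (f x * mellinKernel δ (1 - s) x)) x := by
  have hs1 : (1 : ℂ) - s ≠ 1 := by
    intro h
    have := congrArg Complex.re h
    simp at this
    linarith
  rcases eq_or_ne x 0 with rfl | hx
  · rw [mellinKernel_zero δ hs1]
    simp only [mul_zero, sub_zero]
    rw [hasDerivAt_iff_tendsto_slope]
    have h1 : Tendsto (fun x => f x * mellinKernel δ (1 - s) x) (𝓝[≠] 0) (𝓝 0) := by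
      refine Tendsto.mono_left ?_ nhdsWithin_le_nhds
      have h2 : Tendsto (fun x : ℝ => ‖f x‖ * |x| ^ (-s.re)) (𝓝 0) (𝓝 0) := by
        have : Continuous fun x : ℝ => ‖f x‖ * |x| ^ (-s.re) :=
          f.continuous.norm.mul (continuous_abs.rpow_const fun _ => Or.inr (by linarith))
        have h3 := this.tendsto 0
        simpa [Real.zero_rpow (show -s.re ≠ 0 by linarith)] using h3
      refine squeeze_zero_norm (fun x => ?_) h2
      rw [norm_mul, norm_mellinKernel_one_sub δ hs]
    refine h1.congr' ?_
    filter_upwards [self_mem_nhdsWithin] with y hy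
    have hy0 : (y : ℂ) ≠ 0 := Complex.ofReal_ne_zero.2 hy
    rw [slope_def_module]
    simp only [Complex.ofReal_zero, zero_mul, sub_zero, Complex.real_smul, Complex.ofReal_inv]
    field_simp
  · have hK := differentiableAt_of_contDiffOn puncturedLine.isOpen
      (contDiffOn_mellinKernel δ (1 - s)) (x := x) hx
    have hf : DifferentiableAt ℝ f x := f.differentiableAt
    have h := ((Complex.ofRealCLM.hasDerivAt (x := x)).mul hf.hasDerivAt).mul hK.hasDerivAt
    have hE : (x : ℂ) * deriv (mellinKernel δ (1 - s)) x =
        (1 - s - 1) * mellinKernel δ (1 - s) x := euler_mellinKernel δ (1 - s) hx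
    refine HasDerivAt.congr_deriv (f := fun x : ℝ => (x : ℂ) * f x * mellinKernel δ (1 - s) x) h ?_
    simp only [Complex.ofRealCLM_apply, Complex.ofReal_one, euler, Pi.mul_apply]
    linear_combination (f x) * hE

theorem pairing_euler (f : 𝓢(ℝ, ℂ)) {s : ℂ} (hs : s.re < 0) :
    pairing δ (euler f) s = (s - 1) * pairing δ f s := by
  have i1 : Integrable fun x => euler f x * mellinKernel δ (1 - s) x := by
    have := integrable_mul_mellinKernel δ (eulerCLM f) hs
    rwa [coe_eulerCLM] at this
  have i2 := (integrable_mul_mellinKernel δ f hs).const_mul (s - 1)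
  have i3 : Integrable fun x : ℝ => (x : ℂ) * f x * mellinKernel δ (1 - s) x := by
    have := integrable_mul_mellinKernel δ
      (SchwartzMap.smulLeftCLM ℂ (fun x : ℝ => (x : ℂ)) f) hs
    have h : (fun x : ℝ => (x : ℂ)).HasTemperateGrowth := Complex.ofRealCLM.hasTemperateGrowth
    simpa [SchwartzMap.smulLeftCLM_apply_apply h] using this
  have h := integral_eq_zero_of_hasDerivAt_of_integrable (hasDerivAt_mul_mellinKernel δ f hs)
    (i1.sub i2) i3
  rw [integral_sub i1 i2, integral_const_mul, sub_eq_zero] at h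
  exact h

theorem pairing_euler_iterate (f : 𝓢(ℝ, ℂ)) {s : ℂ} (hs : s.re < 0) (n : ℕ) :
    pairing δ (euler^[n] f) s = (s - 1) ^ n * pairing δ f s := by
  induction n generalizing f with
  | zero => simp
  | succ n ih =>
    rw [Function.iterate_succ_apply, ← coe_eulerCLM, ih, coe_eulerCLM, pairing_euler δ f hs]
    ring

theorem one_add_abs_im_le {s : ℂ} (hs : s.re < 0) : 1 + |s.im| ≤ 2 * ‖s - 1‖ := by
  have h1 := Complex.abs_im_le_norm (s - 1)
  have h2 := Complex.abs_re_le_norm (s - 1)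
  simp only [Complex.sub_im, Complex.sub_re, Complex.one_im, Complex.one_re, sub_zero] at h1 h2
  have h3 := neg_le_abs (s.re - 1)
  linarith

/-- Replacing f by θ^n f multiplies the pairing by (s-1)^n, and |s-1| dominates 1 + |im s| up to a
factor 2 when re s < 0. Hence decay faster than any power. -/
theorem exists_norm_pairing_le (f : 𝓢(ℝ, ℂ)) (n : ℕ) (M : ℝ) :
    ∃ C : ℝ, 0 ≤ C ∧ ∀ s : ℂ, -M ≤ s.re → s.re < 0 →
      ‖pairing δ f s‖ ≤ C * ((1 + |s.im|) ^ n)⁻¹ := by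
  obtain ⟨m, hm⟩ := exists_nat_ge M
  set g := (eulerCLM)^[n] f with hg
  refine ⟨2 ^ n * ∫ x : ℝ, (|x| ^ 0 * ‖g x‖ + |x| ^ m * ‖g x‖),
    mul_nonneg (by positivity) (integral_nonneg fun x => by positivity), fun s h1 h2 => ?_⟩
  have h3 := norm_pairing_le δ g h2 (M := m) (by linarith)
  have h4 := pairing_euler_iterate δ f h2 n
  rw [← coe_eulerCLM_iterate] at h4
  rw [h4, norm_mul, norm_pow] at h3
  have h5 : (1 + |s.im|) ^ n ≤ 2 ^ n * ‖s - 1‖ ^ n := by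
    rw [← mul_pow]
    exact pow_le_pow_left₀ (by positivity) (one_add_abs_im_le h2) n
  rw [← div_eq_mul_inv, le_div_iff₀ (by positivity)]
  calc ‖pairing δ f s‖ * (1 + |s.im|) ^ n ≤ ‖pairing δ f s‖ * (2 ^ n * ‖s - 1‖ ^ n) := by gcongr
    _ = 2 ^ n * (‖s - 1‖ ^ n * ‖pairing δ f s‖) := by ring
    _ ≤ _ := by gcongr

theorem mellinKernel_of_pos (s : ℂ) {x : ℝ} (hx : 0 < x) :
    mellinKernel δ s x = (x : ℂ) ^ (s - 1) := by
  rw [mellinKernel, Real.sign_of_pos hx, abs_of_pos hx]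
  simp

theorem mellinKernel_neg (s : ℂ) (x : ℝ) :
    mellinKernel δ s (-x) = (-1) ^ δ.val * mellinKernel δ s x := by
  rw [mellinKernel, mellinKernel, Real.sign_neg, abs_neg, Complex.ofReal_neg, neg_pow]
  ring

/-- The even or odd part of `f`, doubled. -/
def symm (f : ℝ → ℂ) (x : ℝ) : ℂ := f x + (-1) ^ δ.val * f (-x)

/-- Folding the negative half-line onto the positive one turns the signed pairing into an ordinary
Mellin transform. -/
theorem pairing_eq_mellin {f : ℝ → ℂ} {s : ℂ}
    (hf : Integrable fun x => f x * mellinKernel δ (1 - s) x) :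
    pairing δ f s = mellin (symm δ f) (1 - s) := by
  have h1 : pairing δ f s = (∫ x in Iic 0, f x * mellinKernel δ (1 - s) x) +
      ∫ x in Ioi 0, f x * mellinKernel δ (1 - s) x :=
    (intervalIntegral.integral_Iic_add_Ioi hf.integrableOn hf.integrableOn).symm
  have h2 : (∫ x in Iic 0, f x * mellinKernel δ (1 - s) x) =
      ∫ x in Ioi 0, f (-x) * mellinKernel δ (1 - s) (-x) := by
    have := integral_comp_neg_Ioi (0 : ℝ) fun x => f x * mellinKernel δ (1 - s) x
    rw [neg_zero] at this
    exact this.symm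
  rw [h1, h2, ← integral_add hf.comp_neg.integrableOn hf.integrableOn, mellin]
  refine setIntegral_congr_fun measurableSet_Ioi fun x hx => ?_
  rw [mellinKernel_neg, mellinKernel_of_pos δ _ hx, symm, smul_eq_mul]
  ring

theorem differentiableAt_pairing (f : 𝓢(ℝ, ℂ)) {s : ℂ} (hs : s.re < 0) :
    DifferentiableAt ℂ (pairing δ f) s := by
  set g : 𝓢(ℝ, ℂ) := f + ((-1) ^ δ.val : ℂ) •
    SchwartzMap.compCLMOfContinuousLinearEquiv ℂ (ContinuousLinearEquiv.neg ℝ) f with hg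
  have hgf : ⇑g = symm δ f := by
    ext x
    simp [hg, symm]
  have hm : DifferentiableAt ℂ (mellin g) (1 - s) := by
    have hre : (1 - s).re = 1 - s.re := by simp
    refine mellin_differentiableAt_of_isBigO_rpow (a := 2 - s.re) (b := 0)
      (g.continuous.locallyIntegrable.locallyIntegrableOn _) ?_ (by rw [hre]; linarith) ?_
      (by rw [hre]; linarith)
    · have h1 := (g.isBigO_cocompact_rpow (-(2 - s.re))).mono atTop_le_cocompact
      refine h1.congr' (EventuallyEq.refl _ _) ?_
      filter_upwards [eventually_ge_atTop 0] with x hx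
      rw [Real.norm_of_nonneg hx]
    · have h1 : g =O[𝓝[>] 0] fun _ => (1 : ℝ) :=
        (g.continuous.continuousAt.tendsto.mono_left nhdsWithin_le_nhds).isBigO_one ℝ
      simpa using h1
  have he : pairing δ f =ᶠ[𝓝 s] fun s => mellin g (1 - s) := by
    filter_upwards [(isOpen_lt Complex.continuous_re continuous_const).mem_nhds hs] with w hw
    rw [hgf, pairing_eq_mellin δ (integrable_mul_mellinKernel δ f hw)]
  refine DifferentiableAt.congr_of_eventuallyEq ?_ he
  exact hm.comp s ((differentiableAt_const 1).sub differentiableAt_id)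

end Pairing

/-! ### Contour shifts and line integrals -/

section Strip

/-- `G` is holomorphic on the closed strip `a ≤ re s ≤ b` and `O(|im s|⁻²)` there. -/
def StripDecay (a b : ℝ) (G : ℂ → ℂ) : Prop :=
  (∀ s : ℂ, a ≤ s.re → s.re ≤ b → DifferentiableAt ℂ G s) ∧
    ∃ C : ℝ, ∀ s : ℂ, a ≤ s.re → s.re ≤ b → ‖G s‖ ≤ C * ((1 + |s.im|) ^ 2)⁻¹

theorem integrable_inv_one_add_abs_sq : Integrable fun t : ℝ => ((1 + |t|) ^ 2)⁻¹ := by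
  have h := integrable_one_add_norm (E := ℝ) (μ := volume) (r := 2) (by simp)
  refine h.congr (Eventually.of_forall fun t => ?_)
  simp only [Real.norm_eq_abs]
  rw [Real.rpow_neg (by positivity)]
  norm_cast

@[simp]
theorem re_add_mul_I (c t : ℝ) : ((c : ℂ) + t * Complex.I).re = c := by simp

@[simp]
theorem im_add_mul_I (c t : ℝ) : ((c : ℂ) + t * Complex.I).im = t := by simp

theorem continuous_vertical {G : ℂ → ℂ} {c : ℝ} (h : ∀ s : ℂ, s.re = c → ContinuousAt G s) :
    Continuous fun t : ℝ => G (c + t * Complex.I) := by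
  refine continuous_iff_continuousAt.2 fun t => ?_
  exact ContinuousAt.comp (g := G) (h _ (re_add_mul_I c t)) (by fun_prop)

theorem StripDecay.integrable {a b : ℝ} {G : ℂ → ℂ} (hG : StripDecay a b G) {c : ℝ} (hac : a ≤ c)
    (hcb : c ≤ b) : Integrable fun t : ℝ => G (c + t * Complex.I) := by
  obtain ⟨hd, C, hC⟩ := hG
  refine (integrable_inv_one_add_abs_sq.const_mul C).mono' ?_ (Eventually.of_forall fun t => ?_)
  · exact (continuous_vertical fun s hs =>
      (hd s (hs ▸ hac) (hs ▸ hcb)).continuousAt).aestronglyMeasurable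
  · simpa using hC (c + t * Complex.I) (by simpa using hac) (by simpa using hcb)

/-- Cauchy's theorem on the rectangle of height 2T; the horizontal sides are O(T⁻²). -/
theorem StripDecay.integral_eq {a b : ℝ} (hab : a ≤ b) {G : ℂ → ℂ} (hG : StripDecay a b G) :
    ∫ t : ℝ, G (a + t * Complex.I) = ∫ t : ℝ, G (b + t * Complex.I) := by
  have hia := hG.integrable le_rfl hab
  have hib := hG.integrable hab le_rfl
  obtain ⟨hd, C, hC⟩ := hG
  have hrect : ∀ T : ℝ, 0 ≤ T →
      (∫ x : ℝ in a..b, G (x + (-T : ℝ) * Complex.I)) - (∫ x : ℝ in a..b, G (x + T * Complex.I)) +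
      Complex.I • (∫ y : ℝ in (-T)..T, G (b + y * Complex.I)) -
      Complex.I • (∫ y : ℝ in (-T)..T, G (a + y * Complex.I)) = 0 := by
    intro T hT
    have := Complex.integral_boundary_rect_eq_zero_of_differentiableOn G
      (a + (-T : ℝ) * Complex.I) (b + T * Complex.I) (fun s hs => by
        simp only [re_add_mul_I, im_add_mul_I] at hs
        rw [uIcc_of_le hab] at hs
        exact (hd s hs.1.1 hs.1.2).differentiableWithinAt)
    simpa only [re_add_mul_I, im_add_mul_I] using this
  have hhor : ∀ ε : ℝ, (ε = 1 ∨ ε = -1) →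
      Tendsto (fun T : ℝ => ∫ x : ℝ in a..b, G (x + (ε * T : ℝ) * Complex.I)) atTop (𝓝 0) := by
    intro ε hε
    have hε1 : |ε| = 1 := by rcases hε with h | h <;> simp [h]
    have hlim : Tendsto (fun T : ℝ => C * ((1 + |T|) ^ 2)⁻¹ * |b - a|) atTop (𝓝 0) := by
      have h1 : Tendsto (fun T : ℝ => (1 + |T|) ^ 2) atTop atTop :=
        (tendsto_pow_atTop two_ne_zero).comp
          (tendsto_atTop_add_const_left _ _ tendsto_abs_atTop_atTop)
      simpa using (h1.inv_tendsto_atTop.const_mul C).mul_const |b - a|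
    refine squeeze_zero_norm (fun T => ?_) hlim
    refine intervalIntegral.norm_integral_le_of_norm_le_const fun x hx => ?_
    rw [uIoc_of_le hab] at hx
    have := hC (x + (ε * T : ℝ) * Complex.I) (by simpa using hx.1.le) (by simpa using hx.2)
    simpa only [im_add_mul_I, abs_mul, hε1, one_mul] using this
  have hb := intervalIntegral_tendsto_integral hib tendsto_neg_atTop_atBot tendsto_id
  have ha := intervalIntegral_tendsto_integral hia tendsto_neg_atTop_atBot tendsto_id
  have hlim := (((hhor (-1) (Or.inr rfl)).sub (hhor 1 (Or.inl rfl))).add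
    (hb.const_smul Complex.I)).sub (ha.const_smul Complex.I)
  have h0 := tendsto_nhds_unique (hlim.congr' (f₂ := fun _ => 0) (by
    filter_upwards [eventually_ge_atTop 0] with T hT
    have := hrect T hT
    simpa only [neg_one_mul, one_mul, id] using this)) tendsto_const_nhds
  simp only [sub_zero, zero_add] at h0
  rw [← smul_sub, smul_eq_zero, sub_eq_zero] at h0
  exact (h0.resolve_left Complex.I_ne_zero).symm

theorem exists_norm_le_of_mem_entireModerate {H : ℂ → ℂ} (hH : H ∈ entireModerate) (a b : ℝ) :
    ∃ (C : ℝ) (N : ℕ), 0 ≤ C ∧ ∀ s : ℂ, a ≤ s.re → s.re ≤ b → ‖H s‖ ≤ C * (1 + |s.im|) ^ N := by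
  -- Moderate growth is stated for a < b only, so the strip is enlarged to cover a degenerate line b
  -- = a.
  obtain ⟨T, C, N, hT, hC, h⟩ := hH.2 a (max b (a + 1)) (lt_max_of_lt_right (by linarith))
  have hK : IsCompact (Icc a b ×ℂ Icc (-T) T) := isCompact_Icc.reProdIm isCompact_Icc
  obtain ⟨C', hC'⟩ := hK.exists_bound_of_continuousOn hH.1.continuous.continuousOn
  refine ⟨C + |C'|, N, by positivity, fun s h1 h2 => ?_⟩
  rcases le_total T |s.im| with h3 | h3
  · calc ‖H s‖ ≤ C * |s.im| ^ N := h s h1 (h2.trans (le_max_left _ _)) h3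
      _ ≤ (C + |C'|) * (1 + |s.im|) ^ N := by
        gcongr <;> linarith [abs_nonneg C']
  · have h4 : (1 : ℝ) ≤ (1 + |s.im|) ^ N := one_le_pow₀ (by linarith [abs_nonneg s.im])
    calc ‖H s‖ ≤ C' := hC' s ⟨⟨h1, h2⟩, abs_le.1 h3⟩
      _ ≤ (C + |C'|) * 1 := by linarith [le_abs_self C']
      _ ≤ _ := by gcongr

theorem stripDecay_mul {H Φ : ℂ → ℂ} (hH : H ∈ entireModerate) {a b : ℝ}
    (hd : ∀ s : ℂ, a ≤ s.re → s.re ≤ b → DifferentiableAt ℂ Φ s)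
    (hb : ∀ n : ℕ, ∃ C : ℝ, 0 ≤ C ∧ ∀ s : ℂ, a ≤ s.re → s.re ≤ b →
      ‖Φ s‖ ≤ C * ((1 + |s.im|) ^ n)⁻¹) : StripDecay a b fun s => H s * Φ s := by
  obtain ⟨C, N, hC, h⟩ := exists_norm_le_of_mem_entireModerate hH a b
  obtain ⟨C', hC', h'⟩ := hb (N + 2)
  refine ⟨fun s h1 h2 => (hH.1 s).mul (hd s h1 h2), C * C', fun s h1 h2 => ?_⟩
  rw [norm_mul]
  calc ‖H s‖ * ‖Φ s‖ ≤ (C * (1 + |s.im|) ^ N) * (C' * ((1 + |s.im|) ^ (N + 2))⁻¹) := by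
        gcongr
        · exact h s h1 h2
        · exact h' s h1 h2
    _ = C * C' * ((1 + |s.im|) ^ 2)⁻¹ := by
        have : (1 + |s.im|) ≠ 0 := by positivity
        rw [pow_add]
        field_simp

variable (δ : ZMod 2)

theorem stripDecay_schwartz {H : ℂ → ℂ} (hH : H ∈ entireModerate) (f : 𝓢(ℝ, ℂ)) {a b : ℝ}
    (hb : b < 0) : StripDecay a b fun s => H s * pairing δ f s := by
  refine stripDecay_mul hH (fun s _ h => differentiableAt_pairing δ f (h.trans_lt hb)) fun n => ?_
  obtain ⟨C, hC, h⟩ := exists_norm_pairing_le δ f n (-a)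
  exact ⟨C, hC, fun s h1 h2 => h s (by simpa using h1) (h2.trans_lt hb)⟩

theorem mellinKernel_add_two_mul (s : ℂ) (m : ℕ) {x : ℝ} (hx : x ≠ 0) :
    mellinKernel δ (s + (2 * m : ℕ)) x = mellinKernel δ s x * ((x : ℂ) ^ 2) ^ m := by
  have h : ((|x| : ℝ) : ℂ) ≠ 0 := by simpa using hx
  have e : ((|x| : ℝ) : ℂ) ^ 2 = (x : ℂ) ^ 2 := by
    rw [← Complex.ofReal_pow, sq_abs, Complex.ofReal_pow]
  rw [mellinKernel, mellinKernel, show s + (2 * m : ℕ) - 1 = (s - 1) + (2 * m : ℕ) by ring,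
    Complex.cpow_add _ _ h, Complex.cpow_natCast, pow_mul, e]
  ring

theorem coe_toSchwartz_incl {Ω : Opens ℝ} (φ : 𝓓(Ω, ℂ)) : ⇑(toSchwartz (incl φ)) = φ := by
  ext x
  exact incl_apply φ x

theorem testFunction_zero (φ : 𝓓(puncturedLine, ℂ)) : φ 0 = 0 :=
  (testFunction_eventuallyEq_zero φ).eq_of_nhds

/-- Since φ vanishes near 0 it may be divided by x^(2m), which moves s to s - 2m; the even power
leaves the sign character alone. Facts known for re s < 0 thereby extend to all s. -/
theorem exists_schwartz_shift (φ : 𝓓(puncturedLine, ℂ)) (b : ℝ) :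
    ∃ (m : ℕ) (ψ : 𝓢(ℝ, ℂ)), b < (2 * m : ℕ) ∧ ψ 0 = 0 ∧ ∀ (s : ℂ) (x : ℝ),
      φ x * mellinKernel δ (1 - s) x = ψ x * mellinKernel δ (1 - (s - (2 * m : ℕ))) x := by
  obtain ⟨m, hm⟩ := exists_nat_gt (max b 0)
  have hm1 : b < m := (le_max_left _ _).trans_lt hm
  have hm0 : (0 : ℝ) < m := (le_max_right _ _).trans_lt hm
  refine ⟨m, toSchwartz (incl (mulTest _ (contDiffOn_inv_sq.pow m) φ)), by push_cast; linarith, ?_,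
    fun s x => ?_⟩
  · rw [coe_toSchwartz_incl, mulTest_apply, testFunction_zero, mul_zero]
  rw [coe_toSchwartz_incl, mulTest_apply]
  rcases eq_or_ne x 0 with rfl | hx
  · rw [testFunction_zero]
    ring
  · have hx' : (x : ℂ) ≠ 0 := Complex.ofReal_ne_zero.2 hx
    rw [show (1 : ℂ) - (s - (2 * m : ℕ)) = (1 - s) + (2 * m : ℕ) by ring,
      mellinKernel_add_two_mul δ _ m hx, inv_pow]
    field_simp

theorem integrable_testFunction_mul_mellinKernel (φ : 𝓓(puncturedLine, ℂ)) (s : ℂ) :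
    Integrable fun x => φ x * mellinKernel δ (1 - s) x := by
  obtain ⟨m, ψ, hm, -, h⟩ := exists_schwartz_shift δ φ s.re
  simp only [h]
  exact integrable_mul_mellinKernel δ ψ (by
    rw [Complex.sub_re, Complex.natCast_re]
    linarith)

theorem differentiable_pairing (φ : 𝓓(puncturedLine, ℂ)) : Differentiable ℂ (pairing δ φ) := by
  intro s
  obtain ⟨m, ψ, hm, -, h⟩ := exists_schwartz_shift δ φ s.re
  have e : pairing δ φ = fun s => pairing δ ψ (s - (2 * m : ℕ)) := by
    ext s
    simp only [pairing, h]
  rw [e]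
  refine DifferentiableAt.comp (g := pairing δ ψ) s (differentiableAt_pairing δ ψ ?_)
    (differentiableAt_id.sub_const _)
  rw [Complex.sub_re, Complex.natCast_re]
  linarith

theorem exists_norm_pairing_testFunction_le (φ : 𝓓(puncturedLine, ℂ)) (a b : ℝ) (n : ℕ) :
    ∃ C : ℝ, 0 ≤ C ∧ ∀ s : ℂ, a ≤ s.re → s.re ≤ b →
      ‖pairing δ φ s‖ ≤ C * ((1 + |s.im|) ^ n)⁻¹ := by
  obtain ⟨m, ψ, hm, -, h⟩ := exists_schwartz_shift δ φ b
  have e : pairing δ φ = fun s => pairing δ ψ (s - (2 * m : ℕ)) := by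
    ext s
    simp only [pairing, h]
  obtain ⟨C, hC, h'⟩ := exists_norm_pairing_le δ ψ n (-(a - (2 * m : ℕ)))
  refine ⟨C, hC, fun s h1 h2 => ?_⟩
  rw [e]
  have h3 := h' (s - (2 * m : ℕ)) (by rw [Complex.sub_re, Complex.natCast_re]; linarith)
    (by rw [Complex.sub_re, Complex.natCast_re]; linarith)
  rwa [Complex.sub_im, Complex.natCast_im, sub_zero] at h3

theorem stripDecay_testFunction {H : ℂ → ℂ} (hH : H ∈ entireModerate) (φ : 𝓓(puncturedLine, ℂ))
    (a b : ℝ) : StripDecay a b fun s => H s * pairing δ φ s :=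
  stripDecay_mul hH (fun s _ _ => differentiable_pairing δ φ s) fun n =>
    exists_norm_pairing_testFunction_le δ φ a b n

/-- The inverse Mellin transform of `H` along `re s = c`, paired with `f(x) dx`. -/
def lineInt (H : ℂ → ℂ) (c : ℝ) (f : ℝ → ℂ) : ℂ :=
  -- Mellin inversion contributes 1/(2π). The further 1/2 is needed because it recovers f(x) +
  -- (-1)^δ f(-x), twice the part of f of parity δ.
  (4 * Real.pi : ℂ)⁻¹ * ∫ t : ℝ, H (c + t * Complex.I) * pairing δ f (c + t * Complex.I)

theorem lineInt_schwartz_eq {H : ℂ → ℂ} (hH : H ∈ entireModerate) (f : 𝓢(ℝ, ℂ)) {c c' : ℝ}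
    (hc : c < 0) (hc' : c' < 0) : lineInt δ H c f = lineInt δ H c' f := by
  wlog h : c ≤ c' generalizing c c'
  · exact (this hc' hc (le_of_not_ge h)).symm
  rw [lineInt, lineInt, (stripDecay_schwartz δ hH f (a := c) hc').integral_eq h]

theorem lineInt_testFunction_eq {H : ℂ → ℂ} (hH : H ∈ entireModerate) (φ : 𝓓(puncturedLine, ℂ))
    (c c' : ℝ) : lineInt δ H c φ = lineInt δ H c' φ := by
  wlog h : c ≤ c' generalizing c c'
  · exact (this c' c (le_of_not_ge h)).symm
  rw [lineInt, lineInt, (stripDecay_testFunction δ hH φ c c').integral_eq h]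

end Strip

/-! ### The inverse transform as a tempered distribution -/

section Inverse

variable (δ : ZMod 2)

theorem exists_seminorm_integral_le (M : ℕ) : ∃ (t : Finset (ℕ × ℕ)) (C : ℝ), 0 ≤ C ∧
    ∀ f : 𝓢(ℝ, ℂ), ∫ x : ℝ, (|x| ^ 0 * ‖f x‖ + |x| ^ M * ‖f x‖) ≤
      C * (t.sup (schwartzSeminormFamily ℂ ℝ ℂ)) f := by
  set p := (volume : Measure ℝ).integrablePower
  set D : ℝ := 2 ^ p * ∫ x : ℝ, (1 + ‖x‖) ^ (-(p : ℝ)) with hD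
  have hD0 : 0 ≤ D := mul_nonneg (by positivity) (integral_nonneg fun x => by positivity)
  set t : Finset (ℕ × ℕ) := {(0, 0), (0 + p, 0), (M + p, 0)} with ht
  refine ⟨t, D * 4, by positivity, fun f => ?_⟩
  have hle : ∀ q ∈ t, SchwartzMap.seminorm ℂ q.1 q.2 f ≤
      (t.sup (schwartzSeminormFamily ℂ ℝ ℂ)) f := fun q hq =>
    Seminorm.le_finset_sup_apply (p := schwartzSeminormFamily ℂ ℝ ℂ) hq
  have h0 := hle (0, 0) (by simp [ht])
  have h1 := hle (0 + p, 0) (by simp [ht])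
  have h2 := hle (M + p, 0) (by simp [ht])
  have i0 := SchwartzMap.integral_pow_mul_iteratedFDeriv_le ℂ volume f 0 0
  have i1 := SchwartzMap.integral_pow_mul_iteratedFDeriv_le ℂ volume f M 0
  simp only [norm_iteratedFDeriv_zero, Real.norm_eq_abs] at i0 i1
  have i2 : ∫ x : ℝ, (|x| ^ 0 * ‖f x‖ + |x| ^ M * ‖f x‖) =
      (∫ x : ℝ, |x| ^ 0 * ‖f x‖) + ∫ x : ℝ, |x| ^ M * ‖f x‖ :=
    integral_add (f.integrable_pow_mul volume 0) (f.integrable_pow_mul volume M)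
  rw [i2]
  calc _ ≤ _ := add_le_add i0 i1
    _ ≤ D * (2 * (t.sup (schwartzSeminormFamily ℂ ℝ ℂ)) f) +
        D * (2 * (t.sup (schwartzSeminormFamily ℂ ℝ ℂ)) f) := by
      simp only [Real.norm_eq_abs] at hD
      rw [hD]
      gcongr <;> linarith
    _ = _ := by ring

/-- H may grow, so write H · pairing(f) = H (s-1)^(-n) · pairing(θ^n f). For n large the first
factor is integrable along the line, and the second is bounded by Schwartz seminorms of θ^n f. -/
theorem exists_tempered_lineInt {H : ℂ → ℂ} (hH : H ∈ entireModerate) :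
    ∃ F : 𝓢'(ℝ, ℂ), ∀ f : 𝓢(ℝ, ℂ), F f = lineInt δ H (-1 / 2 : ℝ) f := by
  set c : ℝ := -1 / 2 with hc
  have hc0 : c < 0 := by norm_num [hc]
  obtain ⟨C, N, hC, hHb⟩ := exists_norm_le_of_mem_entireModerate hH c c
  -- Two powers beyond the growth of H leave an integrable O((1+|t|)⁻²).
  set n := N + 2 with hn
  set z : ℝ → ℂ := fun t => c + t * Complex.I with hz
  have hzre : ∀ t, (z t).re = c := fun t => re_add_mul_I c t
  have hzim : ∀ t, (z t).im = t := fun t => im_add_mul_I c t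
  have hzc : Continuous z := by fun_prop
  have hz1 : ∀ t, z t - 1 ≠ 0 := fun t h => by
    have := one_add_abs_im_le (s := z t) (by rw [hzre]; exact hc0)
    rw [h, norm_zero] at this
    linarith [abs_nonneg (z t).im]
  set q : ℝ → ℂ := fun t => H (z t) * ((z t - 1) ^ n)⁻¹ with hq
  have hqc : Continuous q := (hH.1.continuous.comp hzc).mul
    (((hzc.sub continuous_const).pow n).inv₀ fun t => pow_ne_zero _ (hz1 t))
  have hqb : ∀ t, ‖q t‖ ≤ C * 2 ^ n * ((1 + |t|) ^ 2)⁻¹ := fun t => by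
    have h1 := hHb (z t) (hzre t).ge (hzre t).le
    have h2 := one_add_abs_im_le (s := z t) (by rw [hzre]; exact hc0)
    rw [hzim] at h1 h2
    have h3 : 0 < ‖z t - 1‖ := norm_pos_iff.2 (hz1 t)
    have h4 : (‖z t - 1‖ ^ n)⁻¹ ≤ 2 ^ n * ((1 + |t|) ^ n)⁻¹ := by
      rw [← div_eq_mul_inv, le_div_iff₀ (by positivity), ← div_eq_inv_mul,
        div_le_iff₀ (by positivity), ← mul_pow]
      exact pow_le_pow_left₀ (by positivity) h2 n
    simp only [hq, norm_mul, norm_inv, norm_pow]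
    calc _ ≤ C * (1 + |t|) ^ N * (2 ^ n * ((1 + |t|) ^ n)⁻¹) := by gcongr
      _ = _ := by
        have : (1 + |t|) ≠ 0 := by positivity
        rw [hn, pow_add (1 + |t|)]
        field_simp
  have hqi : Integrable q := (integrable_inv_one_add_abs_sq.const_mul _).mono'
    hqc.aestronglyMeasurable (Eventually.of_forall hqb)
  have hpc : ∀ g : 𝓢(ℝ, ℂ), Continuous fun t => pairing δ g (z t) := fun g =>
    continuous_vertical fun s hs => (differentiableAt_pairing δ g (hs ▸ hc0)).continuousAt
  have hpb : ∀ (g : 𝓢(ℝ, ℂ)) (t : ℝ),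
      ‖pairing δ g (z t)‖ ≤ ∫ x : ℝ, (|x| ^ 0 * ‖g x‖ + |x| ^ 1 * ‖g x‖) := fun g t =>
    norm_pairing_le δ g (by rw [hzre]; exact hc0) (by rw [hzre, hc]; norm_num)
  have hInt : ∀ g : 𝓢(ℝ, ℂ), Integrable fun t => q t * pairing δ g (z t) := fun g =>
    hqi.mul_bdd (hpc g).aestronglyMeasurable (Eventually.of_forall (hpb g))
  obtain ⟨T, C', hC', hT⟩ := exists_seminorm_integral_le 1
  let L : 𝓢(ℝ, ℂ) →L[ℂ] ℂ := SchwartzMap.mkCLMtoNormedSpace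
    (fun g => ∫ t, q t * pairing δ g (z t))
    (fun f g => by
      rw [← integral_add (hInt f) (hInt g)]
      refine integral_congr_ae (Eventually.of_forall fun t => ?_)
      have := pairing_add δ f g (s := z t) (by rw [hzre]; exact hc0)
      change q t * pairing δ (fun x => f x + g x) (z t) = _
      rw [this, mul_add])
    (fun a f => by
      simp only [RingHom.id_apply, smul_eq_mul]
      rw [← integral_const_mul]
      refine integral_congr_ae (Eventually.of_forall fun t => ?_)
      change q t * pairing δ (fun x => a * f x) (z t) = _
      rw [pairing_const_mul]
      ring)
    ⟨T, (∫ t, ‖q t‖) * C', mul_nonneg (integral_nonneg fun _ => norm_nonneg _) hC', fun f => by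
      have h1 : ‖∫ t, q t * pairing δ f (z t)‖ ≤
          ∫ t, ‖q t‖ * ∫ x : ℝ, (|x| ^ 0 * ‖f x‖ + |x| ^ 1 * ‖f x‖) := by
        refine norm_integral_le_of_norm_le (hqi.norm.mul_const _) (Eventually.of_forall fun t => ?_)
        rw [norm_mul]
        gcongr
        exact hpb f t
      rw [integral_mul_const] at h1
      refine h1.trans ?_
      rw [mul_assoc]
      gcongr
      exact hT f⟩
  let F : 𝓢(ℝ, ℂ) →L[ℂ] ℂ := (4 * Real.pi : ℂ)⁻¹ • (L ∘L (eulerCLM ^ n))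
  refine ⟨ContinuousLinearMap.toPointwiseConvergenceCLM _ _ _ _ F, fun f => ?_⟩
  change (4 * Real.pi : ℂ)⁻¹ * ∫ t, q t * pairing δ ((eulerCLM ^ n) f) (z t) = _
  rw [lineInt]
  congr 1
  refine integral_congr_ae (Eventually.of_forall fun t => ?_)
  simp only
  rw [FunLike.coe_pow_eq_iterate, coe_eulerCLM_iterate,
    pairing_euler_iterate δ f (by rw [hzre]; exact hc0)]
  have := pow_ne_zero n (hz1 t)
  simp only [hq]
  field_simp
  rfl

/-- The tempered distribution with signed Mellin transform `H`. -/
def inverseMellin {H : ℂ → ℂ} (hH : H ∈ entireModerate) : 𝓢'(ℝ, ℂ) :=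
  (exists_tempered_lineInt δ hH).choose

theorem inverseMellin_apply {H : ℂ → ℂ} (hH : H ∈ entireModerate) (f : 𝓢(ℝ, ℂ)) {c : ℝ}
    (hc : c < 0) : inverseMellin δ hH f = lineInt δ H c f :=
  ((exists_tempered_lineInt δ hH).choose_spec f).trans
    (lineInt_schwartz_eq δ hH f (by norm_num) hc)

/-- For test functions supported away from 0 the pairing is entire and decays rapidly in every
strip, so the contour may be placed anywhere, not only at c < 0. -/
theorem ofTempered_inverseMellin_incl {H : ℂ → ℂ} (hH : H ∈ entireModerate)
    (φ : 𝓓(puncturedLine, ℂ)) (c : ℝ) :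
    ofTempered (inverseMellin δ hH) (incl φ) = lineInt δ H c φ := by
  rw [lineInt_testFunction_eq δ hH φ c (-1)]
  change inverseMellin δ hH (toSchwartz (incl φ)) = _
  rw [inverseMellin_apply δ hH _ (c := -1) (by norm_num), coe_toSchwartz_incl]

theorem hasParity_inverseMellin {H : ℂ → ℂ} (hH : H ∈ entireModerate) :
    HasParity δ (inverseMellin δ hH) := by
  intro f
  rw [inverseMellin_apply δ hH _ (c := -1) (by norm_num),
    inverseMellin_apply δ hH _ (c := -1) (by norm_num), lineInt, lineInt, mul_left_comm,
    ← integral_const_mul ((-1 : ℂ) ^ δ.val)]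
  congr 1
  refine integral_congr_ae (Eventually.of_forall fun t => ?_)
  have h : ∀ s : ℂ, pairing δ (SchwartzMap.compCLMOfContinuousLinearEquiv ℂ
      (ContinuousLinearEquiv.neg ℝ) f) s = (-1) ^ δ.val * pairing δ f s := by
    intro s
    rw [pairing, pairing, ← integral_const_mul,
      ← integral_neg_eq_self (fun x => (SchwartzMap.compCLMOfContinuousLinearEquiv ℂ
      (ContinuousLinearEquiv.neg ℝ) f) x * mellinKernel δ (1 - s) x)]
    refine integral_congr_ae (Eventually.of_forall fun x => ?_)
    simp only [mellinKernel_neg, SchwartzMap.compCLMOfContinuousLinearEquiv_apply,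
      Function.comp_apply, ContinuousLinearEquiv.neg_apply, neg_neg]
    ring
  simp only [h]
  ring

end Inverse

/-! ### Infinite-order vanishing of the inverse transform -/

section InverseVanishing

variable (δ : ZMod 2)

/-- The operator `g ↦ (d/dx)^n (x^n g)` on Schwartz functions. -/
def derivPow : ℕ → 𝓢(ℝ, ℂ) → 𝓢(ℝ, ℂ)
  | 0, g => g
  | n + 1, g => derivPow n (eulerCLM g + (n + 1 : ℂ) • g)

theorem coe_derivPow (n : ℕ) (g : 𝓢(ℝ, ℂ)) :
    ⇑(derivPow n g) = iteratedDeriv n fun x : ℝ => (x : ℂ) ^ n * g x := by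
  induction n generalizing g with
  | zero => simp [derivPow]
  | succ n ih =>
    rw [derivPow, ih, iteratedDeriv_succ']
    congr 1
    ext x
    have h := ((Complex.ofRealCLM.hasDerivAt (x := x)).pow (n + 1)).mul
      (g.differentiableAt (x := x)).hasDerivAt
    have h' : deriv (fun x : ℝ => (x : ℂ) ^ (n + 1) * g x) x = _ := h.deriv
    rw [h']
    have e : (eulerCLM g + (n + 1 : ℂ) • g) x = euler g x + (n + 1) * g x := by
      rw [← coe_eulerCLM]; rfl
    rw [e]
    simp only [Complex.ofRealCLM_apply, Complex.ofReal_one, euler, Pi.pow_apply,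
      Nat.add_sub_cancel]
    push_cast
    ring

/-- The operator is (θ+1)⋯(θ+n), and θ + j + 1 acts on the pairing as (w - 1) + (j + 1) = w + j. -/
theorem pairing_derivPow (n : ℕ) (g : 𝓢(ℝ, ℂ)) {w : ℂ} (hw : w.re < 0) :
    pairing δ (derivPow n g) w = (∏ j ∈ Finset.range n, (w + j)) * pairing δ g w := by
  induction n generalizing g with
  | zero => simp [derivPow]
  | succ n ih =>
    rw [derivPow, ih, Finset.prod_range_succ]
    have h1 := pairing_add δ (eulerCLM g) ((n + 1 : ℂ) • g) hw
    have h2 : pairing δ ⇑((n + 1 : ℂ) • g : 𝓢(ℝ, ℂ)) w = (n + 1 : ℂ) * pairing δ g w :=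
      pairing_const_mul δ (n + 1 : ℂ) g w
    rw [h2, coe_eulerCLM, pairing_euler δ g hw] at h1
    change _ * pairing δ (fun x => (eulerCLM g) x + ((n + 1 : ℂ) • g) x) w = _
    rw [coe_eulerCLM, h1]
    ring

/-- The tangential operator `(-1)^n x^n (d/dx)^n`. -/
def powDiffOp (n : ℕ) : DiffOp ⊤ where
  order := n
  coeff i x := if i = n then (-1) ^ n * (x : ℂ) ^ n else 0
  smooth i := by
    by_cases h : i = n
    · simp only [h, if_true]
      exact (contDiff_const.mul (Complex.ofRealCLM.contDiff.pow n)).contDiffOn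
    · simp only [h, if_false]
      exact contDiffOn_const

theorem isTangential_powDiffOp (n : ℕ) : (powDiffOp n).IsTangential := by
  intro V hV h0 k g hg
  have e : (powDiffOp n).apply g = fun x : ℝ => (-1) ^ n * ((x : ℂ) ^ n * iteratedDeriv n g x) := by
    ext x
    simp only [DiffOp.apply, powDiffOp]
    rw [Finset.sum_eq_single n (fun i _ hi => by simp [hi]) (fun h => by simp at h)]
    simp only [if_true]
    ring
  rw [e]
  refine SmoothVanishing.const_mul _ ?_
  have h2 : SmoothVanishing V (k - n) (iteratedDeriv n g) := by
    refine ⟨contDiffOn_iteratedDeriv V.isOpen hg.1 n, fun j hj => ?_⟩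
    have := hg.2 (j + n) (by omega)
    rwa [iteratedDeriv_eq_iterate, Function.iterate_add_apply, ← iteratedDeriv_eq_iterate,
      ← iteratedDeriv_eq_iterate] at this
  exact ((smoothVanishing_pow V n).mul h0 h2).of_le (by omega)

theorem transpose_powDiffOp (n : ℕ) (g : ℝ → ℂ) :
    (powDiffOp n).transpose g = iteratedDeriv n fun x : ℝ => (x : ℂ) ^ n * g x := by
  ext x
  simp only [DiffOp.transpose, powDiffOp]
  rw [Finset.sum_eq_single n (fun i _ hi => by simp [hi]) (fun h => by simp at h)]
  simp only [if_true, mul_assoc]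
  rw [iteratedDeriv_const_mul_field, ← mul_assoc, ← mul_pow]
  simp

theorem hasTemperateGrowth_ofReal_pow (m : ℕ) :
    (fun x : ℝ => (x : ℂ) ^ m).HasTemperateGrowth := by
  induction m with
  | zero => simp
  | succ m ih =>
    simp only [pow_succ]
    exact ih.mul Complex.ofRealCLM.hasTemperateGrowth

theorem VanishesToOrder.of_le {j k : ℕ} (h : j ≤ k) {T : Dist ⊤} (hT : VanishesToOrder k T) :
    VanishesToOrder j T := by
  obtain ⟨U, hU, N, f, D, g, hf, hD, hg, hT⟩ := hT
  exact ⟨U, hU, N, f, D, g, fun i => (hf i).of_le h, hD, hg, hT⟩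

/-- On re s = -1/2 - 2k the kernel factors as x^(2k) times the kernel on re w = -1/2. Dividing H by
w(w+1)⋯(w+n-1) makes the t-integral converge absolutely to a function h = O(|x|^(1/2)), and the
division is undone by the tangential operator (-1)^n x^n (d/dx)^n. Fubini then gives the required
form x^(2k) D h. -/
theorem vanishesToInfiniteOrder_inverseMellin {H : ℂ → ℂ} (hH : H ∈ entireModerate) :
    VanishesToInfiniteOrder (ofTempered (inverseMellin δ hH)) := by
  intro k
  refine VanishesToOrder.of_le (show k ≤ 2 * k by omega) ?_
  -- The even shift preserves the sign character; the offset -1/2 keeps every w + j at distance at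
  -- least 1/2 from 0, while -re w = 1/2 makes h locally bounded.
  set c : ℝ := -1 / 2 - (2 * k : ℕ) with hc
  have hc0 : c < 0 := by
    have : (0 : ℝ) ≤ (2 * k : ℕ) := Nat.cast_nonneg _
    rw [hc]
    linarith
  obtain ⟨C, N, hC, hHb⟩ := exists_norm_le_of_mem_entireModerate hH c c
  set n := N + 2 with hn
  set z : ℝ → ℂ := fun t => c + t * Complex.I with hz
  set w : ℝ → ℂ := fun t => ((-1 / 2 : ℝ) : ℂ) + t * Complex.I with hw
  have hzw : ∀ t, z t = w t - (2 * k : ℕ) := fun t => by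
    simp only [hz, hw, hc]
    push_cast
    ring
  have hzc : Continuous z := by fun_prop
  have hwc : Continuous w := by fun_prop
  have hwre : ∀ t, (w t).re = -1 / 2 := fun t => re_add_mul_I _ t
  have hwim : ∀ t, (w t).im = t := fun t => im_add_mul_I _ t
  have hwre0 : ∀ t, (w t).re < 0 := fun t => by rw [hwre]; norm_num
  have hwj : ∀ (t : ℝ) (j : ℕ), (1 + |t|) / 3 ≤ ‖w t + j‖ := fun t j => by
    have h1 := Complex.abs_im_le_norm (w t + j)
    have h2 := Complex.abs_re_le_norm (w t + j)
    simp only [Complex.add_im, Complex.add_re, hwre, hwim, Complex.natCast_re, Complex.natCast_im,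
      add_zero] at h1 h2
    have h3 : (1 : ℝ) / 2 ≤ |-1 / 2 + (j : ℝ)| := by
      rcases j with _ | j
      · norm_num
      · rw [le_abs]
        left
        push_cast
        linarith [Nat.cast_nonneg (α := ℝ) j]
    linarith
  set P : ℝ → ℂ := fun t => ∏ j ∈ Finset.range n, (w t + j) with hP
  have hPb : ∀ t, ((1 + |t|) / 3) ^ n ≤ ‖P t‖ := fun t => by
    simp only [hP, norm_prod]
    calc ((1 + |t|) / 3) ^ n = ∏ j ∈ Finset.range n, (1 + |t|) / 3 := by
          rw [Finset.prod_const, Finset.card_range]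
      _ ≤ _ := Finset.prod_le_prod (fun _ _ => by positivity) fun j _ => hwj t j
  have hP0 : ∀ t, P t ≠ 0 := fun t h => by
    have := hPb t
    rw [h, norm_zero] at this
    exact absurd this (not_le.2 (by positivity))
  have hPc : Continuous P := continuous_finsetProd _ fun j _ => hwc.add continuous_const
  set q : ℝ → ℂ := fun t => H (z t) * (P t)⁻¹ with hq
  have hqc : Continuous q := (hH.1.continuous.comp hzc).mul (hPc.inv₀ hP0)
  have hqb : ∀ t, ‖q t‖ ≤ C * 3 ^ n * ((1 + |t|) ^ 2)⁻¹ := fun t => by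
    have h1 := hHb (z t) (re_add_mul_I c t).ge (re_add_mul_I c t).le
    rw [im_add_mul_I] at h1
    simp only [hq, norm_mul, norm_inv]
    calc _ ≤ C * (1 + |t|) ^ N * (((1 + |t|) / 3) ^ n)⁻¹ := by
          gcongr
          exact hPb t
      _ = _ := by
        have : (1 + |t|) ≠ 0 := by positivity
        rw [hn, div_pow, pow_add (1 + |t|)]
        field_simp
  have hqi : Integrable q := (integrable_inv_one_add_abs_sq.const_mul _).mono'
    hqc.aestronglyMeasurable (Eventually.of_forall hqb)
  set κ : ℝ × ℝ → ℂ := fun p => q p.1 * mellinKernel δ (1 - w p.1) p.2 with hκ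
  have hκm : Measurable κ := (hqc.measurable.comp measurable_fst).mul
    ((measurable_mellinKernel_uncurry δ).comp
      ((measurable_const.sub (hwc.measurable.comp measurable_fst)).prodMk measurable_snd))
  have hker : ∀ t x, ‖mellinKernel δ (1 - w t) x‖ = |x| ^ (1 / 2 : ℝ) := fun t x => by
    rw [norm_mellinKernel_one_sub δ (hwre0 t), hwre]
    norm_num
  set h : ℝ → ℂ := fun x => (4 * Real.pi : ℂ)⁻¹ * ∫ t, κ (t, x) with hh
  have hhm : AEStronglyMeasurable h := by
    have : StronglyMeasurable fun x => ∫ t, κ (t, x) :=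
      hκm.stronglyMeasurable.integral_prod_left
    exact (this.aestronglyMeasurable.const_mul _)
  have hhb : ∀ x, ‖h x‖ ≤ ‖(4 * Real.pi : ℂ)⁻¹‖ * ((∫ t, ‖q t‖) * |x| ^ (1 / 2 : ℝ)) := fun x => by
    simp only [hh, norm_mul]
    gcongr
    rw [← integral_mul_const]
    refine norm_integral_le_of_norm_le (hqi.norm.mul_const _) (Eventually.of_forall fun t => ?_)
    simp only [hκ, norm_mul, hker]
    exact le_rfl
  refine ⟨⊤, trivial, 1, fun _ x => (x : ℂ) ^ (2 * k), fun _ => powDiffOp n, fun _ => h,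
    fun _ => smoothVanishing_pow _ _, fun _ => isTangential_powDiffOp n, fun _ K hK _ => ?_,
    fun φ => ?_⟩
  · obtain ⟨R, hR⟩ := hK.isBounded.exists_norm_le
    refine memLp_top_of_bound hhm.restrict
      (‖(4 * Real.pi : ℂ)⁻¹‖ * ((∫ t, ‖q t‖) * R ^ (1 / 2 : ℝ))) ?_
    filter_upwards [ae_restrict_mem hK.measurableSet] with x hx
    refine (hhb x).trans ?_
    have : |x| ≤ R := hR x hx
    have h1 : 0 ≤ ∫ t, ‖q t‖ := integral_nonneg fun _ => norm_nonneg _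
    gcongr
  · simp only [Finset.univ_unique, Finset.sum_singleton, transpose_powDiffOp]
    have hpow : (fun x : ℝ => (x : ℂ) ^ (2 * k)).HasTemperateGrowth :=
      hasTemperateGrowth_ofReal_pow _
    set g : 𝓢(ℝ, ℂ) := SchwartzMap.smulLeftCLM ℂ (fun x : ℝ => (x : ℂ) ^ (2 * k))
      (toSchwartz (incl φ)) with hg
    have hgx : ∀ x, g x = (x : ℂ) ^ (2 * k) * φ x := fun x => by
      rw [hg, SchwartzMap.smulLeftCLM_apply_apply hpow, coe_toSchwartz_incl, smul_eq_mul]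
    have hG : (iteratedDeriv n fun x : ℝ => (x : ℂ) ^ n * ((x : ℂ) ^ (2 * k) * φ x)) =
        derivPow n g := by
      rw [coe_derivPow]
      simp only [hgx]
    rw [hG]
    change inverseMellin δ hH (toSchwartz (incl φ)) = _
    rw [inverseMellin_apply δ hH _ hc0, coe_toSchwartz_incl, lineInt]
    have hpair : ∀ t, H (z t) * pairing δ φ (z t) = ∫ x, derivPow n g x * κ (t, x) := fun t => by
      have e1 : pairing δ φ (z t) = pairing δ g (w t) := by
        refine integral_congr_ae ?_
        filter_upwards [compl_mem_ae_iff.2 (measure_singleton (0 : ℝ))] with x hx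
        rw [hgx, hzw, show (1 : ℂ) - (w t - (2 * k : ℕ)) = (1 - w t) + (2 * k : ℕ) by ring,
          mellinKernel_add_two_mul δ _ k hx, pow_mul]
        ring
      have e2 := pairing_derivPow δ n g (hwre0 t)
      have e3 : ∫ x, derivPow n g x * κ (t, x) = q t * pairing δ (derivPow n g) (w t) := by
        rw [pairing, ← integral_const_mul]
        refine integral_congr_ae (Eventually.of_forall fun x => ?_)
        simp only [hκ]
        ring
      rw [e3, e2, e1]
      have := hP0 t
      simp only [hq]
      change _ = H (z t) * (P t)⁻¹ * (P t * pairing δ g (w t))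
      field_simp
    have hI : Integrable (Function.uncurry fun t x => derivPow n g x * κ (t, x))
        ((volume : Measure ℝ).prod volume) := by
      have h1 : Integrable fun x : ℝ => ‖derivPow n g x‖ * |x| ^ (1 / 2 : ℝ) := by
        have := (integrable_mul_mellinKernel δ (derivPow n g) (hwre0 0)).norm
        simpa only [norm_mul, hker] using this
      refine (hqi.norm.mul_prod h1).mono' ?_ (Eventually.of_forall fun p => ?_)
      · exact (((derivPow n g).continuous.measurable.comp measurable_snd).mul
          hκm).aestronglyMeasurable
      · simp only [Function.uncurry, hκ, norm_mul, hker]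
        exact le_of_eq (by ring)
    have hswap := integral_integral_swap hI
    have e4 : ∫ t : ℝ, H (c + t * Complex.I) * pairing δ φ (c + t * Complex.I) =
        ∫ t, ∫ x, derivPow n g x * κ (t, x) :=
      integral_congr_ae (Eventually.of_forall hpair)
    rw [e4, hswap, ← integral_const_mul]
    refine integral_congr_ae (Eventually.of_forall fun x => ?_)
    simp only [hh]
    rw [integral_const_mul]
    ring

end InverseVanishing

/-! ### Inversion and multiplication by the kernel, seen on H -/

section Substitution

theorem moderateGrowth_of_bound {H : ℂ → ℂ} (h : ∀ a b : ℝ, ∃ (C : ℝ) (N : ℕ), 0 ≤ C ∧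
    ∀ s : ℂ, a ≤ s.re → s.re ≤ b → ‖H s‖ ≤ C * (1 + |s.im|) ^ N) : ModerateGrowth H := by
  intro a b _
  obtain ⟨C, N, hC, hb⟩ := h a b
  refine ⟨1, (C + 1) * 2 ^ N, N, one_pos, by positivity, fun s h1 h2 h3 => ?_⟩
  calc ‖H s‖ ≤ C * (1 + |s.im|) ^ N := hb s h1 h2
    _ ≤ (C + 1) * (2 * |s.im|) ^ N := by gcongr <;> linarith
    _ = _ := by rw [mul_pow]; ring

theorem entireModerate_comp_add {H : ℂ → ℂ} (hH : H ∈ entireModerate) (z : ℂ) :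
    (fun w => H (w + z)) ∈ entireModerate := by
  refine ⟨hH.1.comp (differentiable_id.add_const z), moderateGrowth_of_bound fun a b => ?_⟩
  obtain ⟨C, N, hC, h⟩ := exists_norm_le_of_mem_entireModerate hH (a + z.re) (b + z.re)
  refine ⟨C * (1 + |z.im|) ^ N, N, by positivity, fun s h1 h2 => ?_⟩
  refine (h (s + z) (by simpa using h1) (by simpa using h2)).trans ?_
  rw [mul_assoc, ← mul_pow]
  gcongr
  rw [Complex.add_im]
  nlinarith [abs_add_le s.im z.im, abs_nonneg s.im, abs_nonneg z.im,
    mul_nonneg (abs_nonneg s.im) (abs_nonneg z.im)]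

theorem entireModerate_comp_neg {H : ℂ → ℂ} (hH : H ∈ entireModerate) :
    (fun w => H (-w)) ∈ entireModerate := by
  refine ⟨hH.1.comp differentiable_neg, moderateGrowth_of_bound fun a b => ?_⟩
  obtain ⟨C, N, hC, h⟩ := exists_norm_le_of_mem_entireModerate hH (-b) (-a)
  refine ⟨C, N, hC, fun s h1 h2 => ?_⟩
  have := h (-s) (by simpa using h2) (by simpa using h1)
  rwa [Complex.neg_im, abs_neg] at this

theorem entireModerate_comp_sub {H : ℂ → ℂ} (hH : H ∈ entireModerate) (z : ℂ) :
    (fun w => H (z - w)) ∈ entireModerate := by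
  have := entireModerate_comp_neg (entireModerate_comp_add hH z)
  simpa only [neg_add_eq_sub] using this

variable (δ : ZMod 2)

theorem mellin_congr {f g : ℝ → ℂ} (h : EqOn f g (Ioi 0)) (s : ℂ) : mellin f s = mellin g s :=
  setIntegral_congr_fun measurableSet_Ioi fun x hx => by simp only [h hx]

theorem pairing_testFunction_eq_mellin (φ : 𝓓(puncturedLine, ℂ)) (s : ℂ) :
    pairing δ φ s = mellin (symm δ φ) (1 - s) :=
  pairing_eq_mellin δ (integrable_testFunction_mul_mellinKernel δ φ s)

theorem pairing_invTest (φ : 𝓓(puncturedLine, ℂ)) (w : ℂ) :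
    pairing δ (invTest φ) w = pairing δ φ (2 - w) := by
  rw [pairing_testFunction_eq_mellin, pairing_testFunction_eq_mellin,
    mellin_congr (g := fun t => symm δ φ t⁻¹), mellin_comp_inv]
  · congr 1
    ring
  · intro x _
    simp only [symm, invTest_apply, inv_neg]

theorem pairing_inv_sq_invTest (φ : 𝓓(puncturedLine, ℂ)) (w : ℂ) :
    pairing δ (mulTest _ contDiffOn_inv_sq (invTest φ)) w = pairing δ φ (-w) := by
  rw [pairing_testFunction_eq_mellin, pairing_testFunction_eq_mellin,
    mellin_congr (g := fun t : ℝ => (t : ℂ) ^ (-2 : ℂ) • symm δ φ t⁻¹), mellin_cpow_smul,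
    mellin_comp_inv]
  · congr 1
    ring
  · intro x _
    have : (x : ℂ) ^ (-2 : ℂ) = ((x : ℂ) ^ 2)⁻¹ := by
      rw [Complex.cpow_neg]
      norm_cast
    simp only [symm, mulTest_apply, invTest_apply, inv_neg, this, smul_eq_mul, Complex.ofReal_neg,
      neg_sq]
    ring

/-- The two sign factors cancel, so the density is even and its inverse transforms are taken with
parity 0. -/
theorem mellinKernel_mul_mellinKernel (s w : ℂ) {x : ℝ} (hx : x ≠ 0) :
    mellinKernel δ s x * mellinKernel δ (1 - w) x = mellinKernel 0 (1 - (w + 1 - s)) x := by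
  rw [mellinKernel_of_ne_zero _ _ hx, mellinKernel_of_ne_zero _ _ hx,
    mellinKernel_of_ne_zero _ _ hx, mul_mul_mul_comm, ← mul_pow, ← Complex.exp_add]
  have : ((Real.sign x : ℝ) : ℂ) * ((Real.sign x : ℝ) : ℂ) = 1 := by
    rcases Real.sign_apply_eq_of_ne_zero x hx with h | h <;> simp [h]
  rw [this, one_pow, ZMod.val_zero, pow_zero]
  congr 2
  ring

theorem pairing_mellinKernel_mul (φ : 𝓓(puncturedLine, ℂ)) (s w : ℂ) :
    pairing δ (mulTest (mellinKernel δ s) (contDiffOn_mellinKernel δ s) φ) w =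
      pairing 0 φ (w + 1 - s) := by
  refine integral_congr_ae ?_
  filter_upwards [compl_mem_ae_iff.2 (measure_singleton (0 : ℝ))] with x hx
  rw [mulTest_apply, ← mellinKernel_mul_mellinKernel δ s w hx]
  ring

theorem integral_reflect (G : ℂ → ℂ) (a c : ℝ) :
    ∫ t : ℝ, G (a - (c + t * Complex.I)) = ∫ t : ℝ, G ((a - c : ℝ) + t * Complex.I) := by
  rw [← integral_neg_eq_self fun t : ℝ => G ((a - c : ℝ) + t * Complex.I)]
  refine integral_congr_ae (Eventually.of_forall fun t => ?_)
  simp only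
  congr 1
  push_cast
  ring

theorem integral_translate (G : ℂ → ℂ) (c : ℝ) (z : ℂ) :
    ∫ t : ℝ, G (c + t * Complex.I - z) = ∫ t : ℝ, G ((c - z.re : ℝ) + t * Complex.I) := by
  rw [← integral_sub_right_eq_self (fun t : ℝ => G ((c - z.re : ℝ) + t * Complex.I)) z.im]
  refine integral_congr_ae (Eventually.of_forall fun t => ?_)
  simp only
  congr 1
  conv_lhs => rw [← Complex.re_add_im z]
  push_cast
  ring

theorem lineInt_inv_sq_invTest (H : ℂ → ℂ) (φ : 𝓓(puncturedLine, ℂ)) (c : ℝ) :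
    lineInt δ (fun w => H (-w)) c (mulTest _ contDiffOn_inv_sq (invTest φ)) =
      lineInt δ H (-c) φ := by
  simp only [lineInt, pairing_inv_sq_invTest]
  have := integral_reflect (fun s => H s * pairing δ φ s) 0 c
  simp only [Complex.ofReal_zero, zero_sub] at this
  rw [this]

theorem lineInt_invTest (H : ℂ → ℂ) (φ : 𝓓(puncturedLine, ℂ)) (c : ℝ) :
    lineInt δ (fun w => H (2 - w)) c (invTest φ) = lineInt δ H (2 - c) φ := by
  simp only [lineInt, pairing_invTest]
  have := integral_reflect (fun s => H s * pairing δ φ s) 2 c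
  simp only [Complex.ofReal_ofNat] at this
  rw [this]

theorem lineInt_mellinKernel_mul (H : ℂ → ℂ) (φ : 𝓓(puncturedLine, ℂ)) (s : ℂ) (c : ℝ) :
    lineInt δ H c (mulTest (mellinKernel δ s) (contDiffOn_mellinKernel δ s) φ) =
      lineInt 0 (fun w => H (w + (s - 1))) (c - (s - 1).re) φ := by
  simp only [lineInt, pairing_mellinKernel_mul]
  have := integral_translate (fun w => H (w + (s - 1)) * pairing 0 φ w) c (s - 1)
  simp only [sub_add_cancel] at this
  rw [← this]
  simp only [sub_sub_eq_add_sub]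

/-- In the coordinate y = 1/x the distribution is the inverse transform of H(-w), so vanishing at ∞
is vanishing at 0 for another function of the same class. -/
theorem inverseMellin_mem_mellinSource {H : ℂ → ℂ} (hH : H ∈ entireModerate) :
    inverseMellin δ hH ∈ mellinSource δ := by
  refine ⟨hasParity_inverseMellin δ hH, vanishesToInfiniteOrder_inverseMellin δ hH,
    ⟨ofTempered (inverseMellin δ hH), ofTempered (inverseMellin δ (entireModerate_comp_neg hH)),
      fun φ => ?_⟩, rfl, vanishesToInfiniteOrder_inverseMellin δ _⟩
  rw [ofTempered_inverseMellin_incl δ hH φ (-0),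
    ofTempered_inverseMellin_incl δ (entireModerate_comp_neg hH) _ 0, lineInt_inv_sq_invTest]

/-- Multiplying by the kernel translates H by s - 1; passing to dy then replaces w by 2 - w, the
Jacobian accounting for the 2. Both coefficients are inverse transforms, so their vanishing is
already known. -/
theorem exists_projDensity {H : ℂ → ℂ} (hH : H ∈ entireModerate) (s : ℂ) : ∃ μ : ProjDensity,
    (∀ φ : 𝓓(puncturedLine, ℂ), μ.fin (incl φ) = ofTempered (inverseMellin δ hH)
      (incl (mulTest (mellinKernel δ s) (contDiffOn_mellinKernel δ s) φ))) ∧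
    VanishesToInfiniteOrder μ.fin ∧ VanishesToInfiniteOrder μ.inf := by
  have h1 := entireModerate_comp_add hH (s - 1)
  have h2 := entireModerate_comp_sub h1 2
  refine ⟨⟨ofTempered (inverseMellin 0 h1), ofTempered (inverseMellin 0 h2), fun φ => ?_⟩,
    fun φ => ?_, vanishesToInfiniteOrder_inverseMellin 0 h1,
    vanishesToInfiniteOrder_inverseMellin 0 h2⟩
  · rw [ofTempered_inverseMellin_incl 0 h1 φ (2 - 0), ofTempered_inverseMellin_incl 0 h2 _ 0,
      ← lineInt_invTest]
  · rw [ofTempered_inverseMellin_incl 0 h1 φ (0 - (s - 1).re),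
      ofTempered_inverseMellin_incl δ hH _ 0, lineInt_mellinKernel_mul]

/-- A smooth partition of unity subordinate to the two coordinate domains. -/
theorem exists_partition : ∃ φ χ : 𝓓((⊤ : Opens ℝ), ℂ), ∀ x : ℝ, x ≠ 0 → φ x + χ x⁻¹ = 1 := by
  obtain ⟨β, hβ1, hβ0⟩ := exists_cutoff
  set χ : ℝ → ℂ := fun y => if y = 0 then 1 else 1 - β y⁻¹ with hχ
  have hz : ∀ y, 1 < |y| → χ y = 0 := fun y hy => by
    have hy0 : y ≠ 0 := by
      rintro rfl
      norm_num at hy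
    have : |y⁻¹| ≤ 1 := by
      rw [abs_inv]
      exact inv_le_one_of_one_le₀ hy.le
    simp only [hχ, hy0, if_false, hβ1 _ this, sub_self]
  refine ⟨β, ⟨χ, contDiff_iff_contDiffAt.2 fun y => ?_, isCompact_Icc.of_isClosed_subset
    (isClosed_tsupport _) (tsupport_subset_Icc_of hz), subset_univ _⟩, fun x hx => ?_⟩
  · rcases eq_or_ne y 0 with rfl | hy
    · refine contDiffAt_const (c := (1 : ℂ)).congr_of_eventuallyEq ?_
      filter_upwards [Metric.closedBall_mem_nhds (0 : ℝ) (show (0 : ℝ) < 1 / 2 by norm_num)] with y hy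
      rw [Metric.mem_closedBall, dist_zero_right, Real.norm_eq_abs] at hy
      by_cases hy0 : y = 0
      · simp [hχ, hy0]
      · have : 2 ≤ |y⁻¹| := by
          rw [abs_inv, le_inv_comm₀ two_pos (abs_pos.2 hy0)]
          linarith
        simp only [hχ, hy0, if_false, hβ0 _ this, sub_zero]
    · refine ContDiffAt.congr_of_eventuallyEq (f := fun y => 1 - β y⁻¹) ?_ ?_
      · exact contDiffAt_const.sub (β.contDiff.contDiffAt.comp y (contDiffAt_inv ℝ hy))
      · filter_upwards [isOpen_ne.mem_nhds hy] with y hy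
        exact if_neg hy
  · change β x + χ x⁻¹ = 1
    simp only [hχ, inv_eq_zero, hx, if_false, inv_inv]
    ring

end Substitution

/-! ### The integral of a density as a limit over `ℝ ∖ {0}` -/

section Exhaustion

/-- For `φ` equal to `1` near `0`, the test function
`φ(x) (1 - φ((n+1)x)) + (1 - φ(x)) φ(x/(n+1))` on `ℝ ∖ {0}`. -/
def exhaust (φ : 𝓓((⊤ : Opens ℝ), ℂ)) (h : φ =ᶠ[𝓝 0] 1) (n : ℕ) : 𝓓(puncturedLine, ℂ) :=
  puncTest (φ - mulTest φ φ.contDiff.contDiffOn (scaleTest φ (n + 1) (by positivity)) +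
    (scaleTest φ (n + 1 : ℝ)⁻¹ (by positivity) -
      mulTest φ φ.contDiff.contDiffOn (scaleTest φ (n + 1 : ℝ)⁻¹ (by positivity)))) (by
    have h1 : ∀ c : ℝ, ∀ᶠ x in 𝓝 (0 : ℝ), φ (c * x) = 1 := fun c => by
      have : Tendsto (fun x : ℝ => c * x) (𝓝 0) (𝓝 0) := by
        simpa using (continuous_const_mul c).tendsto 0
      exact this.eventually h
    filter_upwards [h, h1 (n + 1), h1 (n + 1 : ℝ)⁻¹] with x hx h2 h3
    simp [hx, h2, h3])

theorem one_sub_exhaust (φ : 𝓓((⊤ : Opens ℝ), ℂ)) (h : φ =ᶠ[𝓝 0] 1) (n : ℕ) (x : ℝ) :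
    1 - exhaust φ h n x =
      φ x * φ ((n + 1) * x) + (1 - φ x) * (1 - φ ((n + 1 : ℝ)⁻¹ * x)) := by
  have e : exhaust φ h n x = (φ x - φ x * φ ((n + 1) * x)) +
    (φ ((n + 1 : ℝ)⁻¹ * x) - φ x * φ ((n + 1 : ℝ)⁻¹ * x)) := rfl
  rw [e]
  ring

/-- Near 0 the point 1/x leaves the support of χ. At 0 itself, which the partition identity omits,
continuity gives the value. -/
theorem partition_eventuallyEq_one {φ χ : 𝓓((⊤ : Opens ℝ), ℂ)}
    (h : ∀ x : ℝ, x ≠ 0 → φ x + χ x⁻¹ = 1) : φ =ᶠ[𝓝 0] 1 := by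
  obtain ⟨R, hR, hχ⟩ := exists_tsupport_subset_Icc χ
  have h1 : ∀ x : ℝ, x ≠ 0 → |x| < R⁻¹ → φ x = 1 := fun x hx hxR => by
    have h2 : χ x⁻¹ = 0 := by
      by_contra h3
      have := hχ _ h3
      rw [abs_inv] at this
      have h4 := (lt_inv_comm₀ (abs_pos.2 hx) hR).1 hxR
      linarith
    simpa [h2] using h x hx
  have h0 : φ 0 = 1 := by
    have hc : Tendsto φ (𝓝[≠] 0) (𝓝 (φ 0)) :=
      (φ.continuous.tendsto 0).mono_left nhdsWithin_le_nhds
    refine tendsto_nhds_unique hc (tendsto_const_nhds.congr' ?_)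
    have hb : ∀ᶠ x in 𝓝[≠] (0 : ℝ), |x| < R⁻¹ := nhdsWithin_le_nhds (by
      have := Metric.ball_mem_nhds (0 : ℝ) (inv_pos.2 hR)
      simpa [Metric.ball, dist_zero_right] using this)
    filter_upwards [self_mem_nhdsWithin, hb] with x hx hx2
    exact (h1 x hx hx2).symm
  filter_upwards [Metric.ball_mem_nhds (0 : ℝ) (inv_pos.2 hR)] with x hx
  rcases eq_or_ne x 0 with rfl | hx0
  · exact h0
  · exact h1 x hx0 (by simpa [dist_zero_right] using hx)

/-- As 1 - φ(x) = χ(1/x), the truncation is φ minus φ(x) φ((n+1)x) plus the same expression for χ in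
the coordinate 1/x. The two subtracted terms shrink to 0 and to ∞ and are negligible by vanishing to
order 1. Hence the integral is determined by the density on `ℝ ∖ {0}`. -/
theorem ProjDensity.tendsto_exhaust {μ : ProjDensity} (h1 : VanishesToOrder 1 μ.fin)
    (h2 : VanishesToOrder 1 μ.inf) {φ χ : 𝓓((⊤ : Opens ℝ), ℂ)}
    (h : ∀ x : ℝ, x ≠ 0 → φ x + χ x⁻¹ = 1) :
    Tendsto (fun n => μ.fin (incl (exhaust φ (partition_eventuallyEq_one h) n))) atTop
      (𝓝 (μ.fin φ + μ.inf χ)) := by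
  have hφ := partition_eventuallyEq_one h
  have h' : ∀ x : ℝ, x ≠ 0 → χ x + φ x⁻¹ = 1 := fun x hx => by
    have := h x⁻¹ (inv_ne_zero hx)
    rw [inv_inv] at this
    rw [add_comm, this]
  have hχ := partition_eventuallyEq_one h'
  have key : ∀ (ψ : 𝓓((⊤ : Opens ℝ), ℂ)), ψ =ᶠ[𝓝 0] 1 → ∀ n : ℕ,
      (ψ - mulTest ψ ψ.contDiff.contDiffOn (scaleTest ψ (n + 1) (by positivity)) :
        𝓓((⊤ : Opens ℝ), ℂ)) =ᶠ[𝓝 0] 0 := fun ψ hψ n => by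
    have : Tendsto (fun x : ℝ => ((n : ℝ) + 1) * x) (𝓝 0) (𝓝 0) := by
      simpa using (continuous_const_mul ((n : ℝ) + 1)).tendsto 0
    filter_upwards [hψ, this.eventually hψ] with x hx hx2
    simp [hx, hx2]
  have l1 := h1.tendsto_mul_scaleTest φ φ
  have l2 := h2.tendsto_mul_scaleTest χ χ
  have l3 := (tendsto_const_nhds (x := μ.fin φ + μ.inf χ)).sub (l1.add l2)
  rw [add_zero, sub_zero] at l3
  refine l3.congr fun n => ?_
  have e1 : incl (exhaust φ hφ n) = incl (puncTest _ (key φ hφ n)) +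
      incl (invTest (puncTest _ (key χ hχ n))) := by
    ext x
    rw [incl_apply]
    have : (incl (puncTest _ (key φ hφ n)) + incl (invTest (puncTest _ (key χ hχ n)))) x =
        (φ x - φ x * φ ((n + 1) * x)) + (χ x⁻¹ - χ x⁻¹ * χ ((n + 1) * x⁻¹)) := by
      rw [incl_puncTest]
      simp [incl_apply]
    rw [this]
    rcases eq_or_ne x 0 with rfl | hx
    · rw [testFunction_zero]
      have e2 := hφ.eq_of_nhds
      have e3 := hχ.eq_of_nhds
      simp only [Pi.one_apply] at e2 e3
      simp [e2, e3]
    · have e2 := h x hx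
      have e3 := h ((n + 1 : ℝ)⁻¹ * x) (mul_ne_zero (by positivity) hx)
      rw [mul_inv, inv_inv] at e3
      have e4 := one_sub_exhaust φ hφ n x
      have e5 : exhaust φ hφ n x = 1 - (φ x * φ ((n + 1) * x) +
        (1 - φ x) * (1 - φ ((n + 1 : ℝ)⁻¹ * x))) := by rw [← e4]; ring
      rw [e5, eq_sub_of_add_eq' e2, eq_sub_of_add_eq' e3]
      ring
  have e6 : invTest (invTest (puncTest _ (key χ hχ n))) = puncTest _ (key χ hχ n) := by
    ext x
    simp
  rw [e1, map_add, μ.compat (invTest _), e6, incl_puncTest, incl_puncTest, map_sub, map_sub]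
  ring

end Exhaustion

/-! ### Hahn–Banach factorization and the holomorphic kernel jet -/

section Bounded

/-- A functional bounded by the norm of an injective linear map factors through this map. -/
theorem exists_factor {V B : Type*} [AddCommGroup V] [Module ℂ V] [NormedAddCommGroup B]
    [NormedSpace ℂ B] (L : V →ₗ[ℂ] ℂ) (J : V →ₗ[ℂ] B) (hJ : Function.Injective J) (C : ℝ)
    (h : ∀ v, ‖L v‖ ≤ C * ‖J v‖) : ∃ Λ : B →L[ℂ] ℂ, ∀ v, Λ (J v) = L v := by
  let e := LinearEquiv.ofInjective J hJ
  let g : LinearMap.range J →L[ℂ] ℂ :=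
    LinearMap.mkContinuous (L ∘ₗ (e.symm : LinearMap.range J →ₗ[ℂ] V)) C fun w => by
      have h1 : J (e.symm w) = w := by
        simp [e]
      have := h (e.symm w)
      rw [h1] at this
      simpa using this
  obtain ⟨Λ, hΛ, -⟩ := exists_extension_norm_eq (LinearMap.range J) g
  refine ⟨Λ, fun v => ?_⟩
  have h2 := hΛ (e v)
  have h3 : ((e v : LinearMap.range J) : B) = J v := by simp [e]
  rw [h3] at h2
  rw [h2]
  change L (e.symm (e v)) = L v
  rw [e.symm_apply_apply]

/-- Bounded complex functions on `ℝ`, with the supremum norm. -/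
abbrev BddFun : Type := lp (fun _ : ℝ => ℂ) ⊤

/-- A bounded function as an element of `BddFun`. -/
def toBdd (f : ℝ → ℂ) : BddFun :=
  haveI := Classical.propDecidable
  if h : Memℓp (E := fun _ : ℝ => ℂ) f ⊤ then ⟨f, h⟩ else 0

theorem toBdd_apply {f : ℝ → ℂ} {C : ℝ} (h : ∀ x, ‖f x‖ ≤ C) (x : ℝ) : toBdd f x = f x := by
  have hm : Memℓp (E := fun _ : ℝ => ℂ) f ⊤ :=
    memℓp_infty ⟨C, by rintro _ ⟨y, rfl⟩; exact h y⟩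
  rw [toBdd, dif_pos hm]

theorem norm_apply_le (f : BddFun) (x : ℝ) : ‖f x‖ ≤ ‖f‖ :=
  lp.norm_apply_le_norm ENNReal.top_ne_zero f x

/-- A quadratic Taylor remainder that is uniform in x is a remainder in the supremum norm. -/
theorem hasDerivAt_bddFun {F : ℂ → BddFun} {F' : BddFun} {s : ℂ} {C r : ℝ} (hC : 0 ≤ C)
    (hr : 0 < r) (h : ∀ z : ℂ, ‖z - s‖ ≤ r → ∀ x, ‖F z x - F s x - (z - s) * F' x‖ ≤
      C * ‖z - s‖ ^ 2) : HasDerivAt F F' s := by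
  rw [hasDerivAt_iff_isLittleO]
  have h1 : (fun z => F z - F s - (z - s) • F') =O[𝓝 s] fun z => ‖z - s‖ ^ 2 := by
    refine Asymptotics.IsBigO.of_bound C ?_
    filter_upwards [Metric.closedBall_mem_nhds s hr] with z hz
    rw [norm_pow, norm_norm]
    refine lp.norm_le_of_forall_le (by positivity) fun x => ?_
    rw [lp.coeFn_sub, lp.coeFn_sub, lp.coeFn_smul]
    exact h z (by simpa [dist_eq_norm] using hz) x
  exact h1.trans_isLittleO (Asymptotics.isLittleO_pow_sub_sub s one_lt_two)

theorem exists_weight_mul_euler_le (a : ℝ) (φ : 𝓓(puncturedLine, ℂ)) (j : ℕ) :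
    ∃ C : ℝ, ∀ x, ‖(weight a x : ℂ) * euler^[j] φ x‖ ≤ C := by
  have hs := contDiff_euler_iterate φ.contDiff j
  have hz : ∀ x, x ∉ tsupport φ → euler^[j] φ x = 0 := fun x hx =>
    euler_iterate_eq_zero (notMem_tsupport_iff_eventuallyEq.1 hx) j
  have hc : ContinuousOn (fun x : ℝ => (weight a x : ℂ) * euler^[j] φ x) (tsupport φ) :=
    (Complex.continuous_ofReal.comp_continuousOn ((continuousOn_weight a).mono
      fun x hx => ne_zero_of_mem_tsupport φ hx)).mul hs.continuous.continuousOn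
  obtain ⟨C, hC⟩ := φ.hasCompactSupport.isCompact.exists_bound_of_continuousOn hc
  refine ⟨max C 0, fun x => ?_⟩
  by_cases hx : x ∈ tsupport φ
  · exact (hC x hx).trans (le_max_left _ _)
  · rw [hz x hx, mul_zero, norm_zero]
    exact le_max_right _ _

/-- The weighted Euler derivatives of order `≤ N` of a test function. -/
def weightJet (a : ℝ) (N : ℕ) : 𝓓(puncturedLine, ℂ) →ₗ[ℂ] (Fin (N + 1) → BddFun) where
  toFun φ j := toBdd fun x => (weight a x : ℂ) * euler^[j] φ x
  map_add' φ ψ := by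
    ext j x
    obtain ⟨C, hC⟩ := exists_weight_mul_euler_le a (φ + ψ) j
    obtain ⟨C₁, hC₁⟩ := exists_weight_mul_euler_le a φ j
    obtain ⟨C₂, hC₂⟩ := exists_weight_mul_euler_le a ψ j
    rw [Pi.add_apply, lp.coeFn_add, Pi.add_apply, toBdd_apply hC, toBdd_apply hC₁,
      toBdd_apply hC₂, ← mul_add]
    congr 1
    exact euler_iterate_add isOpen_univ φ.contDiff.contDiffOn ψ.contDiff.contDiffOn j (mem_univ x)
  map_smul' c φ := by
    ext j x
    obtain ⟨C, hC⟩ := exists_weight_mul_euler_le a (c • φ) j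
    obtain ⟨C₁, hC₁⟩ := exists_weight_mul_euler_le a φ j
    rw [Pi.smul_apply, lp.coeFn_smul, Pi.smul_apply, toBdd_apply hC, toBdd_apply hC₁]
    have : euler^[j] (c • φ : 𝓓(puncturedLine, ℂ)) x = c * euler^[j] φ x :=
      congrFun (euler_iterate_const_mul c φ j) x
    rw [this, RingHom.id_apply, smul_eq_mul]
    ring

theorem weightJet_apply (a : ℝ) (N : ℕ) (φ : 𝓓(puncturedLine, ℂ)) (j : Fin (N + 1)) (x : ℝ) :
    weightJet a N φ j x = (weight a x : ℂ) * euler^[j] φ x := by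
  obtain ⟨C, hC⟩ := exists_weight_mul_euler_le a φ j
  exact toBdd_apply hC x

theorem weightJet_injective (a : ℝ) (N : ℕ) : Function.Injective (weightJet a N) := by
  refine (injective_iff_map_eq_zero _).2 fun φ h => ?_
  ext x
  rcases eq_or_ne x 0 with rfl | hx
  · exact testFunction_zero φ
  have h1 := weightJet_apply a N φ 0 x
  rw [h] at h1
  have h2 : (weight a x : ℂ) * φ x = 0 := h1.symm
  rcases mul_eq_zero.1 h2 with h3 | h3
  · exact absurd (Complex.ofReal_eq_zero.1 h3) (weight_pos a hx).ne'
  · exact h3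

theorem WeightBounded.exists_factor {a : ℝ} {L : 𝓓(puncturedLine, ℂ) →ₗ[ℂ] ℂ}
    (hL : WeightBounded a L) :
    ∃ (N : ℕ) (Λ : (Fin (N + 1) → BddFun) →L[ℂ] ℂ), ∀ φ, Λ (weightJet a N φ) = L φ := by
  obtain ⟨N, C, hC, h⟩ := hL
  refine ⟨N, MellinDist.exists_factor L (weightJet a N) (weightJet_injective a N) C fun φ =>
    h φ _ fun l hl x => ?_⟩
  have h1 := (norm_apply_le _ x).trans (norm_le_pi_norm (weightJet a N φ) ⟨l, by omega⟩)
  rw [weightJet_apply, norm_mul, Complex.norm_real, Real.norm_of_nonneg (weight_nonneg a x)] at h1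
  exact h1

variable (δ : ZMod 2)

/-- The weighted kernel `x ↦ weight a x (sg x)^δ |x|^(s-1)`. -/
def weightKernel (a : ℝ) (s : ℂ) : BddFun := toBdd fun x => (weight a x : ℂ) * mellinKernel δ s x

theorem weight_mul_mellinKernel (a : ℝ) (s : ℂ) {x : ℝ} (hx : x ≠ 0) :
    (weight a x : ℂ) * mellinKernel δ s x = ((Real.sign x : ℝ) : ℂ) ^ δ.val *
      Complex.exp (-(a * |Real.log x|) + s * Real.log x) := by
  have h0 : ((|x| : ℝ) : ℂ) = Complex.exp (Real.log x) := by
    rw [← Complex.ofReal_exp, Real.exp_log_eq_abs hx]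
  rw [mellinKernel_of_ne_zero δ s hx, weight, Complex.ofReal_mul, h0, Complex.ofReal_exp,
    Real.log_abs, mul_left_comm, ← Complex.exp_add, ← Complex.exp_add]
  congr 2
  push_cast
  ring

/-- For |re s| < a the margin a - |re s| yields decay in |log x|, at 0 and ∞ alike. At x = 0 the
weight is zero. -/
theorem norm_weight_mul_mellinKernel_le (a : ℝ) (s : ℂ) (x : ℝ) :
    ‖(weight a x : ℂ) * mellinKernel δ s x‖ ≤ Real.exp (-((a - |s.re|) * |Real.log x|)) := by
  rcases eq_or_ne x 0 with rfl | hx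
  · simp [weight]
  rw [weight_mul_mellinKernel δ a s hx, norm_mul, norm_sign_pow δ hx, one_mul, Complex.norm_exp,
    Real.exp_le_exp]
  have h1 : (-(a * |Real.log x| : ℂ) + s * Real.log x).re =
      -(a * |Real.log x|) + s.re * Real.log x := by
    simp [← Complex.ofReal_mul]
  rw [h1]
  have h2 : s.re * Real.log x ≤ |s.re| * |Real.log x| := by
    rw [← abs_mul]
    exact le_abs_self _
  linarith

theorem norm_weight_mul_mellinKernel_le_one {a : ℝ} {s : ℂ} (hs : |s.re| ≤ a) (x : ℝ) :
    ‖(weight a x : ℂ) * mellinKernel δ s x‖ ≤ 1 :=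
  (norm_weight_mul_mellinKernel_le δ a s x).trans (Real.exp_le_one_iff.2
    (neg_nonpos.2 (mul_nonneg (sub_nonneg.2 hs) (abs_nonneg _))))

theorem weightKernel_apply {a : ℝ} {s : ℂ} (hs : |s.re| ≤ a) (x : ℝ) :
    weightKernel δ a s x = (weight a x : ℂ) * mellinKernel δ s x :=
  toBdd_apply (norm_weight_mul_mellinKernel_le_one δ hs) x

theorem norm_weightKernel_le {a : ℝ} {s : ℂ} (hs : |s.re| ≤ a) : ‖weightKernel δ a s‖ ≤ 1 :=
  lp.norm_le_of_forall_le zero_le_one fun x => by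
    rw [weightKernel_apply δ hs]
    exact norm_weight_mul_mellinKernel_le_one δ hs x

theorem sq_mul_exp_neg_le {d : ℝ} (hd : 0 < d) {u : ℝ} (hu : 0 ≤ u) :
    u ^ 2 * Real.exp (-(d * u)) ≤ 2 / d ^ 2 := by
  have h := Real.quadratic_le_exp_of_nonneg (mul_nonneg hd.le hu)
  rw [Real.exp_neg, ← div_eq_mul_inv, div_le_div_iff₀ (Real.exp_pos _) (by positivity)]
  nlinarith [mul_nonneg hd.le hu]

/-- The kernel at z is that at s times exp((z-s) log x). For |z-s| ≤ d/2, half of the decay exp(-d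
|log x|) absorbs the exponential in the Taylor remainder and the other half absorbs |log x|². -/
theorem differentiableAt_weightKernel {a : ℝ} {s : ℂ} (hs : |s.re| < a) :
    DifferentiableAt ℂ (weightKernel δ a) s := by
  set d := a - |s.re| with hd
  have hd0 : 0 < d := sub_pos.2 hs
  have hb' : ∀ x, ‖(Real.log x : ℂ) * ((weight a x : ℂ) * mellinKernel δ s x)‖ ≤ 1 + 2 / d ^ 2 := by
    intro x
    rw [norm_mul, Complex.norm_real, Real.norm_eq_abs]
    have h1 := norm_weight_mul_mellinKernel_le δ a s x
    rw [← hd] at h1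
    have h2 := sq_mul_exp_neg_le hd0 (abs_nonneg (Real.log x))
    have h3 : Real.exp (-(d * |Real.log x|)) ≤ 1 :=
      Real.exp_le_one_iff.2 (neg_nonpos.2 (mul_nonneg hd0.le (abs_nonneg _)))
    have h4 := Real.exp_pos (-(d * |Real.log x|))
    calc _ ≤ |Real.log x| * Real.exp (-(d * |Real.log x|)) := by gcongr
      _ ≤ (1 + |Real.log x| ^ 2) * Real.exp (-(d * |Real.log x|)) := by
        gcongr
        nlinarith [sq_nonneg (|Real.log x| - 1), abs_nonneg (Real.log x)]
      _ ≤ _ := by rw [add_mul, one_mul]; exact add_le_add h3 h2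
  refine (hasDerivAt_bddFun (F' := toBdd fun x => (Real.log x : ℂ) *
    ((weight a x : ℂ) * mellinKernel δ s x)) (C := 2 / (d / 2) ^ 2) (r := d / 2) (by positivity)
    (by positivity) fun z hz x => ?_).differentiableAt
  have hza : |z.re| ≤ a := by
    have h1 := (Complex.abs_re_le_norm (z - s)).trans hz
    rw [Complex.sub_re] at h1
    have h2 := abs_sub_abs_le_abs_sub z.re s.re
    linarith
  rw [toBdd_apply hb', weightKernel_apply δ hza, weightKernel_apply δ hs.le]
  rcases eq_or_ne x 0 with rfl | hx
  · simp only [weight, abs_zero, mul_zero, Complex.ofReal_zero, zero_mul, sub_self, norm_zero]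
    positivity
  set w := (z - s) * Real.log x with hw
  have e1 : (weight a x : ℂ) * mellinKernel δ z x =
      (weight a x : ℂ) * mellinKernel δ s x * Complex.exp w := by
    rw [weight_mul_mellinKernel δ a z hx, weight_mul_mellinKernel δ a s hx, mul_assoc,
      ← Complex.exp_add]
    congr 2
    rw [hw]
    ring
  have e2 : (weight a x : ℂ) * mellinKernel δ z x - (weight a x : ℂ) * mellinKernel δ s x -
      (z - s) * (Real.log x * ((weight a x : ℂ) * mellinKernel δ s x)) =
      (weight a x : ℂ) * mellinKernel δ s x * (Complex.exp w -
        ∑ m ∈ Finset.range 2, w ^ m / (m.factorial : ℂ)) := by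
    rw [e1]
    simp [Finset.sum_range_succ, hw]
    ring
  rw [e2, norm_mul]
  have h1 := norm_weight_mul_mellinKernel_le δ a s x
  rw [← hd] at h1
  have h2 := Complex.norm_exp_sub_sum_le_norm_mul_exp w 2
  have h3 : ‖w‖ = ‖z - s‖ * |Real.log x| := by
    rw [hw, norm_mul, Complex.norm_real, Real.norm_eq_abs]
  have h4 := sq_mul_exp_neg_le (half_pos hd0) (abs_nonneg (Real.log x))
  calc _ ≤ Real.exp (-(d * |Real.log x|)) * (‖w‖ ^ 2 * Real.exp ‖w‖) := by gcongr
    _ ≤ Real.exp (-(d * |Real.log x|)) *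
        ((‖z - s‖ * |Real.log x|) ^ 2 * Real.exp (d / 2 * |Real.log x|)) := by
      rw [h3]
      gcongr
    _ = (|Real.log x| ^ 2 * Real.exp (-(d / 2 * |Real.log x|))) * ‖z - s‖ ^ 2 := by
      have : Real.exp (-(d / 2 * |Real.log x|)) =
          Real.exp (-(d * |Real.log x|)) * Real.exp (d / 2 * |Real.log x|) := by
        rw [← Real.exp_add]
        ring_nf
      rw [this]
      ring
    _ ≤ _ := by gcongr

/-- The weighted Euler derivatives of the Mellin kernel. -/
def kernelJet (a : ℝ) (N : ℕ) (s : ℂ) (j : Fin (N + 1)) : BddFun :=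
  (s - 1) ^ (j : ℕ) • weightKernel δ a s

theorem differentiableAt_kernelJet {a : ℝ} (N : ℕ) {s : ℂ} (hs : |s.re| < a) :
    DifferentiableAt ℂ (kernelJet δ a N) s :=
  differentiableAt_pi.2 fun j => DifferentiableAt.smul
    (c := fun s : ℂ => (s - 1) ^ (j : ℕ)) (by fun_prop) (differentiableAt_weightKernel δ hs)

theorem kernelJet_apply {a : ℝ} (N : ℕ) {s : ℂ} (hs : |s.re| ≤ a) (j : Fin (N + 1)) (x : ℝ) :
    kernelJet δ a N s j x = (s - 1) ^ (j : ℕ) * ((weight a x : ℂ) * mellinKernel δ s x) := by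
  rw [kernelJet, lp.coeFn_smul, Pi.smul_apply, weightKernel_apply δ hs, smul_eq_mul]

/-- The powers (s-1)^j are the only growth in im s; this is the source of moderate growth of the
transform. -/
theorem norm_kernelJet_le {a : ℝ} (N : ℕ) {s : ℂ} (hs : |s.re| ≤ a) :
    ‖kernelJet δ a N s‖ ≤ (a + 2) ^ N * (1 + |s.im|) ^ N := by
  have ha : 0 ≤ a := (abs_nonneg _).trans hs
  refine (pi_norm_le_iff_of_nonneg (by positivity)).2 fun j => ?_
  have h1 : ‖s - 1‖ ≤ a + 1 + |s.im| := by
    have := Complex.norm_le_abs_re_add_abs_im (s - 1)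
    rw [Complex.sub_re, Complex.sub_im, Complex.one_re, Complex.one_im, sub_zero] at this
    have h2 := abs_sub s.re 1
    rw [abs_one] at h2
    linarith
  have h3 : ‖s - 1‖ ≤ (a + 2) * (1 + |s.im|) := by
    nlinarith [abs_nonneg s.im]
  have h4 : 1 ≤ (a + 2) * (1 + |s.im|) := by nlinarith [abs_nonneg s.im]
  rw [kernelJet, norm_smul, norm_pow, ← mul_pow]
  calc _ ≤ ((a + 2) * (1 + |s.im|)) ^ (j : ℕ) * 1 := by
        gcongr
        exact norm_weightKernel_le δ hs
    _ ≤ _ := by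
        rw [mul_one]
        exact pow_le_pow_right₀ h4 (Nat.lt_succ_iff.1 j.2)

end Bounded

/-! ### Convergence of truncated kernels -/

section Limit

theorem exists_exhaust_eq_one {φ : 𝓓((⊤ : Opens ℝ), ℂ)} (h : φ =ᶠ[𝓝 0] 1) :
    ∃ R : ℝ, 0 < R ∧ ∀ (n : ℕ) (x : ℝ), R / (n + 1) < |x| → |x| < (n + 1) / R →
      exhaust φ h n x = 1 := by
  obtain ⟨r, hr, hφ1⟩ := Metric.eventually_nhds_iff.1 h
  obtain ⟨R, hR, hφ0⟩ := exists_tsupport_subset_Icc φ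
  refine ⟨max R r⁻¹, lt_max_of_lt_left hR, fun n x h1 h2 => ?_⟩
  have hn : (0 : ℝ) < n + 1 := by positivity
  have e1 : φ ((n + 1) * x) = 0 := by
    by_contra hne
    have := hφ0 _ hne
    rw [abs_mul, abs_of_pos hn] at this
    rw [div_lt_iff₀ hn] at h1
    have := le_max_left R r⁻¹
    linarith
  have e2 : φ ((n + 1 : ℝ)⁻¹ * x) = 1 := by
    refine hφ1 ?_
    rw [Real.dist_0_eq_abs, abs_mul, abs_of_pos (inv_pos.2 hn), ← div_eq_inv_mul, div_lt_iff₀ hn]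
    have h3 : r⁻¹ ≤ max R r⁻¹ := le_max_right _ _
    have h4 : (n + 1) / max R r⁻¹ ≤ (n + 1) / r⁻¹ := by gcongr
    rw [div_inv_eq_mul, mul_comm] at h4
    linarith
  have e3 := one_sub_exhaust φ h n x
  rw [e1, e2] at e3
  rw [mul_zero, sub_self, mul_zero, add_zero] at e3
  exact (sub_eq_zero.1 e3).symm

/-- Uniformity in n comes from the dilation invariance of θ: each factor of 1 - `exhaust` is φ or 1
- φ, possibly dilated. -/
theorem exists_bound_one_sub_exhaust {φ : 𝓓((⊤ : Opens ℝ), ℂ)} (h : φ =ᶠ[𝓝 0] 1) (N : ℕ) :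
    ∃ B : ℝ, 0 ≤ B ∧ ∀ (n : ℕ), ∀ j ≤ N, ∀ x,
      ‖euler^[j] (fun y => 1 - exhaust φ h n y) x‖ ≤ B := by
  have s1 : ContDiff ℝ ∞ (fun _ : ℝ => (1 : ℂ)) := contDiff_const
  have sφ : ContDiff ℝ ∞ φ := φ.contDiff
  have sη : ContDiff ℝ ∞ (fun x => 1 - φ x) := s1.sub sφ
  obtain ⟨B, hB, hφ⟩ := eulerBounded_testFunction φ N
  obtain ⟨D, hD, hη⟩ := (eulerBounded_const 1).sub s1 sφ (eulerBounded_testFunction φ) N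
  refine ⟨2 ^ N * B * B + 2 ^ N * D * D, by positivity, fun n j hj x => ?_⟩
  have sc : ∀ c : ℝ, ContDiff ℝ ∞ (fun x : ℝ => c * x) := fun c => contDiff_const.mul contDiff_id
  have s2 : ContDiff ℝ ∞ (fun x => φ ((n + 1) * x)) := sφ.comp (sc _)
  have s3 : ContDiff ℝ ∞ (fun x => 1 - φ ((n + 1 : ℝ)⁻¹ * x)) := sη.comp (sc _)
  simp only [one_sub_exhaust]
  rw [euler_iterate_add isOpen_univ (sφ.mul s2).contDiffOn (sη.mul s3).contDiffOn j (mem_univ x)]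
  refine (norm_add_le _ _).trans (add_le_add ?_ ?_)
  · refine (norm_euler_iterate_mul_le isOpen_univ sφ.contDiffOn s2.contDiffOn (mem_univ x) j
      (fun i hi => hφ i (hi.trans hj) x) (B := B) fun i hi => ?_).trans (by
        gcongr
        exact one_le_two)
    rw [euler_iterate_comp_mul]
    exact hφ i (hi.trans hj) _
  · refine (norm_euler_iterate_mul_le isOpen_univ sη.contDiffOn s3.contDiffOn (mem_univ x) j
      (fun i hi => hη i (hi.trans hj) x) (B := D) fun i hi => ?_).trans (by
        gcongr
        exact one_le_two)
    rw [euler_iterate_comp_mul (fun x => 1 - φ x)]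
    exact hη i (hi.trans hj) _

variable (δ : ZMod 2)

/-- The error is supported where |log x| ≥ log((n+1)/R). There the margin d = a - |re s| makes the
weighted kernel at most exp(-d log((n+1)/R)), and the cutoff costs only a constant. -/
theorem tendsto_weightJet_exhaust {a : ℝ} (N : ℕ) {s : ℂ} (hs : |s.re| < a)
    {φ : 𝓓((⊤ : Opens ℝ), ℂ)} (h : φ =ᶠ[𝓝 0] 1) :
    Tendsto (fun n => weightJet a N (mulTest (mellinKernel δ s) (contDiffOn_mellinKernel δ s)
      (exhaust φ h n))) atTop (𝓝 (kernelJet δ a N s)) := by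
  set d := a - |s.re| with hd
  have hd0 : 0 < d := sub_pos.2 hs
  obtain ⟨R, hR, hone⟩ := exists_exhaust_eq_one h
  obtain ⟨B, hB, hbd⟩ := exists_bound_one_sub_exhaust h N
  set A := max 1 ‖s - 1‖ with hA
  have hA1 : 1 ≤ A := le_max_left _ _
  set K := 2 ^ N * A ^ N * B with hK
  have hK0 : 0 ≤ K := by positivity
  have hopen : IsOpen ({0}ᶜ : Set ℝ) := isOpen_compl_singleton
  have hKs : ContDiffOn ℝ ∞ (mellinKernel δ s) {0}ᶜ := contDiffOn_mellinKernel δ s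
  have hdiff : ∀ (n : ℕ), ‖weightJet a N (mulTest (mellinKernel δ s) (contDiffOn_mellinKernel δ s)
      (exhaust φ h n)) - kernelJet δ a N s‖ ≤ K * Real.exp (-(d * Real.log ((n + 1) / R))) := by
    intro n
    have hnn : 0 ≤ K * Real.exp (-(d * Real.log ((n + 1) / R))) :=
      mul_nonneg hK0 (Real.exp_pos _).le
    refine (pi_norm_le_iff_of_nonneg hnn).2 fun j => lp.norm_le_of_forall_le hnn fun x => ?_
    rw [Pi.sub_apply, lp.coeFn_sub, Pi.sub_apply, weightJet_apply, kernelJet_apply δ N hs.le]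
    rcases eq_or_ne x 0 with rfl | hx
    · simpa [weight] using hnn
    have hs2 : ContDiffOn ℝ ∞ (fun y => 1 - exhaust φ h n y) {0}ᶜ :=
      contDiffOn_const.sub (exhaust φ h n).contDiff.contDiffOn
    have e1 : euler^[j] (mulTest (mellinKernel δ s) (contDiffOn_mellinKernel δ s)
        (exhaust φ h n)) x + euler^[j] (fun y => mellinKernel δ s y * (1 - exhaust φ h n y)) x =
        (s - 1) ^ (j : ℕ) * mellinKernel δ s x := by
      refine Eq.trans ?_ (euler_iterate_mellinKernel δ s j hx)
      have := euler_iterate_add hopen (mulTest (mellinKernel δ s) (contDiffOn_mellinKernel δ s)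
        (exhaust φ h n)).contDiff.contDiffOn (hKs.mul hs2) j hx
      refine this.symm.trans ?_
      refine congrFun (congrArg (euler^[j]) (funext fun y => ?_)) x
      rw [mulTest_apply]
      ring
    have e2 : (weight a x : ℂ) * euler^[j] (mulTest (mellinKernel δ s)
        (contDiffOn_mellinKernel δ s) (exhaust φ h n)) x -
        (s - 1) ^ (j : ℕ) * ((weight a x : ℂ) * mellinKernel δ s x) =
        -((weight a x : ℂ) * euler^[j] (fun y => mellinKernel δ s y * (1 - exhaust φ h n y)) x) := by
      rw [eq_sub_of_add_eq e1]
      ring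
    rw [e2, norm_neg]
    have hjN : (j : ℕ) ≤ N := Nat.lt_succ_iff.1 j.2
    have hn : (0 : ℝ) < n + 1 := by positivity
    by_cases hmid : R / (n + 1) < |x| ∧ |x| < (n + 1) / R
    · have hz : (fun y => mellinKernel δ s y * (1 - exhaust φ h n y)) =ᶠ[𝓝 x] 0 := by
        filter_upwards [(isOpen_lt continuous_const continuous_abs).mem_nhds hmid.1,
          (isOpen_lt continuous_abs continuous_const).mem_nhds hmid.2] with y h1 h2
        rw [hone n y h1 h2, sub_self, mul_zero, Pi.zero_apply]
      rw [euler_iterate_eq_zero hz, mul_zero, norm_zero]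
      exact hnn
    have hlog : Real.log ((n + 1) / R) ≤ |Real.log x| := by
      rw [not_and_or, not_lt, not_lt] at hmid
      rw [← Real.log_abs x]
      have hx0 := abs_pos.2 hx
      rcases hmid with h1 | h1
      · have := Real.log_le_log hx0 h1
        rw [← inv_div, Real.log_inv] at this
        exact (le_neg_of_le_neg this).trans (neg_le_abs _)
      · exact (Real.log_le_log (by positivity) h1).trans (le_abs_self _)
    have h1 := norm_euler_iterate_mul_le hopen hKs hs2 hx (A := A ^ N * ‖mellinKernel δ s x‖)
      (B := B) j (fun i hi => by
        rw [euler_iterate_mellinKernel δ s i hx, norm_mul, norm_pow]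
        gcongr
        exact (pow_le_pow_left₀ (norm_nonneg _) (le_max_right _ _) i).trans
          (pow_le_pow_right₀ hA1 (hi.trans hjN)))
      (fun i hi => hbd n i (hi.trans hjN) x)
    have h2 := norm_weight_mul_mellinKernel_le δ a s x
    rw [← hd, norm_mul] at h2
    rw [norm_mul]
    calc _ ≤ ‖(weight a x : ℂ)‖ * (2 ^ (j : ℕ) * (A ^ N * ‖mellinKernel δ s x‖) * B) := by gcongr
      _ ≤ ‖(weight a x : ℂ)‖ * (2 ^ N * (A ^ N * ‖mellinKernel δ s x‖) * B) := by
        gcongr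
        exact one_le_two
      _ = K * (‖(weight a x : ℂ)‖ * ‖mellinKernel δ s x‖) := by rw [hK]; ring
      _ ≤ K * Real.exp (-(d * |Real.log x|)) := by gcongr
      _ ≤ _ := by gcongr
  refine tendsto_iff_norm_sub_tendsto_zero.2 (squeeze_zero (fun n => norm_nonneg _) hdiff ?_)
  have l1 : Tendsto (fun n : ℕ => ((n : ℝ) + 1) / R) atTop atTop :=
    (tendsto_atTop_add_const_right _ 1 tendsto_natCast_atTop_atTop).atTop_div_const hR
  have l2 := Real.tendsto_exp_neg_atTop_nhds_zero.comp
    ((Real.tendsto_log_atTop.comp l1).const_mul_atTop hd0)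
  simpa using l2.const_mul K

end Limit

/-! ### Mellin inversion as a Bochner integral of jets -/

section Inversion

variable (δ : ZMod 2)

/-- The dilate `x ↦ φ(c x)` of a test function on `ℝ ∖ {0}`. -/
def dilate (φ : 𝓓(puncturedLine, ℂ)) (c : ℝ) (hc : c ≠ 0) : 𝓓(puncturedLine, ℂ) :=
  puncTest (scaleTest (incl φ) c hc) (by
    have h1 : Tendsto (fun x : ℝ => c * x) (𝓝 0) (𝓝 0) := by
      simpa using (continuous_const_mul c).tendsto 0
    filter_upwards [h1.eventually (testFunction_eventuallyEq_zero φ)] with x hx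
    rw [scaleTest_apply, incl_apply, hx]
    rfl)

theorem dilate_apply (φ : 𝓓(puncturedLine, ℂ)) (c : ℝ) (hc : c ≠ 0) (x : ℝ) :
    dilate φ c hc x = φ (c * x) :=
  incl_apply φ (c * x)

theorem one_mem_entireModerate : (fun _ => 1) ∈ entireModerate :=
  ⟨differentiable_const 1, moderateGrowth_of_bound fun _ _ =>
    ⟨1, 0, zero_le_one, fun _ _ _ => by simp⟩⟩

theorem mellinConvergent_symm {f : ℝ → ℂ} {s : ℂ}
    (hf : Integrable fun x => f x * mellinKernel δ (1 - s) x) :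
    MellinConvergent (symm δ f) (1 - s) := by
  refine (hf.comp_neg.add hf).integrableOn.congr_fun (fun x hx => ?_) measurableSet_Ioi
  simp only [Pi.add_apply]
  rw [mellinKernel_neg, mellinKernel_of_pos δ _ hx, symm, smul_eq_mul]
  ring

theorem symm_neg (f : ℝ → ℂ) (x : ℝ) : symm δ f (-x) = (-1) ^ δ.val * symm δ f x := by
  have : ((-1 : ℂ) ^ δ.val) * (-1) ^ δ.val = 1 := by rw [← mul_pow]; simp
  rw [symm, symm, neg_neg, mul_add, ← mul_assoc, this]
  ring

/-- For x > 0 this is Mellin inversion on re = 1 - c for the folded function, with t reversed;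
negative x follows by parity. -/
theorem symm_eq_integral (f : 𝓢(ℝ, ℂ)) {c : ℝ} (hc : c < 0) {x : ℝ} (hx : x ≠ 0) :
    symm δ f x = (2 * Real.pi : ℂ)⁻¹ * ∫ t : ℝ, pairing δ f (c + t * Complex.I) *
      mellinKernel δ (c + t * Complex.I) x := by
  wlog hx0 : 0 < x generalizing x
  · have h1 : 0 < -x := neg_pos.2 (lt_of_le_of_ne (not_lt.1 hx0) hx)
    have h2 := this h1.ne' h1
    rw [symm_neg] at h2
    simp only [mellinKernel_neg, mul_left_comm _ ((-1 : ℂ) ^ δ.val)] at h2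
    rw [integral_const_mul, mul_left_comm] at h2
    exact mul_left_cancel₀ (pow_ne_zero _ (neg_ne_zero.2 one_ne_zero)) h2
  have hInt := fun t : ℝ => integrable_mul_mellinKernel δ f (s := c - t * Complex.I) (by simpa using hc)
  have hp : ∀ t : ℝ, mellin (symm δ f) ((1 - c : ℝ) + t * Complex.I) =
      pairing δ f (c - t * Complex.I) := fun t => by
    rw [pairing_eq_mellin δ (hInt t)]
    congr 1
    push_cast
    ring
  have hmc : MellinConvergent (symm δ f) ((1 - c : ℝ) : ℂ) := by
    have := mellinConvergent_symm δ (integrable_mul_mellinKernel δ f (s := c) (by simpa using hc))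
    simpa using this
  have hvi : Complex.VerticalIntegrable (mellin (symm δ f)) (1 - c) volume := by
    have h1 := (stripDecay_schwartz δ one_mem_entireModerate f (a := c) hc).integrable
      le_rfl le_rfl
    simp only [one_mul] at h1
    refine h1.comp_neg.congr (Eventually.of_forall fun t => ?_)
    simp only [hp]
    congr 1
    push_cast
    ring
  have hcont : Continuous (symm δ f) :=
    f.continuous.add (continuous_const.mul (f.continuous.comp continuous_neg))
  have key := mellinInv_mellin_eq (1 - c) (symm δ f) hx0 hmc hvi hcont.continuousAt
  rw [← key, mellinInv, ← integral_neg_eq_self, Complex.real_smul]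
  congr 1
  · push_cast
    rw [one_div]
  · refine integral_congr_ae (Eventually.of_forall fun t => ?_)
    simp only
    rw [hp, mellinKernel_of_pos δ _ hx0, smul_eq_mul, mul_comm]
    congr 2 <;> · push_cast; ring

theorem symm_euler_iterate {f : ℝ → ℂ} (hf : ContDiff ℝ ∞ f) (j : ℕ) :
    euler^[j] (symm δ f) = symm δ (euler^[j] f) := by
  ext x
  have e : symm δ f = fun x => f x + (-1) ^ δ.val * f (-1 * x) := by
    ext x
    rw [symm, neg_one_mul]
  have h1 : ContDiff ℝ ∞ fun x => f (-1 * x) := hf.comp (contDiff_const.mul contDiff_id)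
  rw [e, euler_iterate_add isOpen_univ hf.contDiffOn (contDiff_const.mul h1).contDiffOn j
    (mem_univ x), euler_iterate_const_mul, euler_iterate_comp_mul, symm]
  simp only [neg_one_mul]

/-- The even or odd part of a test function, doubled. -/
def symTest (φ : 𝓓(puncturedLine, ℂ)) : 𝓓(puncturedLine, ℂ) :=
  φ + ((-1) ^ δ.val : ℂ) • dilate φ (-1) (neg_ne_zero.2 one_ne_zero)

theorem coe_symTest (φ : 𝓓(puncturedLine, ℂ)) : ⇑(symTest δ φ) = symm δ φ := by
  ext x
  have : symTest δ φ x = φ x + (-1) ^ δ.val * dilate φ (-1) (neg_ne_zero.2 one_ne_zero) x := rfl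
  rw [this, dilate_apply, neg_one_mul, symm]

theorem integrable_pairing_smul_kernelJet {a c : ℝ} (hc : |c| < a) (N : ℕ)
    (φ : 𝓓(puncturedLine, ℂ)) : Integrable fun t : ℝ =>
      pairing δ φ (c + t * Complex.I) • kernelJet δ a N (c + t * Complex.I) := by
  obtain ⟨C, hC, h⟩ := exists_norm_pairing_testFunction_le δ φ c c (N + 2)
  have hcont : Continuous fun t : ℝ =>
      pairing δ φ (c + t * Complex.I) • kernelJet δ a N (c + t * Complex.I) := by
    refine Continuous.smul ((differentiable_pairing δ φ).continuous.comp (by fun_prop)) ?_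
    refine continuous_iff_continuousAt.2 fun t => ?_
    exact ContinuousAt.comp (g := kernelJet δ a N)
      (differentiableAt_kernelJet δ N (by simpa using hc)).continuousAt (by fun_prop)
  -- The space of bounded functions is not separable; strong measurability of the continuous
  -- integrand comes from the line being second countable.
  have : SecondCountableTopologyEither ℝ (Fin (N + 1) → BddFun) := ⟨Or.inl inferInstance⟩
  refine (integrable_inv_one_add_abs_sq.const_mul (C * (a + 2) ^ N)).mono'
    hcont.aestronglyMeasurable (Eventually.of_forall fun t => ?_)
  have h1 := h (c + t * Complex.I) (by simp) (by simp)
  have h2 := norm_kernelJet_le δ N (s := c + t * Complex.I) (a := a) (by simpa using hc.le)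
  rw [im_add_mul_I] at h1 h2
  have hp : 0 < 1 + |t| := by positivity
  have ha : 0 ≤ a := (abs_nonneg c).trans hc.le
  rw [norm_smul]
  calc _ ≤ C * ((1 + |t|) ^ (N + 2))⁻¹ * ((a + 2) ^ N * (1 + |t|) ^ N) := by gcongr
    _ = _ := by
      rw [pow_add]
      field_simp

/-- Evaluation at a component j and a point x is continuous, hence commutes with the Bochner
integral, and there the identity is Mellin inversion for θ^j φ. The vector-valued form allows an
arbitrary functional Λ to be applied under the integral. -/
theorem weightJet_symTest {a c : ℝ} (hc : |c| < a) (hc0 : c < 0) (N : ℕ)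
    (φ : 𝓓(puncturedLine, ℂ)) : weightJet a N (symTest δ φ) =
      (2 * Real.pi : ℂ)⁻¹ • ∫ t : ℝ,
        pairing δ φ (c + t * Complex.I) • kernelJet δ a N (c + t * Complex.I) := by
  ext j x
  have hInt := integrable_pairing_smul_kernelJet δ hc N φ
  let ev : (Fin (N + 1) → BddFun) →L[ℂ] ℂ :=
    lp.evalCLM ℂ (fun _ : ℝ => ℂ) ⊤ x ∘L ContinuousLinearMap.proj j
  have e1 := ev.integral_comp_comm hInt
  have e2 : ∀ F : Fin (N + 1) → BddFun, ev F = F j x := fun F => rfl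
  have e3 : ∀ t : ℝ, ev (pairing δ φ (c + t * Complex.I) • kernelJet δ a N (c + t * Complex.I)) =
      (weight a x : ℂ) * (pairing δ (euler^[j] φ) (c + t * Complex.I) *
        mellinKernel δ (c + t * Complex.I) x) := fun t => by
    have h1 := pairing_euler_iterate δ (toSchwartz (incl φ)) (s := c + t * Complex.I)
      (by simpa using hc0) j
    rw [coe_toSchwartz_incl] at h1
    rw [map_smul, e2, kernelJet_apply δ N (by simpa using hc.le), h1, smul_eq_mul]
    ring
  rw [Pi.smul_apply, lp.coeFn_smul, Pi.smul_apply, ← e2 (∫ t : ℝ, _), ← e1, weightJet_apply,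
    integral_congr_ae (Eventually.of_forall e3), integral_const_mul, smul_eq_mul, mul_left_comm,
    coe_symTest, symm_euler_iterate δ φ.contDiff]
  rcases eq_or_ne x 0 with rfl | hx
  · simp [weight]
  have h2 := symm_eq_integral δ ((eulerCLM)^[j] (toSchwartz (incl φ))) hc0 hx
  rw [coe_eulerCLM_iterate, coe_toSchwartz_incl] at h2
  rw [h2]

end Inversion

/-! ### The transform and its characterization -/

section Transform

variable (δ : ZMod 2)

/-- Evaluate the Hahn–Banach extension on the kernel jet. Extensions chosen for different a agree on
common strips because their values are limits of L on the same truncated kernels. -/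
theorem exists_transform {L : 𝓓(puncturedLine, ℂ) →ₗ[ℂ] ℂ} (hL : ∀ a, WeightBounded a L)
    (hp : ∀ φ, L (dilate φ (-1) (neg_ne_zero.2 one_ne_zero)) = (-1) ^ δ.val * L φ) :
    ∃ H ∈ entireModerate,
      (∀ (φ : 𝓓((⊤ : Opens ℝ), ℂ)) (h : φ =ᶠ[𝓝 0] 1) (s : ℂ), Tendsto (fun n =>
        L (mulTest (mellinKernel δ s) (contDiffOn_mellinKernel δ s) (exhaust φ h n))) atTop
          (𝓝 (H s))) ∧
      ∀ φ : 𝓓(puncturedLine, ℂ), L φ = lineInt δ H (-1 / 2 : ℝ) φ := by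
  choose N Λ hΛ using fun a => (hL a).exists_factor
  set G : ℝ → ℂ → ℂ := fun a s => Λ a (kernelJet δ a (N a) s) with hG
  have lim : ∀ (a : ℝ) (s : ℂ), |s.re| < a → ∀ (φ : 𝓓((⊤ : Opens ℝ), ℂ)) (h : φ =ᶠ[𝓝 0] 1),
      Tendsto (fun n => L (mulTest (mellinKernel δ s) (contDiffOn_mellinKernel δ s)
        (exhaust φ h n))) atTop (𝓝 (G a s)) := fun a s hs φ h => by
    have := ((Λ a).continuous.tendsto _).comp (tendsto_weightJet_exhaust δ (N a) hs h)
    simpa only [Function.comp_def, hΛ] using this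
  obtain ⟨β, hβ1, -⟩ := exists_cutoff
  have hβ : β =ᶠ[𝓝 0] 1 := by
    filter_upwards [Metric.closedBall_mem_nhds (0 : ℝ) one_pos] with x hx
    exact hβ1 x (by simpa using hx)
  -- Any a > |re s| gives the same value; |re s| + 1 is one choice, replaced by a locally constant a
  -- to prove holomorphy.
  set H : ℂ → ℂ := fun s => G (|s.re| + 1) s with hH
  have heq : ∀ (a : ℝ) (s : ℂ), |s.re| < a → H s = G a s := fun a s hs =>
    tendsto_nhds_unique (lim _ s (lt_add_one _) β hβ) (lim a s hs β hβ)
  refine ⟨H, ⟨fun s => ?_, moderateGrowth_of_bound fun a b => ?_⟩,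
    fun φ h s => lim _ s (lt_add_one _) φ h, fun φ => ?_⟩
  · have h1 : H =ᶠ[𝓝 s] G (|s.re| + 1) := by
      filter_upwards [(isOpen_lt (continuous_abs.comp Complex.continuous_re)
        continuous_const).mem_nhds (lt_add_one |s.re|)] with z hz
      exact heq _ z hz
    refine DifferentiableAt.congr_of_eventuallyEq ?_ h1
    exact (Λ _).differentiableAt.comp s (differentiableAt_kernelJet δ _ (lt_add_one _))
  · set A := max |a| |b| + 1 with hA
    refine ⟨‖Λ A‖ * (A + 2) ^ N A, N A, by positivity, fun s h1 h2 => ?_⟩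
    have hs : |s.re| < A := (abs_le_max_abs_abs h1 h2).trans_lt (lt_add_one _)
    rw [heq A s hs, mul_assoc]
    exact ((Λ A).le_opNorm _).trans (by
      gcongr
      exact norm_kernelJet_le δ (N A) hs.le)
  · set c : ℝ := -1 / 2 with hc
    have hc0 : c < 0 := by norm_num [hc]
    have hc1 : |c| < 1 := by norm_num [hc, abs_lt]
    have e1 : L (symTest δ φ) = 2 * L φ := by
      have : ((-1 : ℂ) ^ δ.val) * (-1) ^ δ.val = 1 := by rw [← mul_pow]; simp
      rw [symTest, map_add, map_smul, hp, smul_eq_mul, ← mul_assoc, this]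
      ring
    have e2 := hΛ 1 (symTest δ φ)
    rw [weightJet_symTest δ hc1 hc0, map_smul,
      ← (Λ 1).integral_comp_comm (integrable_pairing_smul_kernelJet δ hc1 _ φ), e1,
      smul_eq_mul] at e2
    have e3 : ∀ t : ℝ, Λ 1 (pairing δ φ (c + t * Complex.I) •
        kernelJet δ 1 (N 1) (c + t * Complex.I)) =
        H (c + t * Complex.I) * pairing δ φ (c + t * Complex.I) := fun t => by
      rw [map_smul, smul_eq_mul, heq 1 (c + t * Complex.I) (by simpa using hc1), mul_comm]
    rw [integral_congr_ae (Eventually.of_forall e3)] at e2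
    have e4 : L φ = 2⁻¹ * (2 * L φ) := by ring
    rw [e4, ← e2, lineInt, ← mul_assoc]
    congr 1
    rw [← mul_inv]
    congr 1
    ring

theorem exists_mellin_of_mem {σ : 𝓢'(ℝ, ℂ)} (hσ : σ ∈ mellinSource δ) :
    ∃ H ∈ entireModerate,
      (∀ (φ : 𝓓((⊤ : Opens ℝ), ℂ)) (h : φ =ᶠ[𝓝 0] 1) (s : ℂ), Tendsto (fun n => ofTempered σ
        (incl (mulTest (mellinKernel δ s) (contDiffOn_mellinKernel δ s) (exhaust φ h n)))) atTop
          (𝓝 (H s))) ∧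
      ∀ φ : 𝓓(puncturedLine, ℂ), ofTempered σ (incl φ) = lineInt δ H (-1 / 2 : ℝ) φ := by
  refine exists_transform δ (L := ((ofTempered σ) ∘L incl : 𝓓(puncturedLine, ℂ) →L[ℂ] ℂ))
    (fun a => weightBounded_of_mem_mellinSource hσ a) fun φ => ?_
  have h1 := hσ.1 (toSchwartz (incl φ))
  change σ (toSchwartz (incl _)) = _ * σ (toSchwartz (incl φ))
  rw [← h1]
  congr 1
  ext x
  rw [SchwartzMap.compCLMOfContinuousLinearEquiv_apply, Function.comp_apply, coe_toSchwartz_incl,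
    coe_toSchwartz_incl, dilate_apply, ContinuousLinearEquiv.neg_apply, neg_one_mul]

/-- Any admissible density has integral equal to the limit over truncations, so its value is forced.
For existence the explicit density built from H is used; its integral need not be computed, since
uniqueness already identifies it. -/
theorem hasSignedMellinAt_iff {σ : 𝓢'(ℝ, ℂ)} {H : ℂ → ℂ} (hH : H ∈ entireModerate)
    (hlim : ∀ (φ : 𝓓((⊤ : Opens ℝ), ℂ)) (h : φ =ᶠ[𝓝 0] 1) (s : ℂ), Tendsto (fun n => ofTempered σ
      (incl (mulTest (mellinKernel δ s) (contDiffOn_mellinKernel δ s) (exhaust φ h n)))) atTop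
        (𝓝 (H s)))
    (hline : ∀ φ : 𝓓(puncturedLine, ℂ), ofTempered σ (incl φ) = lineInt δ H (-1 / 2 : ℝ) φ)
    (s z : ℂ) : HasSignedMellinAt δ σ s z ↔ z = H s := by
  have huniq : ∀ z, HasSignedMellinAt δ σ s z → z = H s := by
    rintro z ⟨μ, hμ, h1, h2, φ, χ, hpart, rfl⟩
    have l1 := ProjDensity.tendsto_exhaust (h1 1) (h2 1) hpart
    simp only [hμ] at l1
    exact tendsto_nhds_unique l1 (hlim φ _ s)
  refine ⟨huniq z, ?_⟩
  rintro rfl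
  obtain ⟨μ, hμ, h1, h2⟩ := exists_projDensity δ hH s
  obtain ⟨φ, χ, hpart⟩ := exists_partition
  have h3 : HasSignedMellinAt δ σ s (μ.fin φ + μ.inf χ) :=
    ⟨μ, fun ψ => by rw [hμ, ofTempered_inverseMellin_incl δ hH _ (-1 / 2 : ℝ), hline], h1, h2,
      φ, χ, hpart, rfl⟩
  rwa [← huniq _ h3]

end Transform

/-! ### Determination of σ and of H -/

section Uniqueness

/-- The cutoff tail vanishes for |x| < n + 1; beyond that, one spare power of |x| in the Schwartz
decay gives 1/(n+1). -/
theorem exists_schwartz_tail_bound (β : 𝓓((⊤ : Opens ℝ), ℂ)) (hβ : ∀ x, |x| ≤ 1 → β x = 1)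
    (f : 𝓢(ℝ, ℂ)) (p q : ℕ) : ∃ C : ℝ, 0 ≤ C ∧ ∀ (n : ℕ) (x : ℝ),
      |x| ^ p * ‖iteratedDeriv q (fun y => (1 - β ((n + 1 : ℝ)⁻¹ * y)) * f y) x‖ ≤
        C / (n + 1) := by
  have s1 : ContDiff ℝ ∞ (fun _ : ℝ => (1 : ℂ)) := contDiff_const
  have sη : ContDiff ℝ ∞ (fun x => 1 - β x) := s1.sub β.contDiff
  obtain ⟨D, hD, hη⟩ := (eulerBounded_const 1).sub s1 β.contDiff (eulerBounded_testFunction β) q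
  have hf : ∀ i : ℕ, ∃ A : ℝ, 0 ≤ A ∧ ∀ x, |x| ^ (p + 1) * ‖euler^[i] f x‖ ≤ A := fun i => by
    have h := SchwartzMap.le_seminorm ℂ (p + 1) 0 ((eulerCLM)^[i] f)
    refine ⟨SchwartzMap.seminorm ℂ (p + 1) 0 ((eulerCLM)^[i] f), apply_nonneg _ _, fun x => ?_⟩
    have := h x
    rwa [norm_iteratedFDeriv_zero, coe_eulerCLM_iterate, Real.norm_eq_abs] at this
  choose A hA0 hA using hf
  set S := ∑ i ∈ Finset.range (q + 1), A i with hS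
  have hS0 : 0 ≤ S := Finset.sum_nonneg fun i _ => hA0 i
  refine ⟨q.factorial * (2 ^ q * D * S), by positivity, fun n x => ?_⟩
  have hn : (0 : ℝ) < n + 1 := by positivity
  have hn1 : (1 : ℝ) ≤ n + 1 := by linarith [n.cast_nonneg (α := ℝ)]
  have s2 : ContDiff ℝ ∞ (fun x : ℝ => 1 - β ((n + 1 : ℝ)⁻¹ * x)) :=
    sη.comp (contDiff_const.mul contDiff_id)
  rcases lt_or_ge |x| (n + 1) with hx | hx
  · have hz : (fun y => (1 - β ((n + 1 : ℝ)⁻¹ * y)) * f y) =ᶠ[𝓝 x] 0 := by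
      filter_upwards [(isOpen_lt continuous_abs continuous_const).mem_nhds hx] with y hy
      rw [hβ, sub_self, zero_mul, Pi.zero_apply]
      rw [abs_mul, abs_of_pos (inv_pos.2 hn), ← div_eq_inv_mul, div_le_one hn]
      exact le_of_lt hy
    rw [hz.iteratedDeriv_eq]
    have : iteratedDeriv q (0 : ℝ → ℂ) x = 0 := by simp
    rw [this, norm_zero, mul_zero]
    positivity
  have hx1 : 1 ≤ |x| := hn1.trans hx
  have hx0 : 0 < |x| := by linarith
  have h1 := norm_pow_mul_iteratedDeriv_le isOpen_univ (s2.mul (f.smooth ⊤)).contDiffOn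
    (mem_univ x) (A := 2 ^ q * D * (S / |x| ^ (p + 1))) q fun i hi => by
      refine (norm_euler_iterate_mul_le isOpen_univ s2.contDiffOn (f.smooth ⊤).contDiffOn
        (mem_univ x) (A := D) (B := S / |x| ^ (p + 1)) i (fun l hl => ?_) fun l hl => ?_).trans (by
          gcongr
          exact one_le_two)
      · rw [euler_iterate_comp_mul (fun x => 1 - β x)]
        exact hη l (hl.trans hi) _
      · rw [le_div_iff₀' (by positivity)]
        exact (hA l x).trans (Finset.single_le_sum (f := A) (fun i _ => hA0 i)
          (Finset.mem_range.2 (by omega)))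
  have h2 : (1 : ℝ) ≤ |x| ^ q := one_le_pow₀ hx1
  have h3 := norm_nonneg (iteratedDeriv q (fun y => (1 - β ((n + 1 : ℝ)⁻¹ * y)) * f y) x)
  calc _ ≤ |x| ^ p * (|x| ^ q *
        ‖iteratedDeriv q (fun y => (1 - β ((n + 1 : ℝ)⁻¹ * y)) * f y) x‖) := by
        gcongr
        exact le_mul_of_one_le_left h3 h2
    _ ≤ |x| ^ p * (q.factorial * (2 ^ q * D * (S / |x| ^ (p + 1)))) := by gcongr
    _ = q.factorial * (2 ^ q * D * S) / |x| := by
        rw [pow_succ]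
        field_simp
    _ ≤ _ := by gcongr

/-- A tempered distribution is determined by its values on test functions. -/
theorem eq_zero_of_ofTempered {σ : 𝓢'(ℝ, ℂ)} (h : ∀ φ, ofTempered σ φ = 0) (f : 𝓢(ℝ, ℂ)) :
    σ f = 0 := by
  obtain ⟨β, hβ, -⟩ := exists_cutoff
  obtain ⟨s, C, hC, hσ⟩ := exists_seminorm_bound σ
  choose D hD0 hD using fun p : ℕ × ℕ => exists_schwartz_tail_bound β hβ f p.1 p.2
  set S := ∑ p ∈ s, D p with hS
  have hS0 : 0 ≤ S := Finset.sum_nonneg fun p _ => hD0 p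
  have key : ∀ n : ℕ, ‖σ f‖ ≤ C * (S / (n + 1)) := fun n => by
    set g : 𝓢(ℝ, ℂ) := f - toSchwartz (mulTest f (f.smooth ⊤).contDiffOn
      (scaleTest β (n + 1 : ℝ)⁻¹ (by positivity))) with hg
    have e1 : σ g = σ f := by
      rw [hg, map_sub]
      have := h (mulTest f (f.smooth ⊤).contDiffOn (scaleTest β (n + 1 : ℝ)⁻¹ (by positivity)))
      rw [show σ (toSchwartz _) = 0 from this, sub_zero]
    have e2 : ⇑g = fun y => (1 - β ((n + 1 : ℝ)⁻¹ * y)) * f y := by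
      ext y
      have : g y = f y - f y * β ((n + 1 : ℝ)⁻¹ * y) := rfl
      rw [this]
      ring
    rw [← e1]
    refine (hσ g).trans ?_
    gcongr
    refine Seminorm.finset_sup_apply_le (by positivity) fun p hp => ?_
    refine SchwartzMap.seminorm_le_bound' ℂ p.1 p.2 g (by positivity) fun x => ?_
    rw [e2]
    refine (hD p n x).trans ?_
    gcongr
    exact Finset.single_le_sum (f := D) (fun p _ => hD0 p) hp
  have lim : Tendsto (fun n : ℕ => C * (S / ((n : ℝ) + 1))) atTop (𝓝 (C * 0)) :=
    (tendsto_const_nhds.div_atTop (tendsto_atTop_add_const_right _ 1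
      tendsto_natCast_atTop_atTop)).const_mul C
  rw [mul_zero] at lim
  exact norm_le_zero_iff.1 (ge_of_tendsto' lim key)

variable (δ : ZMod 2)

/-- Homogeneity of the kernel. Along a vertical line dilation by e^u becomes multiplication by a
constant times e^(iut), so dilates of one φ supply all characters. -/
theorem pairing_dilate (φ : 𝓓(puncturedLine, ℂ)) (u : ℝ) (s : ℂ) :
    pairing δ (dilate φ (Real.exp u) (Real.exp_pos u).ne') s =
      Complex.exp (u * (s - 1)) * pairing δ φ s := by
  have h1 := Measure.integral_comp_mul_left
    (fun y => φ y * mellinKernel δ (1 - s) (Real.exp (-u) * y)) (Real.exp u)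
  have e1 : ∀ x : ℝ, Real.exp (-u) * (Real.exp u * x) = x := fun x => by
    rw [← mul_assoc, ← Real.exp_add, neg_add_cancel, Real.exp_zero, one_mul]
  simp only [e1] at h1
  simp only [pairing, dilate_apply]
  rw [h1, ← Real.exp_neg, abs_of_pos (Real.exp_pos _), ← integral_const_mul, ← integral_smul]
  refine integral_congr_ae ?_
  filter_upwards [compl_mem_ae_iff.2 (measure_singleton (0 : ℝ))] with y hy
  have hy0 : y ≠ 0 := hy
  have hpos := Real.exp_pos (-u)
  have e2 : Real.sign (Real.exp (-u) * y) = Real.sign y := by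
    rcases lt_or_gt_of_ne hy0 with h | h
    · rw [Real.sign_of_neg h, Real.sign_of_neg (mul_neg_of_pos_of_neg hpos h)]
    · rw [Real.sign_of_pos h, Real.sign_of_pos (mul_pos hpos h)]
  rw [mellinKernel_of_ne_zero δ _ (mul_ne_zero hpos.ne' hy0), mellinKernel_of_ne_zero δ _ hy0, e2,
    abs_mul, abs_of_pos hpos, Real.log_mul hpos.ne' (abs_ne_zero.2 hy0), Real.log_exp,
    Complex.real_smul, Complex.ofReal_exp]
  have e3 : ((1 - s - 1) * ((-u + Real.log |y| : ℝ) : ℂ)) =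
      u * s + (1 - s - 1) * (Real.log |y| : ℝ) := by
    push_cast
    ring
  have e4 : (u : ℂ) * (s - 1) = (-u : ℝ) + u * s := by
    push_cast
    ring
  rw [e3, e4, Complex.exp_add, Complex.exp_add]
  ring

open FourierTransform in
theorem eq_zero_of_forall_integral_exp {F : ℝ → ℂ} (hc : Continuous F) (hF : Integrable F)
    (h : ∀ u : ℝ, ∫ t : ℝ, Complex.exp (u * t * Complex.I) * F t = 0) : F = 0 := by
  have h0 : 𝓕 F = 0 := by
    ext w
    rw [Real.fourier_real_eq_integral_exp_smul, Pi.zero_apply, ← h (-2 * Real.pi * w)]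
    refine integral_congr_ae (Eventually.of_forall fun t => ?_)
    simp only [smul_eq_mul]
    congr 3
    push_cast
    ring
  have h1 := hc.fourierInv_fourier_eq hF (by rw [h0]; exact integrable_zero _ _ _)
  rw [← h1, h0]
  ext w
  simp [Real.fourierInv_eq]

/-- Take a bump at 2 supported on the positive half-line: if its pairings vanished along the whole
line, inversion would make its folded value at 2 zero, but that value is 1. -/
theorem exists_pairing_ne_zero {c : ℝ} (hc : c < 0) :
    ∃ (φ : 𝓓(puncturedLine, ℂ)) (t : ℝ), pairing δ φ (c + t * Complex.I) ≠ 0 := by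
  let b : ContDiffBump (2 : ℝ) := ⟨1 / 2, 1, by norm_num, by norm_num⟩
  have hb : ∀ x : ℝ, x ≤ 1 → b x = 0 := fun x hx => by
    refine b.zero_of_le_dist ?_
    change 1 ≤ dist x 2
    rw [Real.dist_eq, abs_of_nonpos (by linarith)]
    linarith
  have hb2 : b 2 = 1 := b.one_of_mem_closedBall (Metric.mem_closedBall_self b.rIn_pos.le)
  let ψ : 𝓓((⊤ : Opens ℝ), ℂ) := ⟨fun x => (b x : ℂ), Complex.ofRealCLM.contDiff.comp b.contDiff,
    b.hasCompactSupport.comp_left Complex.ofReal_zero, subset_univ _⟩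
  have hψ : ψ =ᶠ[𝓝 0] 0 := by
    filter_upwards [Iic_mem_nhds (zero_lt_one' ℝ)] with x hx
    change ((b x : ℝ) : ℂ) = 0
    rw [hb x hx, Complex.ofReal_zero]
  refine ⟨puncTest ψ hψ, ?_⟩
  by_contra! hall
  have h1 := symm_eq_integral δ (toSchwartz (incl (puncTest ψ hψ))) hc (x := 2) two_ne_zero
  rw [coe_toSchwartz_incl] at h1
  simp only [hall, zero_mul, integral_zero, mul_zero, symm] at h1
  have e1 : puncTest ψ hψ 2 = 1 := by
    change ((b 2 : ℝ) : ℂ) = 1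
    rw [hb2, Complex.ofReal_one]
  have e2 : puncTest ψ hψ (-2) = 0 := by
    change ((b (-2) : ℝ) : ℂ) = 0
    rw [hb _ (by norm_num), Complex.ofReal_zero]
  rw [e1, e2] at h1
  simp at h1

/-- Dilates turn the hypothesis into the vanishing of the Fourier transform of D · pairing(φ) along
the line, so this product is zero. Where some pairing is nonzero D vanishes on a piece of the line,
and the identity theorem finishes. -/
theorem eq_zero_of_lineInt_eq_zero {D : ℂ → ℂ} (hD : D ∈ entireModerate) {c : ℝ} (hc : c < 0)
    (h : ∀ φ : 𝓓(puncturedLine, ℂ), lineInt δ D c φ = 0) : D = 0 := by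
  have hz : ∀ (φ : 𝓓(puncturedLine, ℂ)) (t : ℝ),
      D (c + t * Complex.I) * pairing δ φ (c + t * Complex.I) = 0 := fun φ => by
    refine congrFun (eq_zero_of_forall_integral_exp (F := fun t : ℝ =>
      D (c + t * Complex.I) * pairing δ φ (c + t * Complex.I)) ?_
      ((stripDecay_testFunction δ hD φ c c).integrable le_rfl le_rfl) fun u => ?_)
    · exact (hD.1.continuous.comp (by fun_prop)).mul
        ((differentiable_pairing δ φ).continuous.comp (by fun_prop))
    · have h1 := h (dilate φ (Real.exp u) (Real.exp_pos u).ne')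
      have hpi : (4 * Real.pi : ℂ)⁻¹ ≠ 0 := by simp [Real.pi_ne_zero]
      have h2 := (mul_eq_zero.1 h1).resolve_left hpi
      have e1 : ∀ t : ℝ, D (c + t * Complex.I) *
          pairing δ (dilate φ (Real.exp u) (Real.exp_pos u).ne') (c + t * Complex.I) =
          Complex.exp (u * (c - 1)) * (Complex.exp (u * t * Complex.I) *
            (D (c + t * Complex.I) * pairing δ φ (c + t * Complex.I))) := fun t => by
        have e2 : (u : ℂ) * (c + t * Complex.I - 1) = u * (c - 1) + u * t * Complex.I := by ring
        rw [pairing_dilate, e2, Complex.exp_add]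
        ring
      rw [integral_congr_ae (Eventually.of_forall e1), integral_const_mul] at h2
      exact (mul_eq_zero.1 h2).resolve_left (Complex.exp_ne_zero _)
  obtain ⟨φ, t₀, ht₀⟩ := exists_pairing_ne_zero δ hc
  have hcont : Continuous fun t : ℝ => (c : ℂ) + t * Complex.I := by fun_prop
  have hev : ∀ᶠ t : ℝ in 𝓝[≠] t₀, D (c + t * Complex.I) = 0 := by
    have := (((differentiable_pairing δ φ).continuous.comp hcont).continuousAt.eventually_ne
      ht₀).filter_mono (nhdsWithin_le_nhds (s := {t₀}ᶜ))
    filter_upwards [this] with t ht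
    exact (mul_eq_zero.1 (hz φ t)).resolve_right ht
  have htend : Tendsto (fun t : ℝ => (c : ℂ) + t * Complex.I) (𝓝[≠] t₀)
      (𝓝[≠] (c + t₀ * Complex.I)) := by
    refine tendsto_nhdsWithin_iff.2 ⟨hcont.continuousAt.tendsto.mono_left nhdsWithin_le_nhds, ?_⟩
    filter_upwards [self_mem_nhdsWithin] with t ht heq
    refine ht ?_
    have := congrArg Complex.im heq
    simpa using this
  exact AnalyticOnNhd.eq_of_frequently_eq (hD.1.differentiableOn.analyticOnNhd isOpen_univ)
    analyticOnNhd_const (htend.frequently hev.frequently)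

end Uniqueness

/-! ### The isomorphism -/

section Main

variable (δ : ZMod 2)

/-- The signed Mellin transform as a linear map. -/
theorem exists_mellinTransform : ∃ M : mellinSource δ →ₗ[ℂ] entireModerate,
    ∀ σ : mellinSource δ,
      (∀ (φ : 𝓓((⊤ : Opens ℝ), ℂ)) (h : φ =ᶠ[𝓝 0] 1) (s : ℂ), Tendsto (fun n =>
        ofTempered (σ : 𝓢'(ℝ, ℂ)) (incl (mulTest (mellinKernel δ s) (contDiffOn_mellinKernel δ s)
          (exhaust φ h n)))) atTop (𝓝 ((M σ : ℂ → ℂ) s))) ∧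
      ∀ φ : 𝓓(puncturedLine, ℂ),
        ofTempered (σ : 𝓢'(ℝ, ℂ)) (incl φ) = lineInt δ (M σ : ℂ → ℂ) (-1 / 2 : ℝ) φ := by
  choose M hM hlim hline using fun σ : mellinSource δ => exists_mellin_of_mem δ σ.2
  obtain ⟨φ, χ, hpart⟩ := exists_partition
  have hφ := partition_eventuallyEq_one hpart
  refine ⟨⟨⟨fun σ => ⟨M σ, hM σ⟩, fun σ τ => ?_⟩, fun c σ => ?_⟩,
    fun σ => ⟨hlim σ, hline σ⟩⟩
  -- The choice of transforms is linear because each value is the limit of quantities linear in σ.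
  · refine Subtype.ext (funext fun s => ?_)
    exact tendsto_nhds_unique (hlim (σ + τ) φ hφ s) ((hlim σ φ hφ s).add (hlim τ φ hφ s))
  · refine Subtype.ext (funext fun s => ?_)
    exact tendsto_nhds_unique (hlim (c • σ) φ hφ s) ((hlim σ φ hφ s).const_mul c)

/-- Injectivity: a zero transform kills σ off 0, order-1 vanishing at 0 kills it on all test
functions, and their density in Schwartz space finishes. Surjectivity: the transform of
`inverseMellin` has the same line integrals as H. -/
theorem exists_mellinEquiv : ∃ M : mellinSource δ ≃ₗ[ℂ] entireModerate,
    ∀ (σ : mellinSource δ) (s z : ℂ), HasSignedMellinAt δ σ s z ↔ z = (M σ : ℂ → ℂ) s := by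
  obtain ⟨M, hM⟩ := exists_mellinTransform δ
  have hinj : Function.Injective M := by
    refine (injective_iff_map_eq_zero M).2 fun σ hσ => Subtype.ext ?_
    ext f
    refine eq_zero_of_ofTempered (σ := σ) (fun φ => (σ.2.2.1 1).eq_zero (fun ψ => ?_) φ) f
    rw [(hM σ).2 ψ, hσ, lineInt]
    simp
  have hsurj : Function.Surjective M := fun H => by
    set σ : mellinSource δ := ⟨inverseMellin δ H.2, inverseMellin_mem_mellinSource δ H.2⟩ with hσ
    refine ⟨σ, sub_eq_zero.1 (Subtype.ext ?_)⟩
    refine eq_zero_of_lineInt_eq_zero δ (c := -1 / 2) (M σ - H).2 (by norm_num) fun φ => ?_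
    have h1 := (hM σ).2 φ
    rw [hσ, ofTempered_inverseMellin_incl δ H.2 φ (-1 / 2 : ℝ), ← hσ, lineInt, lineInt] at h1
    rw [lineInt]
    have e : ∀ t : ℝ, ((M σ - H : entireModerate) : ℂ → ℂ) ((-1 / 2 : ℝ) + t * Complex.I) *
        pairing δ φ ((-1 / 2 : ℝ) + t * Complex.I) =
        (M σ : ℂ → ℂ) ((-1 / 2 : ℝ) + t * Complex.I) *
          pairing δ φ ((-1 / 2 : ℝ) + t * Complex.I) -
        (H : ℂ → ℂ) ((-1 / 2 : ℝ) + t * Complex.I) *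
          pairing δ φ ((-1 / 2 : ℝ) + t * Complex.I) := fun t => sub_mul _ _ _
    rw [integral_congr_ae (Eventually.of_forall e), integral_sub
      ((stripDecay_testFunction δ (M σ).2 φ _ _).integrable le_rfl le_rfl)
      ((stripDecay_testFunction δ H.2 φ _ _).integrable le_rfl le_rfl), mul_sub, h1, sub_self]
  exact ⟨LinearEquiv.ofBijective M ⟨hinj, hsurj⟩, fun σ s z =>
    hasSignedMellinAt_iff δ (M σ).2 (hM σ).1 (hM σ).2 s z⟩

end Main

end MellinDist
end

theorem mainTheorem2 (δ : ZMod 2) :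
    (∀ σ ∈ MellinDist.mellinSource δ, ∀ s : ℂ, ∃! z : ℂ, MellinDist.HasSignedMellinAt δ σ s z) ∧
    ∃ M : MellinDist.mellinSource δ ≃ₗ[ℂ] MellinDist.entireModerate,
      ∀ (σ : MellinDist.mellinSource δ) (s : ℂ),
        MellinDist.HasSignedMellinAt δ σ s ((M σ : ℂ → ℂ) s) := by
  obtain ⟨M, hM⟩ := MellinDist.exists_mellinEquiv δ
  exact ⟨fun σ hσ s => ⟨_, (hM ⟨σ, hσ⟩ s _).2 rfl, fun z hz => (hM ⟨σ, hσ⟩ s z).1 hz⟩,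
    M, fun σ s => (hM σ s _).2 rfl⟩
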